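/- Let $d,n\ge 1$ be integers, $1<r<\infty$, $r'=r/(r-1)$ and $\gamma>0$. A dyadic lattice $\mathscr D$ in $\mathbb R^d$ is a collection of half-open axis-parallel cubes with side lengths in $2^{\mathbb Z}$ which contains all dyadic subcubes of its members, in which any two members are dyadic subcubes of a common member, and such that every compact set is contained in some member. A family $\mathscr Q\subset\mathscr D$ is $\gamma$-sparse if there are pairwise disjoint measurable sets $E_Q\subset Q$ ($Q\in\mathscr Q$) with $|E_Q|\ge\gamma|Q|$. A matrix weight is a locally integrable, almost everywhere positive definite $W:\mathbb R^d\to\mathbb R^{n\times n}$; put $$[W]_{A_r}=\sup_Q\fint_Q\Big(\fint_Q|W^{1/r}(x)W^{-1/r}(y)|_{op}^{r'}\,dy\Big)^{r/r'}dx ,$$ the supremum being over all cubes, and $W\in A_r$ if $[W]_{A_r}<\infty$. For a Banach space $B$ let $\|\vec h\|_{L^r_{B^n}(W)}=\|W^{1/r}\vec h\|_{L^r(\mathbb R^d;B^n)}$, where $B^n$ carries the norm $(\sum_i|b_i|_B^2)^{1/2}$. There is a constant $C$, depending only on $d,n,r,\gamma$, such that the following hold for every dyadic lattice $\mathscr D$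 and every $W\in A_r$. (1) For every $\gamma$-sparse family $\mathscr Q\subset\mathscr D$ the operator $$\tilde L_rf(y)=\sum_{Q\in\mathscr Q}1_Q(y)\fint_Q|W^{-1/r}(x)W^{1/r}(y)|_{op}\,|f(x)|\,dx$$ maps $L^r(\mathbb R^d)$ to itself, and $$\|\tilde L_rf\|_{L^r}\le C\,[W]_{A_r}^{1+\frac1{r-1}-\frac1r}\,\|f\|_{L^r}\qquad\text{for all } f\in L^r(\mathbb R^d).$$ (2) Let $B_1,B_2$ be real Banach spaces, let $F$ and $G$ be linear spaces of $B_1$-valued, respectively $B_2^*$-valued, functions on $\mathbb R^d$ which are Bochner integrable on every cube of $\mathscr D$, and let $T$ be a linear operator from $F$ to the strongly measurable $B_2$-valued functions modulo equality almost everywhere, such that $x\mapsto\langle Tf(x),g(x)\rangle$ is integrable for all $f\in F$, $g\in G$. For $\vec f\in F^n$, $\vec g\in G^n$ put $\langle T\vec f,\vec g\rangle=\sum_{i=1}^n\int_{\mathbb R^d}\langle Tf_i,g_i\rangle\,dx$. Suppose that $T$ has $(L^1,L^1)$ convex body domination with constant $C_1\ge0$: for all $\vec f\in F^n$, $\vec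 g\in G^n$ there is a $\gamma$-sparse $\mathscr Q\subset\mathscr D$ with $$|\langle T\vec f,\vec g\rangle|\le C_1\sum_{Q\in\mathscr Q}|Q|\,\langle\!\langle\vec f\rangle\!\rangle_{L^1(Q,B_1)}\cdot\langle\!\langle\vec g\rangle\!\rangle_{L^1(Q,B_2^*)} .$$ Here $L^1(Q,B)$ has the normalised norm $\fint_Q|f|_B$; the convex body of $\vec x\in X^n$ is $\langle\!\langle\vec x\rangle\!\rangle_X=\{(\langle x_i,x^*\rangle)_{i=1}^n: x^*\in X^*,\ \|x^*\|\le1\}\subset\mathbb R^n$; and the product $K\cdot L=\{a\cdot b: a\in K,\ b\in L\}$ of two convex bodies, a closed interval $[-c,c]$, is identified with $c$. Then for all $\vec f\in F^n$ and $\vec g\in G^n$ $$|\langle T\vec f,\vec g\rangle|\le C\,C_1\,[W]_{A_r}^{1+\frac1{r-1}-\frac1r}\,\|\vec f\|_{L^r_{B_1^n}(W)}\,\|\vec g\|_{L^{r'}_{(B_2^*)^n}(W^{-r'/r})},$$ and, if $G$ contains all finite sums $\sum_i a_i1_{Q_i}$ with $a_i\in B_2^*$ and $Q_i\in\mathscr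 D$, then for all $\vec f\in F^n$ $$\|T\vec f\|_{L^r_{B_2^n}(W)}\le C\,C_1\,[W]_{A_r}^{1+\frac1{r-1}-\frac1r}\,\|\vec f\|_{L^r_{B_1^n}(W)} .$$ -/

import Mathlib

open MeasureTheory
open scoped ENNReal NNReal

universe u v

noncomputable section

/-! ### Cubes, dyadic lattices, sparse families -/

/-- A cube of `ℝ^d` with sides parallel to the axes, given by its lower corner and side length. -/
structure Cube (d : ℕ) where
  corner : Fin d → ℝ
  side : ℝ
  side_pos : 0 < side

namespace Cube

/-- The points of the (half-open) cube `∏ [cᵢ, cᵢ + ℓ)`. -/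
def toSet {d : ℕ} (Q : Cube d) : Set (EuclideanSpace ℝ (Fin d)) :=
  {x | ∀ i, Q.corner i ≤ x i ∧ x i < Q.corner i + Q.side}

/-- The dyadic subcubes of `Q`: for each `m`, the `2 ^ (m d)` cubes of side `ℓ / 2 ^ m` which
are obtained by `m` successive bisections of all sides of `Q`. -/
def dyadicSubcubes {d : ℕ} (Q : Cube d) : Set (Cube d) :=
  {R | ∃ (m : ℕ) (k : Fin d → ℕ), (∀ i, k i < 2 ^ m) ∧ R.side = Q.side / 2 ^ m ∧
    ∀ i, R.corner i = Q.corner i + k i * (Q.side / 2 ^ m)}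

/-- The normalised Lebesgue measure `|Q|⁻¹ 1_Q dx` of a cube. -/
def avgMeasure {d : ℕ} (Q : Cube d) : Measure (EuclideanSpace ℝ (Fin d)) :=
  (volume Q.toSet)⁻¹ • volume.restrict Q.toSet

end Cube

/-- Dyadic lattices of cubes of `ℝ^d`. -/
structure IsDyadicLattice {d : ℕ} (D : Set (Cube d)) : Prop where
  side_eq : ∀ Q ∈ D, ∃ k : ℤ, Q.side = (2 : ℝ) ^ k
  subcubes : ∀ Q ∈ D, Q.dyadicSubcubes ⊆ D
  common : ∀ Q ∈ D, ∀ R ∈ D, ∃ P ∈ D, Q ∈ P.dyadicSubcubes ∧ R ∈ P.dyadicSubcubes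
  compact_subset : ∀ K : Set (EuclideanSpace ℝ (Fin d)), IsCompact K → ∃ Q ∈ D, K ⊆ Q.toSet

/-- `γ`-sparse families: there are pairwise disjoint measurable sets `E_Q ⊆ Q`, for `Q` in the
family, with `|E_Q| ≥ γ |Q|`. -/
def IsSparse {d : ℕ} (γ : ℝ) (S : Set (Cube d)) : Prop :=
  ∃ E : Cube d → Set (EuclideanSpace ℝ (Fin d)),
    (∀ Q ∈ S, E Q ⊆ Q.toSet ∧ MeasurableSet (E Q) ∧
      ENNReal.ofReal γ * volume Q.toSet ≤ volume (E Q)) ∧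
    S.PairwiseDisjoint E

/-! ### Matrix weights -/

/-- The real power `A ^ α` of a positive definite matrix, by functional calculus. -/
def matPow {n : ℕ} (A : Matrix (Fin n) (Fin n) ℝ) (α : ℝ) : Matrix (Fin n) (Fin n) ℝ :=
  cfc (fun t : ℝ => t ^ α) A

/-- The operator norm of a matrix with respect to the Euclidean norm of `ℝ^n`. -/
def opNorm {n : ℕ} (A : Matrix (Fin n) (Fin n) ℝ) : ℝ≥0∞ :=
  ‖Matrix.toEuclideanCLM (n := Fin n) (𝕜 := ℝ) A‖ₑ

/-- Matrix weights: locally integrable and almost everywhere positive definite. -/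
structure IsMatrixWeight {d n : ℕ}
    (W : EuclideanSpace ℝ (Fin d) → Matrix (Fin n) (Fin n) ℝ) : Prop where
  locallyIntegrable : ∀ i j, LocallyIntegrable (fun x => W x i j) volume
  posDef : ∀ᵐ x ∂volume, (W x).PosDef

/-- The matrix `A_r` constant
`sup_Q ⨍_Q (⨍_Q |W^{1/r}(x) W^{-1/r}(y)|^{r'} dy)^{r/r'} dx`, over all cubes `Q`. -/
def matrixAr {d n : ℕ} (r : ℝ)
    (W : EuclideanSpace ℝ (Fin d) → Matrix (Fin n) (Fin n) ℝ) : ℝ≥0∞ :=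
  ⨆ Q : Cube d, ⨍⁻ x in Q.toSet,
    (⨍⁻ y in Q.toSet,
      opNorm (matPow (W x) (1 / r) * matPow (W y) (-(1 / r))) ^ (Real.conjExponent r) ∂volume)
      ^ (r / Real.conjExponent r) ∂volume

/-- The operator
`f ↦ ∑_{Q ∈ S} 1_Q(y) ⨍_Q |W^{-1/r}(x) W^{1/r}(y)| |f(x)| dx`, with values in `[0, ∞]`. -/
def sparseOp {d n : ℕ} (r : ℝ)
    (W : EuclideanSpace ℝ (Fin d) → Matrix (Fin n) (Fin n) ℝ) (S : Set (Cube d))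
    (f : EuclideanSpace ℝ (Fin d) → ℝ) (y : EuclideanSpace ℝ (Fin d)) : ℝ≥0∞ :=
  ∑' Q : S, (Q : Cube d).toSet.indicator (fun y =>
    ⨍⁻ x in (Q : Cube d).toSet,
      opNorm (matPow (W x) (-(1 / r)) * matPow (W y) (1 / r)) * ‖f x‖ₑ ∂volume) y

/-- The norm `‖W^{1/r} h‖_{L^r}` of `L^r_{B^n}(W)`, where `B^n` carries the norm
`(∑ |bᵢ|²)^{1/2}`. -/
def weightedNorm {d n : ℕ} {B : Type*} [NormedAddCommGroup B] [NormedSpace ℝ B] (r : ℝ)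
    (W : EuclideanSpace ℝ (Fin d) → Matrix (Fin n) (Fin n) ℝ)
    (h : Fin n → EuclideanSpace ℝ (Fin d) → B) : ℝ≥0∞ :=
  eLpNorm (fun x => WithLp.toLp 2 (fun i => ∑ j, matPow (W x) (1 / r) i j • h j x))
    (ENNReal.ofReal r) volume

/-! ### Convex bodies and convex body domination -/

/-- The convex body `{(⟨x_i, φ⟩)_i : φ ∈ X*, ‖φ‖ ≤ 1} ⊆ ℝ^n` of `x ∈ X^n`. -/
def convexBody {n : ℕ} {X : Type*} [NormedAddCommGroup X] [NormedSpace ℝ X]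
    (x : Fin n → X) : Set (Fin n → ℝ) :=
  {v | ∃ φ : StrongDual ℝ X, ‖φ‖ ≤ 1 ∧ v = fun i => φ (x i)}

/-- The Minkowski dot product of two sets. -/
def minkowskiDot {n : ℕ} (K L : Set (Fin n → ℝ)) : Set ℝ :=
  {c | ∃ a ∈ K, ∃ b ∈ L, c = ∑ i, a i * b i}

open Classical in
/-- The element of `Ł^1(Q, B)` given by a function; here `Ł^1(Q, B)` is the space of Bochner
integrable functions on `Q` with the norm `⨍_Q |f|` (the value is `0` if `f` is not integrable
on `Q`). -/
def toL1Avg {d : ℕ} {B : Type*} [NormedAddCommGroup B] (Q : Cube d)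
    (f : EuclideanSpace ℝ (Fin d) → B) : Lp B 1 Q.avgMeasure :=
  if h : MemLp f 1 Q.avgMeasure then h.toLp f else 0

/-- The number `c` such that the product of the convex bodies of `f` in `Ł^1(Q, B)` and of `g` in
`Ł^1(Q, B')` is the interval `[-c, c]`. -/
def convexBodyProd {d n : ℕ} {B B' : Type*} [NormedAddCommGroup B] [NormedSpace ℝ B]
    [NormedAddCommGroup B'] [NormedSpace ℝ B'] (Q : Cube d)
    (f : Fin n → EuclideanSpace ℝ (Fin d) → B)
    (g : Fin n → EuclideanSpace ℝ (Fin d) → B') : ℝ :=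
  sSup (minkowskiDot (convexBody fun i => toL1Avg Q (f i)) (convexBody fun i => toL1Avg Q (g i)))

/-- The form `⟨T f, g⟩ = ∑ᵢ ∫ ⟨T fᵢ(x), gᵢ(x)⟩ dx` for vectors `f`, `g` of functions. -/
def pairing {d n : ℕ} {B₁ B₂ : Type*} [NormedAddCommGroup B₁] [NormedSpace ℝ B₁]
    [NormedAddCommGroup B₂] [NormedSpace ℝ B₂]
    {F : Submodule ℝ (EuclideanSpace ℝ (Fin d) → B₁)}
    {G : Submodule ℝ (EuclideanSpace ℝ (Fin d) → StrongDual ℝ B₂)}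
    (T : F →ₗ[ℝ] (EuclideanSpace ℝ (Fin d) →ₘ[volume] B₂)) (f : Fin n → F) (g : Fin n → G) : ℝ :=
  ∑ i, ∫ x, ((g i : EuclideanSpace ℝ (Fin d) → StrongDual ℝ B₂) x) (T (f i) x) ∂volume

/-- `T`, defined on the space of functions `F` and tested against the functions in `G`, has
`(Ł^1_{B₁}, Ł^1_{B₂*})` convex body domination with respect to the lattice `D`, for vectors of
`n` functions, with sparseness parameter `γ` and constant `C₁`: the elements of `F` and `G` are
integrable on the cubes of `D`, the form `⟨T f, g⟩` is well defined on `F × G`, and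
`|⟨T f, g⟩| ≤ C₁ ∑_{Q ∈ S} |Q| ⟪f⟫_{Ł^1(Q)} · ⟪g⟫_{Ł^1(Q)}` for some `γ`-sparse `S ⊆ D`, which
may depend on `f` and `g`. -/
structure HasConvexBodyDomination {d : ℕ} (n : ℕ) {B₁ B₂ : Type*} [NormedAddCommGroup B₁]
    [NormedSpace ℝ B₁] [NormedAddCommGroup B₂] [NormedSpace ℝ B₂] (D : Set (Cube d))
    (F : Submodule ℝ (EuclideanSpace ℝ (Fin d) → B₁))
    (G : Submodule ℝ (EuclideanSpace ℝ (Fin d) → StrongDual ℝ B₂))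
    (T : F →ₗ[ℝ] (EuclideanSpace ℝ (Fin d) →ₘ[volume] B₂)) (γ : ℝ) (C₁ : ℝ≥0) : Prop where
  memLp_left : ∀ f ∈ F, ∀ Q ∈ D, MemLp f 1 Q.avgMeasure
  memLp_right : ∀ g ∈ G, ∀ Q ∈ D, MemLp g 1 Q.avgMeasure
  integrable : ∀ (f : F), ∀ g ∈ G, Integrable (fun x => (g x) (T f x)) volume
  bound : ∀ (f : Fin n → F) (g : Fin n → G), ∃ S ⊆ D, IsSparse γ S ∧
    ENNReal.ofReal |pairing T f g| ≤ C₁ * ∑' Q : S, volume (Q : Cube d).toSet *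
      ENNReal.ofReal (convexBodyProd (Q : Cube d) (fun i => (f i : EuclideanSpace ℝ (Fin d) → B₁))
        (fun i => (g i : EuclideanSpace ℝ (Fin d) → StrongDual ℝ B₂)))

/-- The space of step functions `∑ a_i 1_{Q_i}` (finite sums) with `a_i ∈ B` and cubes
`Q_i ∈ D`. -/
def stepFunctions {d : ℕ} (B : Type*) [NormedAddCommGroup B] [NormedSpace ℝ B]
    (D : Set (Cube d)) : Submodule ℝ (EuclideanSpace ℝ (Fin d) → B) :=
  Submodule.span ℝ {f | ∃ Q ∈ D, ∃ a : B, f = Q.toSet.indicator fun _ => a}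

end

/-! Write U = W^{1/r}, V = W^{-1/r}, K = [W]_{A_r}. By duality and Tonelli, the bound of the sparse
operator is a bound of the bilinear form Σ_Q ∫_Q (⨍_Q |V(x)U(y)| f(x) dx) g(y) dy. The convex body
form reduces to the same one: a functional of norm at most 1 on L^1(Q) can be traded for an average,
and inserting W^{-1/r} W^{1/r} = 1 on both sides produces the kernel |V(x)U(y)| with a loss of n^2
(`ofReal_convexBodyProd_le`).

The bilinear form is estimated in `IsWeightPair.tsum_lintegral_le`, from three ingredients.

Separation of variables (`IsWeightPair.exists_decomposition`). On a cube Q, an Auerbach basis b_i of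
ℝ^n for the norm e ↦ (⨍_Q |V e|^{r'})^{1/r'}, with dual basis c_i, gives |V(x)U(y)| ≤ Σ_i |V(x)b_i|
|U(y)c_i|, where the averages of |V b_i|^{r'} and |U c_i|^r over Q are at most 1 and K.

Reverse Hölder (`IsApWeight.reverse_holder`). The functions |U e|^r and |V e|^{r'} are scalar A_r
and A_{r'} weights with constants K and K^{1/(r-1)}, uniformly in e ≠ 0. A scalar A_p weight of
constant K gains an integrability exponent 1 + t with t comparable to 1/K. By Hölder, ⨍_Q |V b_i| f
is thus at most 4 times an L^τ average of f with τ slightly below r, and similarly for g.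

Carleson embedding (`IsSparse.tsum_laverage_rpow_le`). Summing |Q| times the r-th powers of the L^τ
averages over a sparse family costs a factor of order 1/t, that is, linear in the A_p constant.

Altogether the powers of K are 1/r from the c_i, 1/(r(r-1)) from the embedding of f and 1/r' from
that of g. Their sum is 1 + 1/(r-1) - 1/r.

To pass from the form to the norm of T f when only step functions are admissible tests, simple
approximations of W^{1/r} T f are composed with norming functionals. The resulting test functions
have finitely many functionals with bounded scalar coefficients, and dyadic averages of these
coefficients are step functions (`IsMatrixWeight.weightedNorm_le_of_stepFunctions`). -/

noncomputable section

open Filter Topology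

/-! ### Geometry of cubes -/

namespace Cube

variable {d : ℕ}

lemma toSet_eq_preimage (Q : Cube d) :
    Q.toSet = (MeasurableEquiv.toLp 2 (Fin d → ℝ)).symm ⁻¹'
      (Set.univ.pi fun i => Set.Ico (Q.corner i) (Q.corner i + Q.side)) := by
  ext x
  simp [toSet, Set.mem_pi]

@[measurability]
lemma measurableSet_toSet (Q : Cube d) : MeasurableSet Q.toSet := by
  rw [toSet_eq_preimage]
  exact (MeasurableEquiv.measurable _)
    (MeasurableSet.univ_pi fun i => measurableSet_Ico)

lemma volume_toSet (Q : Cube d) : volume Q.toSet = ENNReal.ofReal Q.side ^ d := by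
  rw [toSet_eq_preimage,
    (EuclideanSpace.volume_preserving_symm_measurableEquiv_toLp (Fin d)).measure_preimage
    (MeasurableSet.univ_pi fun i => measurableSet_Ico).nullMeasurableSet, Real.volume_pi_Ico]
  simp

lemma volume_toSet_ne_zero (Q : Cube d) : volume Q.toSet ≠ 0 := by
  rw [volume_toSet]
  exact pow_ne_zero _ (by simpa using Q.side_pos)

lemma volume_toSet_ne_top (Q : Cube d) : volume Q.toSet ≠ ∞ := by
  rw [volume_toSet]
  exact ENNReal.pow_ne_top ENNReal.ofReal_ne_top

lemma laverage_eq (Q : Cube d) (f : EuclideanSpace ℝ (Fin d) → ℝ≥0∞) :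
    ⨍⁻ x in Q.toSet, f x ∂volume = (volume Q.toSet)⁻¹ * ∫⁻ x in Q.toSet, f x := by
  rw [setLAverage_eq, ENNReal.div_eq_inv_mul]

lemma volume_mul_laverage (Q : Cube d) (f : EuclideanSpace ℝ (Fin d) → ℝ≥0∞) :
    volume Q.toSet * ⨍⁻ x in Q.toSet, f x ∂volume = ∫⁻ x in Q.toSet, f x := by
  rw [laverage_eq, ← mul_assoc, ENNReal.mul_inv_cancel Q.volume_toSet_ne_zero Q.volume_toSet_ne_top,
    one_mul]

lemma lintegral_avgMeasure (Q : Cube d) (f : EuclideanSpace ℝ (Fin d) → ℝ≥0∞) :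
    ∫⁻ x, f x ∂Q.avgMeasure = ⨍⁻ x in Q.toSet, f x ∂volume := by
  rw [laverage_eq, avgMeasure, lintegral_smul_measure, smul_eq_mul]

/-- The `2 ^ d` cubes obtained by bisecting the sides of `Q`. -/
def child (Q : Cube d) (c : Fin d → Fin 2) : Cube d where
  corner i := Q.corner i + (c i : ℕ) * (Q.side / 2)
  side := Q.side / 2
  side_pos := half_pos Q.side_pos

lemma child_mem_dyadicSubcubes (Q : Cube d) (c : Fin d → Fin 2) :
    Q.child c ∈ Q.dyadicSubcubes :=
  ⟨1, fun i => c i, fun i => by simp [(c i).2], by simp [child], fun i => by simp [child]⟩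

lemma child_subset (Q : Cube d) (c : Fin d → Fin 2) : (Q.child c).toSet ⊆ Q.toSet := by
  intro x hx i
  have h := hx i
  have hp := Q.side_pos
  simp only [child] at h
  rcases (by omega : (c i : ℕ) = 0 ∨ (c i : ℕ) = 1) with hc | hc <;> rw [hc] at h <;>
    push_cast at h <;> constructor <;> linarith

lemma iUnion_child (Q : Cube d) : ⋃ c, (Q.child c).toSet = Q.toSet := by
  refine Set.Subset.antisymm (Set.iUnion_subset fun c => Q.child_subset c) fun x hx => ?_
  refine Set.mem_iUnion.2 ⟨fun i => if x i < Q.corner i + Q.side / 2 then 0 else 1, fun i => ?_⟩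
  have h := hx i
  have hp := Q.side_pos
  by_cases hi : x i < Q.corner i + Q.side / 2
  · simp [child, hi, h.1]
  · simp only [child, hi]
    simp only [not_lt] at hi
    constructor <;> simp <;> linarith

lemma pairwise_disjoint_child (Q : Cube d) :
    Pairwise (Function.onFun Disjoint fun c => (Q.child c).toSet) := by
  intro c c' hcc
  rw [Function.onFun, Set.disjoint_left]
  intro x hx hx'
  apply hcc
  ext i
  have h := hx i
  have h' := hx' i
  have hp := Q.side_pos
  simp only [child] at h h'
  have h1 : ((c i : ℕ) : ℝ) < (c' i : ℕ) + 1 := by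
    by_contra hcon
    push Not at hcon
    nlinarith
  have h2 : ((c' i : ℕ) : ℝ) < (c i : ℕ) + 1 := by
    by_contra hcon
    push Not at hcon
    nlinarith
  norm_cast at h1 h2
  omega

lemma two_pow_mul_volume_child (Q : Cube d) (c : Fin d → Fin 2) :
    2 ^ d * volume (Q.child c).toSet = volume Q.toSet := by
  rw [volume_toSet, volume_toSet, ← mul_pow]
  congr 1
  rw [child, ← ENNReal.ofReal_ofNat, ← ENNReal.ofReal_mul (by norm_num)]
  congr 1
  ring

/-- The step function on the dyadic subcubes of `Q` of generation `N` whose values are given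
by `a`. -/
def dyadicStep {M : Type*} [AddCommMonoid M] (a : Cube d → M) :
    ℕ → Cube d → EuclideanSpace ℝ (Fin d) → M
  | 0, Q => Q.toSet.indicator fun _ => a Q
  | N + 1, Q => fun x => ∑ c, dyadicStep a N (Q.child c) x

lemma dyadicStep_of_notMem {M : Type*} [AddCommMonoid M] (a : Cube d → M) (N : ℕ) (Q : Cube d)
    {x : EuclideanSpace ℝ (Fin d)} (hx : x ∉ Q.toSet) : dyadicStep a N Q x = 0 := by
  induction N generalizing Q with
  | zero => simp [dyadicStep, hx]
  | succ N ih =>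
    rw [dyadicStep]
    exact Finset.sum_eq_zero fun c _ => ih _ fun h => hx (Q.child_subset c h)

lemma exists_dyadicStep_eq {M : Type*} [AddCommMonoid M] (a : Cube d → M) (N : ℕ) (Q : Cube d)
    {x : EuclideanSpace ℝ (Fin d)} (hx : x ∈ Q.toSet) :
    ∃ R : Cube d, x ∈ R.toSet ∧ R.toSet ⊆ Q.toSet ∧ R.side = Q.side / 2 ^ N ∧
      dyadicStep a N Q x = a R := by
  induction N generalizing Q with
  | zero => exact ⟨Q, hx, subset_rfl, by simp, by simp [dyadicStep, hx]⟩
  | succ N ih =>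
    rw [← iUnion_child, Set.mem_iUnion] at hx
    obtain ⟨c, hc⟩ := hx
    obtain ⟨R, h1, h2, h3, h4⟩ := ih _ hc
    refine ⟨R, h1, h2.trans (Q.child_subset c), ?_, ?_⟩
    · rw [h3, child, pow_succ]
      field_simp
    · simp only [dyadicStep]
      rw [Finset.sum_eq_single c, h4]
      · intro c' _ hne
        refine dyadicStep_of_notMem _ _ _ fun h => ?_
        exact Set.disjoint_left.1 (Q.pairwise_disjoint_child hne) h hc
      · simp

lemma measurable_dyadicStep {M : Type*} [AddCommMonoid M] [MeasurableSpace M] [MeasurableAdd₂ M]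
    (a : Cube d → M) (N : ℕ) (Q : Cube d) : Measurable (dyadicStep a N Q) := by
  induction N generalizing Q with
  | zero => exact measurable_const.indicator Q.measurableSet_toSet
  | succ N ih =>
    simp only [dyadicStep]
    exact Finset.measurable_sum _ fun c _ => ih _

/-- The radius √d times the side would do; the factor d + 1 avoids the root and stays positive for d
= 0. -/
lemma toSet_subset_closedBall (Q : Cube d) {x : EuclideanSpace ℝ (Fin d)} (hx : x ∈ Q.toSet) :
    Q.toSet ⊆ Metric.closedBall x ((d + 1) * Q.side) := by
  intro y hy
  rw [Metric.mem_closedBall, EuclideanSpace.dist_eq]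
  refine Real.sqrt_le_iff.2 ⟨by have := Q.side_pos; positivity, ?_⟩
  have hs := Q.side_pos
  calc ∑ i, dist (y i) (x i) ^ 2 ≤ ∑ i : Fin d, Q.side ^ 2 := by
        refine Finset.sum_le_sum fun i _ => ?_
        have h := hx i
        have h' := hy i
        rw [Real.dist_eq, sq_abs]
        apply sq_le_sq'  <;> linarith
    _ = d * Q.side ^ 2 := by simp
    _ ≤ ((d + 1) * Q.side) ^ 2 := by
        rw [mul_pow]
        gcongr
        nlinarith [(Nat.cast_nonneg d : (0:ℝ) ≤ d)]

lemma isBounded_toSet (Q : Cube d) : Bornology.IsBounded Q.toSet := by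
  rcases Q.toSet.eq_empty_or_nonempty with h | ⟨x, hx⟩
  · simp [h]
  · exact Metric.isBounded_closedBall.subset (Q.toSet_subset_closedBall hx)

/-- Lebesgue differentiation along cubes which contain the point. -/
theorem ae_tendsto_setAverage {f : EuclideanSpace ℝ (Fin d) → ℝ}
    (hf : LocallyIntegrable f volume) :
    ∀ᵐ x ∂(volume : Measure (EuclideanSpace ℝ (Fin d))), ∀ R : ℕ → Cube d,
      (∀ N, x ∈ (R N).toSet) → Tendsto (fun N => (R N).side) atTop (𝓝 0) →
      Tendsto (fun N => ⨍ y in (R N).toSet, f y ∂volume) atTop (𝓝 (f x)) := by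
  filter_upwards [IsUnifLocDoublingMeasure.ae_tendsto_average_norm_sub
    (μ := (volume : Measure (EuclideanSpace ℝ (Fin d)))) hf 1] with x hx R hxR hR
  have hlim : Tendsto (fun N => (d + 1 : ℝ) * (R N).side) atTop (𝓝[>] 0) := by
    refine tendsto_nhdsWithin_iff.2 ⟨?_, Eventually.of_forall fun N => ?_⟩
    · simpa using hR.const_mul (d + 1 : ℝ)
    · have := (R N).side_pos
      simp only [Set.mem_Ioi]
      positivity
  have h := hx (fun _ : ℕ => x) _ hlim (Eventually.of_forall fun N => by
    have := (R N).side_pos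
    exact Metric.mem_closedBall_self (by positivity))
  -- The ratio of the volume of a ball of radius (d + 1)ℓ to that of a cube of side ℓ. It does not
  -- depend on ℓ, so averages over cubes containing x are controlled by averages over balls centred
  -- at x.
  set c : ℝ := ((d + 1 : ℝ) ^ d * (volume (Metric.closedBall (0 : EuclideanSpace ℝ (Fin d)) 1)).toReal)
  rw [tendsto_iff_norm_sub_tendsto_zero]
  refine squeeze_zero (fun N => norm_nonneg _) (fun N => ?_) (by simpa using h.const_mul c)
  have hs := (R N).side_pos
  have hi : ∀ s : Set (EuclideanSpace ℝ (Fin d)), Bornology.IsBounded s → IntegrableOn f s := by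
    intro s hs
    exact (hf.integrableOn_isCompact hs.isCompact_closure).mono_set subset_closure
  have hi1 := hi _ (R N).isBounded_toSet
  have hi2 := hi (Metric.closedBall x ((d + 1) * (R N).side)) Metric.isBounded_closedBall
  have hB : volume (Metric.closedBall x ((d + 1) * (R N).side)) ≠ ∞ :=
    measure_closedBall_lt_top.ne
  have hBpos : 0 < (volume (Metric.closedBall x ((d + 1) * (R N).side))).toReal :=
    ENNReal.toReal_pos (Metric.measure_closedBall_pos _ _ (by positivity)).ne' hB
  have hvB : (volume (Metric.closedBall x ((d + 1) * (R N).side))).toReal =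
      c * (volume (R N).toSet).toReal := by
    rw [Measure.addHaar_closedBall' _ _ (by positivity), volume_toSet]
    simp [c, finrank_euclideanSpace, mul_pow, ENNReal.toReal_mul, ENNReal.toReal_pow, hs.le]
    rw [ENNReal.toReal_ofReal (by positivity)]
    ring
  have hRpos : 0 < (volume (R N).toSet).toReal :=
    ENNReal.toReal_pos (R N).volume_toSet_ne_zero (R N).volume_toSet_ne_top
  calc ‖(⨍ y in (R N).toSet, f y) - f x‖
      = ‖⨍ y in (R N).toSet, (f y - f x)‖ := by
        nth_rw 1 [← setAverage_const (R N).volume_toSet_ne_zero (R N).volume_toSet_ne_top (f x)]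
        simp_rw [setAverage_eq]
        rw [integral_sub hi1 (integrableOn_const (R N).volume_toSet_ne_top), smul_sub]
    _ ≤ ⨍ y in (R N).toSet, ‖f y - f x‖ := by
        rw [setAverage_eq, setAverage_eq, norm_smul, smul_eq_mul]
        gcongr
        · simp [measureReal_def]
        · exact norm_integral_le_integral_norm _
    _ ≤ (volume (R N).toSet).toReal⁻¹ *
          ∫ y in Metric.closedBall x ((d + 1) * (R N).side), ‖f y - f x‖ := by
        rw [setAverage_eq, smul_eq_mul, measureReal_def]
        gcongr
        · exact ae_of_all _ fun _ => norm_nonneg _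
        · exact (hi2.sub (integrableOn_const hB)).norm
        · exact (R N).toSet_subset_closedBall (hxR N)
    _ = c * ⨍ y in Metric.closedBall x ((d + 1) * (R N).side), ‖f y - f x‖ := by
        rw [setAverage_eq, smul_eq_mul, measureReal_def, hvB]
        have : c ≠ 0 := by
          rintro h0
          rw [hvB, h0] at hBpos
          simp at hBpos
        field_simp

end Cube

/-! ### Dyadic lattices -/

/-- In units of the finer side, R has integer coordinates [b, b + 1) and Q is the block [a 2^j, (a +
1) 2^j). In each coordinate an integer cell is inside the block or disjoint from it. -/
lemma Cube.subset_or_disjoint_of_mem_dyadicSubcubes {d : ℕ} {P Q R : Cube d} {m k : ℕ}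
    {a b : Fin d → ℕ} (hmk : m ≤ k) (hQ : Q.side = P.side / 2 ^ m)
    (hQ' : ∀ i, Q.corner i = P.corner i + a i * (P.side / 2 ^ m))
    (hR : R.side = P.side / 2 ^ k)
    (hR' : ∀ i, R.corner i = P.corner i + b i * (P.side / 2 ^ k)) :
    R.toSet ⊆ Q.toSet ∨ Disjoint Q.toSet R.toSet := by
  obtain ⟨j, rfl⟩ := Nat.exists_eq_add_of_le hmk
  have hs : P.side / 2 ^ m = 2 ^ j * (P.side / 2 ^ (m + j)) := by
    rw [pow_add]; field_simp
  have hp : 0 < P.side / 2 ^ (m + j) := div_pos P.side_pos (by positivity)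
  set t := P.side / 2 ^ (m + j)
  rw [hs] at hQ
  simp only [hs] at hQ'
  by_cases h : ∀ i, a i * 2 ^ j ≤ b i ∧ b i + 1 ≤ (a i + 1) * 2 ^ j
  · left
    intro x hx i
    have hi := hx i
    rw [hR', hR] at hi
    rw [hQ', hQ]
    obtain ⟨h1, h2⟩ := h i
    have h1' : (a i : ℝ) * 2 ^ j ≤ b i := mod_cast h1
    have h2' : (b i : ℝ) + 1 ≤ (a i + 1) * 2 ^ j := mod_cast h2
    constructor <;> nlinarith
  · right
    push Not at h
    obtain ⟨i, hi⟩ := h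
    rw [Set.disjoint_left]
    intro x hx hx'
    have h1 := hx i
    have h2 := hx' i
    rw [hR', hR] at h2
    rw [hQ', hQ] at h1
    have h3 : (a i : ℝ) * 2 ^ j < b i + 1 := by
      by_contra hcon
      push Not at hcon
      nlinarith
    have h4 : (b i : ℝ) < (a i + 1) * 2 ^ j := by
      by_contra hcon
      push Not at hcon
      nlinarith
    have h3' : a i * 2 ^ j < b i + 1 := mod_cast h3
    have h4' : b i < (a i + 1) * 2 ^ j := mod_cast h4
    have := hi (by omega)
    omega

/-- A family of cubes any two of which are nested or disjoint. -/
def IsNested {d : ℕ} (S : Set (Cube d)) : Prop :=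
  ∀ Q ∈ S, ∀ R ∈ S, Q.toSet ⊆ R.toSet ∨ R.toSet ⊆ Q.toSet ∨ Disjoint Q.toSet R.toSet

lemma IsNested.mono {d : ℕ} {S S' : Set (Cube d)} (h : IsNested S) (hS : S' ⊆ S) : IsNested S' :=
  fun Q hQ R hR => h Q (hS hQ) R (hS hR)

lemma IsDyadicLattice.isNested {d : ℕ} {D : Set (Cube d)} (hD : IsDyadicLattice D) :
    IsNested D := by
  intro Q hQ R hR
  obtain ⟨P, -, ⟨m, a, -, h1, h2⟩, ⟨k, b, -, h3, h4⟩⟩ := hD.common Q hQ R hR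
  rcases le_total m k with h | h
  · rcases Cube.subset_or_disjoint_of_mem_dyadicSubcubes h h1 h2 h3 h4 with h | h
    · exact Or.inr (Or.inl h)
    · exact Or.inr (Or.inr h)
  · rcases Cube.subset_or_disjoint_of_mem_dyadicSubcubes h h3 h4 h1 h2 with h | h
    · exact Or.inl h
    · exact Or.inr (Or.inr h.symm)

/-- A finite family of nested sets contains a disjoint subfamily with the same union. -/
lemma IsNested.exists_pairwiseDisjoint {d : ℕ} (s : Finset (Cube d))
    (hs : IsNested (s : Set (Cube d))) :
    ∃ t ⊆ s, (t : Set (Cube d)).PairwiseDisjoint Cube.toSet ∧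
      ⋃ Q ∈ s, Q.toSet ⊆ ⋃ Q ∈ t, Q.toSet := by
  classical
  induction s using Finset.induction_on with
  | empty => exact ⟨∅, by simp⟩
  | insert Q s _ ih =>
    obtain ⟨t, hts, htd, htu⟩ := ih (hs.mono (by simp))
    by_cases h : ∃ R ∈ t, Q.toSet ⊆ R.toSet
    · obtain ⟨R, hR, hQR⟩ := h
      refine ⟨t, hts.trans (Finset.subset_insert _ _), htd, ?_⟩
      rw [Finset.set_biUnion_insert]
      exact Set.union_subset (hQR.trans (Set.subset_biUnion_of_mem (u := Cube.toSet) hR)) htu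
    · push Not at h
      -- As Q lies in no cube of t, each cube of t that meets Q is contained in Q and can be
      -- dropped.
      refine ⟨insert Q (t.filter fun R => Disjoint Q.toSet R.toSet), ?_, ?_, ?_⟩
      · exact Finset.insert_subset_insert _ ((Finset.filter_subset _ _).trans hts)
      · rw [Finset.coe_insert]
        refine Set.PairwiseDisjoint.insert (htd.subset ?_) ?_
        · exact_mod_cast Finset.filter_subset _ _
        · intro R hR _
          exact (Finset.mem_filter.1 hR).2
      · rw [Finset.set_biUnion_insert, Finset.set_biUnion_insert]
        refine Set.union_subset Set.subset_union_left (htu.trans ?_)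
        refine Set.iUnion₂_subset fun R hR => ?_
        rcases hs Q (by simp) R (by simp [hts hR]) with h' | h' | h'
        · exact absurd h' (h R hR)
        · exact h'.trans Set.subset_union_left
        · refine Set.subset_union_of_subset_right ?_ _
          exact Set.subset_biUnion_of_mem (u := Cube.toSet) (Finset.mem_filter.2 ⟨hR, h'⟩)

/-! ### Dyadic averages, stopping times and the reverse Hölder inequality -/

namespace Cube

variable {d : ℕ}

lemma lintegral_eq_sum_child (Q : Cube d) (f : EuclideanSpace ℝ (Fin d) → ℝ≥0∞) :
    ∫⁻ x in Q.toSet, f x = ∑ c, ∫⁻ x in (Q.child c).toSet, f x := by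
  conv_lhs => rw [← iUnion_child]
  rw [lintegral_iUnion (fun c => measurableSet_toSet _) Q.pairwise_disjoint_child, tsum_fintype]

lemma dyadicStep_succ_of_mem {M : Type*} [AddCommMonoid M] (a : Cube d → M) (N : ℕ) (Q : Cube d)
    {c : Fin d → Fin 2} {x : EuclideanSpace ℝ (Fin d)} (hx : x ∈ (Q.child c).toSet) :
    dyadicStep a (N + 1) Q x = dyadicStep a N (Q.child c) x := by
  simp only [dyadicStep]
  refine Finset.sum_eq_single c (fun c' _ hne => ?_) (by simp)
  exact dyadicStep_of_notMem _ _ _ fun h =>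
    Set.disjoint_left.1 (Q.pairwise_disjoint_child hne) h hx

lemma laverage_child_le (Q : Cube d) (c : Fin d → Fin 2) (w : EuclideanSpace ℝ (Fin d) → ℝ≥0∞) :
    ⨍⁻ x in (Q.child c).toSet, w x ∂volume ≤ 2 ^ d * ⨍⁻ x in Q.toSet, w x ∂volume := by
  rw [laverage_eq, laverage_eq, ← Q.two_pow_mul_volume_child c,
    ENNReal.mul_inv (by simp) (by simp), ← mul_assoc, ← mul_assoc,
    ENNReal.mul_inv_cancel (by simp) (by simp), one_mul]
  gcongr
  exact Q.child_subset c

/-- Lebesgue differentiation for the integrable function 1_Q w, along the shrinking dyadic subcubes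
of Q that contain x. These lie in Q, so the indicator does not change the averages. -/
lemma ae_tendsto_dyadicStep_laverage (Q : Cube d) {w : EuclideanSpace ℝ (Fin d) → ℝ≥0∞}
    (hw : AEMeasurable w) (hfin : ∫⁻ x in Q.toSet, w x ≠ ∞) :
    ∀ᵐ x ∂volume.restrict Q.toSet,
      Tendsto (fun N => dyadicStep (fun R => ⨍⁻ y in R.toSet, w y ∂volume) N Q x)
        atTop (𝓝 (w x)) := by
  have hint : Integrable (fun x => (Q.toSet.indicator w x).toReal) := by
    refine integrable_toReal_of_lintegral_ne_top (hw.indicator Q.measurableSet_toSet) ?_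
    rwa [lintegral_indicator Q.measurableSet_toSet]
  have hwf : ∀ᵐ x ∂volume.restrict Q.toSet, w x < ∞ := ae_lt_top' hw.restrict hfin
  filter_upwards [ae_restrict_of_ae (ae_tendsto_setAverage hint.locallyIntegrable), hwf,
    ae_restrict_mem Q.measurableSet_toSet] with x hx hxf hxQ
  choose R hxR hRQ hRs hRe using fun N => exists_dyadicStep_eq
    (fun R => ⨍⁻ y in R.toSet, w y ∂volume) N Q hxQ
  have hlim : Tendsto (fun N => (R N).side) atTop (𝓝 0) := by
    simp only [hRs]
    have := (tendsto_pow_atTop_nhds_zero_of_lt_one (r := (1 / 2 : ℝ)) (by norm_num)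
      (by norm_num)).const_mul Q.side
    simpa [div_eq_mul_inv] using this
  have h := ENNReal.tendsto_ofReal (hx R hxR hlim)
  simp only [Set.indicator_of_mem hxQ, ENNReal.ofReal_toReal hxf.ne] at h
  refine h.congr fun N => ?_
  rw [hRe, laverage_eq, setAverage_eq, smul_eq_mul]
  have h1 : ∫⁻ y in (R N).toSet, Q.toSet.indicator w y = ∫⁻ y in (R N).toSet, w y :=
    setLIntegral_congr_fun (R N).measurableSet_toSet fun y hy => by
      simp [hRQ N hy]
  have h2 : ∫⁻ y in (R N).toSet, w y ≠ ∞ :=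
    ne_top_of_le_ne_top hfin (lintegral_mono_set (hRQ N))
  rw [integral_toReal (hw.indicator Q.measurableSet_toSet).restrict
    (ae_lt_top' (hw.indicator Q.measurableSet_toSet).restrict (h1 ▸ h2)), h1, measureReal_def,
    ← ENNReal.toReal_inv, ← ENNReal.toReal_mul, ENNReal.ofReal_toReal]
  exact ENNReal.mul_ne_top (ENNReal.inv_ne_top.2 (volume_toSet_ne_zero _)) h2

/-- The step from the children to the parent, shared by the construction of stopping sets and by the
induction for the reverse Hölder inequality. The sets chosen in different children are disjoint, so
both estimates add up. -/
lemma stopping_union (w : EuclideanSpace ℝ (Fin d) → ℝ≥0∞) (Q : Cube d) (N : ℕ)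
    (a : Cube d → ℝ≥0∞) (l A B : ℝ≥0∞) {t : ℝ}
    (h : ∀ c, ∃ O ⊆ (Q.child c).toSet, MeasurableSet O ∧ l * volume O ≤ ∫⁻ x in O, w x ∧
      ∫⁻ x in (Q.child c).toSet, dyadicStep a N (Q.child c) x ^ t ≤
        A * (∫⁻ x in (Q.child c).toSet \ O, w x) + B * ∫⁻ x in O, w x) :
    ∃ O ⊆ Q.toSet, MeasurableSet O ∧ l * volume O ≤ ∫⁻ x in O, w x ∧
      ∫⁻ x in Q.toSet, dyadicStep a (N + 1) Q x ^ t ≤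
        A * (∫⁻ x in Q.toSet \ O, w x) + B * ∫⁻ x in O, w x := by
  choose O hO hOm hOl hOb using h
  have hd : Pairwise (Function.onFun Disjoint O) := fun c c' hcc =>
    (Q.pairwise_disjoint_child hcc).mono (hO c) (hO c')
  have hd' : Pairwise (Function.onFun Disjoint fun c => (Q.child c).toSet \ O c) :=
    fun c c' hcc => (Q.pairwise_disjoint_child hcc).mono Set.sdiff_subset Set.sdiff_subset
  refine ⟨⋃ c, O c, ?_, MeasurableSet.iUnion hOm, ?_, ?_⟩
  · rw [← iUnion_child]
    exact Set.iUnion_mono hO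
  · rw [measure_iUnion hd hOm, lintegral_iUnion hOm hd, ← ENNReal.tsum_mul_left]
    exact ENNReal.tsum_le_tsum hOl
  · have h1 : ⋃ c, (Q.child c).toSet \ O c ⊆ Q.toSet \ ⋃ c, O c := by
      refine Set.iUnion_subset fun c x hx => ⟨Q.child_subset c hx.1, ?_⟩
      simp only [Set.mem_iUnion, not_exists]
      intro c' hx'
      by_cases hcc : c' = c
      · exact hx.2 (hcc ▸ hx')
      · exact Set.disjoint_left.1 (Q.pairwise_disjoint_child hcc) (hO c' hx') hx.1
    calc ∫⁻ x in Q.toSet, dyadicStep a (N + 1) Q x ^ t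
        = ∑ c, ∫⁻ x in (Q.child c).toSet, dyadicStep a N (Q.child c) x ^ t := by
          rw [lintegral_eq_sum_child]
          refine Finset.sum_congr rfl fun c _ =>
            setLIntegral_congr_fun (measurableSet_toSet _) fun x hx => ?_
          simp only [dyadicStep_succ_of_mem a N Q hx]
      _ ≤ ∑ c, (A * (∫⁻ x in (Q.child c).toSet \ O c, w x) + B * ∫⁻ x in O c, w x) :=
          Finset.sum_le_sum fun c _ => hOb c
      _ = A * (∫⁻ x in ⋃ c, (Q.child c).toSet \ O c, w x) + B * ∫⁻ x in ⋃ c, O c, w x := by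
          rw [lintegral_iUnion hOm hd,
            lintegral_iUnion (fun c => (measurableSet_toSet _).diff (hOm c)) hd',
            tsum_fintype, tsum_fintype, Finset.sum_add_distrib, Finset.mul_sum, Finset.mul_sum]
      _ ≤ _ := by gcongr

lemma lintegral_dyadicStep_zero (Q : Cube d) (w : EuclideanSpace ℝ (Fin d) → ℝ≥0∞) {t : ℝ}
    (ht : 0 ≤ t) :
    ∫⁻ x in Q.toSet, dyadicStep (fun R => ⨍⁻ y in R.toSet, w y ∂volume) 0 Q x ^ (1 + t) =
      (⨍⁻ y in Q.toSet, w y ∂volume) ^ t * ∫⁻ x in Q.toSet, w x := by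
  rw [setLIntegral_congr_fun (g := fun _ => (⨍⁻ y in Q.toSet, w y ∂volume) ^ (1 + t))
    Q.measurableSet_toSet fun x hx => by simp [dyadicStep, hx], setLIntegral_const,
    ← volume_mul_laverage, ENNReal.rpow_add_of_nonneg _ _ zero_le_one ht, ENNReal.rpow_one]
  ring

/-- The stopping time argument: on the complement of `O` the averages are at most `l`. -/
lemma exists_stopping (w : EuclideanSpace ℝ (Fin d) → ℝ≥0∞) {t : ℝ} (ht : 0 ≤ t) (X l : ℝ≥0∞)
    (N : ℕ) (hP : ∀ j ≤ N, ∀ Q : Cube d,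
      ∫⁻ x in Q.toSet, dyadicStep (fun R => ⨍⁻ y in R.toSet, w y ∂volume) j Q x ^ (1 + t) ≤
        X * (⨍⁻ y in Q.toSet, w y ∂volume) ^ t * ∫⁻ x in Q.toSet, w x)
    (Q : Cube d) (hQ : ⨍⁻ y in Q.toSet, w y ∂volume ≤ 2 ^ d * l) :
    ∃ O ⊆ Q.toSet, MeasurableSet O ∧ l * volume O ≤ ∫⁻ x in O, w x ∧
      ∫⁻ x in Q.toSet, dyadicStep (fun R => ⨍⁻ y in R.toSet, w y ∂volume) N Q x ^ (1 + t) ≤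
        l ^ t * (∫⁻ x in Q.toSet \ O, w x) + X * (2 ^ d * l) ^ t * ∫⁻ x in O, w x := by
  -- A cube whose average exceeds l is stopped as a whole. Since that average is still at most 2^d
  -- l, the hypothesis `hP` bounds it by the second term alone.
  by_cases hl : l < ⨍⁻ y in Q.toSet, w y ∂volume
  · refine ⟨Q.toSet, subset_rfl, Q.measurableSet_toSet, ?_, ?_⟩
    · rw [← volume_mul_laverage, mul_comm]
      gcongr
    · refine (hP N le_rfl Q).trans (le_add_left ?_)
      gcongr
  push Not at hl
  induction N generalizing Q with
  | zero =>
    refine ⟨∅, Set.empty_subset _, MeasurableSet.empty, by simp, ?_⟩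
    rw [lintegral_dyadicStep_zero _ _ ht]
    simp only [Set.sdiff_empty, Measure.restrict_empty, lintegral_zero_measure, mul_zero, add_zero]
    gcongr
  | succ N ih =>
    refine stopping_union w Q N _ l _ _ fun c => ?_
    -- The parent was not stopped, so passing to a child raises the average to at most 2^d l.
    have hc : ⨍⁻ y in (Q.child c).toSet, w y ∂volume ≤ 2 ^ d * l :=
      (Q.laverage_child_le c w).trans (by gcongr)
    by_cases hl' : l < ⨍⁻ y in (Q.child c).toSet, w y ∂volume
    · refine ⟨(Q.child c).toSet, subset_rfl, measurableSet_toSet _, ?_, ?_⟩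
      · rw [← volume_mul_laverage, mul_comm]
        gcongr
      · refine (hP N (Nat.le_succ N) _).trans (le_add_left ?_)
        gcongr
    · push Not at hl'
      exact ih (fun j hj => hP j (hj.trans (Nat.le_succ N))) _ hc hl'

/-- Stop at height 2m, where m is the average of w over Q. The stopped set O satisfies 2m|O| ≤ w(O)
≤ w(Q) = m|Q|, so it fills at most half of Q, and with u = w(Q \ O), v = w(O) the hypothesis `hδ`
gives δ v ≤ u. Off O the step function is at most 2m and contributes (2m)^t u. On O the induction
hypothesis contributes 2 · 2^t m^t (2^{d+1})^t v ≤ 2 · 2^t m^t (v + u/2). The sum is exactly 2 · 2^t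
m^t (u + v), which explains the constant. Induction on the generation N replaces an absorption
argument that would need ∫ w^{1+t} to be finite beforehand. -/
lemma lintegral_dyadicStep_rpow_le {w : EuclideanSpace ℝ (Fin d) → ℝ≥0∞} {t : ℝ} (ht : 0 ≤ t)
    (hfin : ∀ Q : Cube d, ∫⁻ x in Q.toSet, w x ≠ ∞) (hpos : ∀ Q : Cube d, ∫⁻ x in Q.toSet, w x ≠ 0)
    {δ : ℝ≥0∞} (hδ : ∀ Q : Cube d, ∀ O ⊆ Q.toSet, MeasurableSet O → 2 * volume O ≤ volume Q.toSet →
      δ * ∫⁻ x in Q.toSet, w x ≤ ∫⁻ x in Q.toSet \ O, w x)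
    (htδ : ((2 : ℝ≥0∞) ^ (d + 1)) ^ t ≤ 1 + δ / 2) (N : ℕ) (Q : Cube d) :
    ∫⁻ x in Q.toSet, dyadicStep (fun R => ⨍⁻ y in R.toSet, w y ∂volume) N Q x ^ (1 + t) ≤
      2 * 2 ^ t * (⨍⁻ y in Q.toSet, w y ∂volume) ^ t * ∫⁻ x in Q.toSet, w x := by
  induction N using Nat.strong_induction_on generalizing Q with
  | _ N ih =>
  match N, ih with
  | 0, _ =>
    rw [lintegral_dyadicStep_zero _ _ ht, mul_assoc]
    refine le_mul_of_one_le_left' ?_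
    exact one_le_mul one_le_two (by simpa using ENNReal.rpow_le_rpow one_le_two ht)
  | N + 1, ih =>
    set m := ⨍⁻ y in Q.toSet, w y ∂volume with hm
    have hm0 : m ≠ 0 := by
      intro h
      apply hpos Q
      rw [← volume_mul_laverage, ← hm, h, mul_zero]
    have hmt : m ≠ ∞ := by
      rw [hm, laverage_eq]
      exact ENNReal.mul_ne_top (ENNReal.inv_ne_top.2 (volume_toSet_ne_zero _)) (hfin Q)
    obtain ⟨O, hOQ, hOm, hOl, hOb⟩ := stopping_union w Q N
      (fun R => ⨍⁻ y in R.toSet, w y ∂volume) (2 * m) ((2 * m) ^ t)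
      (2 * 2 ^ t * (2 ^ d * (2 * m)) ^ t) (t := 1 + t) fun c =>
        exists_stopping w ht _ _ N (fun j hj => ih j (Nat.lt_succ_of_le hj)) _
          ((Q.laverage_child_le c w).trans (by
            gcongr; exact le_mul_of_one_le_left' one_le_two))
    have hO2 : 2 * volume O ≤ volume Q.toSet := by
      have h1 : m * (2 * volume O) ≤ m * volume Q.toSet := by
        calc m * (2 * volume O) = 2 * m * volume O := by ring
          _ ≤ ∫⁻ x in O, w x := hOl
          _ ≤ ∫⁻ x in Q.toSet, w x := lintegral_mono_set hOQ
          _ = m * volume Q.toSet := by rw [← volume_mul_laverage, mul_comm]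
      exact (ENNReal.mul_le_mul_iff_right hm0 hmt).1 h1
    have hu := hδ Q O hOQ hOm hO2
    set u := ∫⁻ x in Q.toSet \ O, w x
    set v := ∫⁻ x in O, w x
    have huv : ∫⁻ x in Q.toSet, w x = u + v := by
      rw [add_comm, ← lintegral_inter_add_sdiff w Q.toSet hOm, Set.inter_eq_right.2 hOQ]
    rw [huv] at hu ⊢
    calc _ ≤ _ := hOb
      _ = 2 ^ t * m ^ t * u + 2 * 2 ^ t * m ^ t * ((2 ^ (d + 1)) ^ t * v) := by
        have : (2 : ℝ≥0∞) ^ d * (2 * m) = 2 ^ (d + 1) * m := by ring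
        rw [this, ENNReal.mul_rpow_of_nonneg _ _ ht, ENNReal.mul_rpow_of_nonneg _ _ ht]
        ring
      _ ≤ 2 ^ t * m ^ t * u + 2 * 2 ^ t * m ^ t * (v + u / 2) := by
        gcongr
        calc (2 ^ (d + 1)) ^ t * v ≤ (1 + δ / 2) * v := by gcongr
          _ = v + δ * v / 2 := by rw [add_mul, one_mul, ENNReal.mul_div_right_comm]
          _ ≤ v + u / 2 := by
            gcongr
            refine le_trans ?_ hu
            gcongr
            exact le_add_self
      _ = 2 * 2 ^ t * m ^ t * (u + v) := by
        have h2 : 2 * (u / 2) = u := ENNReal.mul_div_cancel (by simp) (by simp)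
        calc _ = 2 ^ t * m ^ t * u + (2 * 2 ^ t * m ^ t * v + 2 ^ t * m ^ t * (2 * (u / 2))) := by
              ring
          _ = _ := by rw [h2]; ring

/-- The reverse Hölder inequality, with the sharp dependence of the exponent. -/
theorem reverse_holder {w : EuclideanSpace ℝ (Fin d) → ℝ≥0∞} (hw : AEMeasurable w) {t : ℝ}
    (ht : 0 ≤ t)
    (hfin : ∀ Q : Cube d, ∫⁻ x in Q.toSet, w x ≠ ∞) (hpos : ∀ Q : Cube d, ∫⁻ x in Q.toSet, w x ≠ 0)
    {δ : ℝ≥0∞} (hδ : ∀ Q : Cube d, ∀ O ⊆ Q.toSet, MeasurableSet O → 2 * volume O ≤ volume Q.toSet →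
      δ * ∫⁻ x in Q.toSet, w x ≤ ∫⁻ x in Q.toSet \ O, w x)
    (htδ : ((2 : ℝ≥0∞) ^ (d + 1)) ^ t ≤ 1 + δ / 2) (Q : Cube d) :
    ⨍⁻ x in Q.toSet, w x ^ (1 + t) ∂volume ≤
      2 * 2 ^ t * (⨍⁻ y in Q.toSet, w y ∂volume) ^ (1 + t) := by
  have h : ∫⁻ x in Q.toSet, w x ^ (1 + t) ≤
      2 * 2 ^ t * (⨍⁻ y in Q.toSet, w y ∂volume) ^ t * ∫⁻ x in Q.toSet, w x := by
    -- The bound for step functions is uniform in N, so Fatou's lemma carries it over to the limit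
    -- w.
    calc ∫⁻ x in Q.toSet, w x ^ (1 + t)
        = ∫⁻ x in Q.toSet, liminf (fun N =>
          dyadicStep (fun R => ⨍⁻ y in R.toSet, w y ∂volume) N Q x ^ (1 + t)) atTop := by
          refine lintegral_congr_ae ?_
          filter_upwards [Q.ae_tendsto_dyadicStep_laverage hw (hfin Q)] with x hx
          exact ((ENNReal.continuous_rpow_const.tendsto _).comp hx).liminf_eq.symm
      _ ≤ liminf (fun N => ∫⁻ x in Q.toSet,
          dyadicStep (fun R => ⨍⁻ y in R.toSet, w y ∂volume) N Q x ^ (1 + t)) atTop :=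
          lintegral_liminf_le fun N => (measurable_dyadicStep _ N Q).pow_const _
      _ ≤ liminf (fun _ : ℕ => 2 * 2 ^ t * (⨍⁻ y in Q.toSet, w y ∂volume) ^ t *
            ∫⁻ x in Q.toSet, w x) atTop :=
          liminf_le_liminf (Eventually.of_forall fun N =>
            lintegral_dyadicStep_rpow_le ht hfin hpos hδ htδ N Q)
      _ = _ := by simp
  rw [laverage_eq]
  calc (volume Q.toSet)⁻¹ * ∫⁻ x in Q.toSet, w x ^ (1 + t)
      ≤ (volume Q.toSet)⁻¹ * (2 * 2 ^ t * (⨍⁻ y in Q.toSet, w y ∂volume) ^ t *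
        ∫⁻ x in Q.toSet, w x) := by gcongr
    _ = 2 * 2 ^ t * (⨍⁻ y in Q.toSet, w y ∂volume) ^ (1 + t) := by
      rw [ENNReal.rpow_add_of_nonneg _ _ zero_le_one ht, ENNReal.rpow_one, mul_left_comm,
        ← laverage_eq]
      ring

end Cube

/-! ### Scalar weights -/

lemma AEMeasurable.avgMeasure {d : ℕ} {β : Type*} [MeasurableSpace β]
    {f : EuclideanSpace ℝ (Fin d) → β} (hf : AEMeasurable f) (Q : Cube d) :
    AEMeasurable f Q.avgMeasure :=
  hf.restrict.smul_measure _

/-- The scalar Muckenhoupt condition, for a weight which is almost everywhere positive and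
finite. -/
structure IsApWeight {d : ℕ} (p K : ℝ) (w : EuclideanSpace ℝ (Fin d) → ℝ≥0∞) : Prop where
  aemeasurable : AEMeasurable w
  ae_ne_zero : ∀ᵐ x, w x ≠ 0
  ae_ne_top : ∀ᵐ x, w x ≠ ∞
  le : ∀ Q : Cube d, (⨍⁻ x in Q.toSet, w x ∂volume) *
    (⨍⁻ x in Q.toSet, w x ^ (-(1 / (p - 1))) ∂volume) ^ (p - 1) ≤ ENNReal.ofReal K

namespace IsApWeight

variable {d : ℕ} {p K : ℝ} {w : EuclideanSpace ℝ (Fin d) → ℝ≥0∞}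

lemma lintegral_ne_zero (h : IsApWeight p K w) (Q : Cube d) : ∫⁻ x in Q.toSet, w x ≠ 0 := by
  intro h0
  rw [lintegral_eq_zero_iff' h.aemeasurable.restrict] at h0
  have : ∀ᵐ x ∂volume.restrict Q.toSet, False := by
    filter_upwards [h0, ae_restrict_of_ae h.ae_ne_zero] with x h1 h2 using h2 h1
  simp [ae_iff, Q.volume_toSet_ne_zero] at this

/-- If w had infinite integral over Q, the A_p bound would force the average of the dual weight to
vanish (∞ · 0 = 0), contradicting w < ∞ almost everywhere. -/
lemma lintegral_ne_top (h : IsApWeight p K w) (hp : 1 < p) (Q : Cube d) :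
    ∫⁻ x in Q.toSet, w x ≠ ∞ := by
  intro htop
  have h1 := h.le Q
  rw [Q.laverage_eq, htop, ENNReal.mul_top (ENNReal.inv_ne_zero.2 Q.volume_toSet_ne_top)] at h1
  have h2 : ⨍⁻ x in Q.toSet, w x ^ (-(1 / (p - 1))) ∂volume = 0 := by
    by_contra hne
    rw [ENNReal.top_mul] at h1
    · simp at h1
    · simp only [ne_eq, ENNReal.rpow_eq_zero_iff, not_or, not_and, not_lt]
      exact ⟨fun h => absurd h hne, fun _ => by linarith⟩
  rw [Q.laverage_eq, mul_eq_zero, or_iff_right (ENNReal.inv_ne_zero.2 Q.volume_toSet_ne_top),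
    lintegral_eq_zero_iff' (h.aemeasurable.pow_const _).restrict] at h2
  have : ∀ᵐ x ∂volume.restrict Q.toSet, False := by
    filter_upwards [h2, ae_restrict_of_ae h.ae_ne_top] with x h1 h2
    simp only [Pi.zero_apply, ENNReal.rpow_eq_zero_iff] at h1
    have : 0 < 1 / (p - 1) := by apply one_div_pos.2; linarith
    rcases h1 with h1 | h1
    · linarith [h1.2]
    · exact h2 h1.1
  simp [ae_iff, Q.volume_toSet_ne_zero] at this

/-- Hölder's inequality for a weight and its dual weight. -/
lemma volume_rpow_le (h : IsApWeight p K w) (hp : 1 < p)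
    (E : Set (EuclideanSpace ℝ (Fin d))) :
    volume E ^ p ≤ (∫⁻ x in E, w x) * (∫⁻ x in E, w x ^ (-(1 / (p - 1)))) ^ (p - 1) := by
  have hp0 : 0 < p := by linarith
  have hp1 : 0 < p - 1 := by linarith
  have hpq : p.HolderConjugate (Real.conjExponent p) := Real.HolderConjugate.conjExponent hp
  set σ := fun x => w x ^ (-(1 / (p - 1)))
  have h1 : volume E ≤ (∫⁻ x in E, w x) ^ (1 / p) *
      (∫⁻ x in E, σ x) ^ (1 / Real.conjExponent p) := by
    calc volume E = ∫⁻ x in E, w x ^ (1 / p) * w x ^ (-(1 / p)) := by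
          rw [← setLIntegral_one]
          refine lintegral_congr_ae ?_
          filter_upwards [ae_restrict_of_ae h.ae_ne_zero, ae_restrict_of_ae h.ae_ne_top]
            with x h1 h2
          rw [← ENNReal.rpow_add _ _ h1 h2]
          simp
      _ ≤ (∫⁻ x in E, (w x ^ (1 / p)) ^ p) ^ (1 / p) *
          (∫⁻ x in E, (w x ^ (-(1 / p))) ^ Real.conjExponent p) ^ (1 / Real.conjExponent p) :=
          ENNReal.lintegral_mul_le_Lp_mul_Lq _ hpq
            (h.aemeasurable.pow_const _).restrict (h.aemeasurable.pow_const _).restrict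
      _ = _ := by
          congr 3
          · ext x
            rw [← ENNReal.rpow_mul, one_div_mul_cancel hp0.ne', ENNReal.rpow_one]
          · ext x
            rw [← ENNReal.rpow_mul]
            congr 1
            rw [Real.conjExponent]
            field_simp
  calc volume E ^ p ≤ ((∫⁻ x in E, w x) ^ (1 / p) *
      (∫⁻ x in E, σ x) ^ (1 / Real.conjExponent p)) ^ p := by gcongr
    _ = (∫⁻ x in E, w x) * (∫⁻ x in E, σ x) ^ (p - 1) := by
      rw [ENNReal.mul_rpow_of_nonneg _ _ hp0.le, ← ENNReal.rpow_mul, ← ENNReal.rpow_mul,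
        one_div_mul_cancel hp0.ne', ENNReal.rpow_one]
      congr 2
      rw [Real.conjExponent]
      field_simp

lemma lintegral_mul_le (h : IsApWeight p K w) (hp : 1 < p) (Q : Cube d) :
    (∫⁻ x in Q.toSet, w x) * (∫⁻ x in Q.toSet, w x ^ (-(1 / (p - 1)))) ^ (p - 1) ≤
      ENNReal.ofReal K * volume Q.toSet ^ p := by
  have hp1 : 0 < p - 1 := by linarith
  set σ := fun x => w x ^ (-(1 / (p - 1)))
  have h1 := h.le Q
  rw [← Q.volume_mul_laverage, ← Q.volume_mul_laverage, ENNReal.mul_rpow_of_nonneg _ _ hp1.le]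
  have h2 : volume Q.toSet ^ p = volume Q.toSet * volume Q.toSet ^ (p - 1) := by
    nth_rw 2 [← ENNReal.rpow_one (volume Q.toSet)]
    rw [← ENNReal.rpow_add _ _ Q.volume_toSet_ne_zero Q.volume_toSet_ne_top]
    congr 1; ring
  rw [h2]
  calc _ = volume Q.toSet * volume Q.toSet ^ (p - 1) * ((⨍⁻ x in Q.toSet, w x ∂volume) *
      (⨍⁻ x in Q.toSet, σ x ∂volume) ^ (p - 1)) := by ring
    _ ≤ volume Q.toSet * volume Q.toSet ^ (p - 1) * ENNReal.ofReal K := by gcongr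
    _ = _ := by ring

/-- Hölder's inequality and the A_p condition bound the same product from below and above; on a cube
of volume 1 this leaves 1 ≤ K. -/
lemma one_le (h : IsApWeight p K w) (hp : 1 < p) : 1 ≤ K := by
  have hp0 : 0 < p := by linarith
  let Q : Cube d := ⟨0, 1, one_pos⟩
  have h1 := (h.volume_rpow_le hp Q.toSet).trans (h.lintegral_mul_le hp Q)
  rw [Q.volume_toSet] at h1
  simpa [Q] using h1

/-- For E = Q \ O and σ the dual weight, Hölder gives |E|^p ≤ w(E) σ(Q)^{p-1} and the A_p condition
gives w(Q) σ(Q)^{p-1} ≤ K|Q|^p. Hence w(Q)|E|^p ≤ K|Q|^p w(E), and |Q| ≤ 2|E|. That the fraction is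
of order 1/K is what makes the gain of order 1/K. -/
lemma le_lintegral_sdiff (h : IsApWeight p K w) (hp : 1 < p) (hK : 0 < K) (Q : Cube d)
    {O : Set (EuclideanSpace ℝ (Fin d))} (hO : O ⊆ Q.toSet) (hOm : MeasurableSet O)
    (hOQ : 2 * volume O ≤ volume Q.toSet) :
    ENNReal.ofReal (1 / (K * 2 ^ p)) * ∫⁻ x in Q.toSet, w x ≤ ∫⁻ x in Q.toSet \ O, w x := by
  have hp0 : 0 < p := by linarith
  have hp1 : 0 < p - 1 := by linarith
  set E := Q.toSet \ O
  set σ := fun x => w x ^ (-(1 / (p - 1)))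
  have hEt : volume E ≠ ∞ :=
    ne_top_of_le_ne_top Q.volume_toSet_ne_top (measure_mono Set.sdiff_subset)
  have hE : volume Q.toSet ≤ 2 * volume E := by
    have h1 : volume Q.toSet = volume O + volume E := by
      rw [← measure_inter_add_sdiff Q.toSet hOm, Set.inter_eq_right.2 hO]
    have h2 : 2 * volume O ≤ 2 * volume E + 0 := by
      have : volume O + volume O ≤ volume O + volume E := by rw [← two_mul, ← h1]; exact hOQ
      have h3 : volume O ≤ volume E := ENNReal.le_of_add_le_add_left
        (ne_top_of_le_ne_top Q.volume_toSet_ne_top (measure_mono hO)) this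
      rw [add_zero]
      gcongr
    have h3 : volume O ≤ volume E := by
      rw [add_zero] at h2
      exact (ENNReal.mul_le_mul_iff_right (by simp) (by simp)).1 h2
    rw [h1, two_mul]
    gcongr
  have hE0 : volume E ≠ 0 := by
    intro h0
    rw [h0, mul_zero] at hE
    exact Q.volume_toSet_ne_zero (le_antisymm hE bot_le)
  have hH : volume E ^ p ≤ (∫⁻ x in E, w x) * (∫⁻ x in Q.toSet, σ x) ^ (p - 1) := by
    refine (h.volume_rpow_le hp E).trans ?_
    gcongr
    exact Set.sdiff_subset
  have hA := h.lintegral_mul_le hp Q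
  have hEp0 : volume E ^ p ≠ 0 := by simp [hE0, hEt]
  have hEpt : volume E ^ p ≠ ∞ := ENNReal.rpow_ne_top_of_nonneg hp0.le hEt
  have hmain : ∫⁻ x in Q.toSet, w x ≤ ENNReal.ofReal (K * 2 ^ p) * ∫⁻ x in E, w x := by
    refine (ENNReal.mul_le_mul_iff_right hEp0 hEpt).1 ?_
    calc volume E ^ p * ∫⁻ x in Q.toSet, w x
        ≤ ((∫⁻ x in E, w x) * (∫⁻ x in Q.toSet, σ x) ^ (p - 1)) * ∫⁻ x in Q.toSet, w x := by
          gcongr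
      _ = ((∫⁻ x in Q.toSet, w x) * (∫⁻ x in Q.toSet, σ x) ^ (p - 1)) * ∫⁻ x in E, w x := by
          ring
      _ ≤ ENNReal.ofReal K * volume Q.toSet ^ p * ∫⁻ x in E, w x := by gcongr
      _ ≤ ENNReal.ofReal K * (2 * volume E) ^ p * ∫⁻ x in E, w x := by gcongr
      _ = _ := by
          rw [ENNReal.mul_rpow_of_nonneg _ _ hp0.le, ENNReal.ofReal_mul hK.le,
            ← ENNReal.ofReal_rpow_of_pos two_pos, ENNReal.ofReal_ofNat]
          ring
  have hc : 0 < K * 2 ^ p := by positivity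
  calc ENNReal.ofReal (1 / (K * 2 ^ p)) * ∫⁻ x in Q.toSet, w x
      ≤ ENNReal.ofReal (1 / (K * 2 ^ p)) * (ENNReal.ofReal (K * 2 ^ p) * ∫⁻ x in E, w x) := by
        gcongr
    _ = ∫⁻ x in E, w x := by
        rw [← mul_assoc, ← ENNReal.ofReal_mul (by positivity), one_div_mul_cancel hc.ne']
        simp

end IsApWeight

/-- The gain of integrability in the reverse Hölder inequality of an `A_p` weight. -/
def gain (d : ℕ) (p K : ℝ) : ℝ := 1 / (K * 2 ^ p) / (2 * (d + 1))

/-- The exponent conjugate to the exponent of integrability `p (1 + gain)` of `w ^ (1 / p)`. -/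
def gainExponent (d : ℕ) (p K : ℝ) : ℝ := Real.conjExponent (p * (1 + gain d p K))

lemma gain_pos (d : ℕ) (p : ℝ) {K : ℝ} (hK : 0 < K) : 0 < gain d p K := by
  unfold gain; positivity

lemma gain_le_one (d : ℕ) {p K : ℝ} (hp : 1 < p) (hK : 1 ≤ K) :
    1 / (K * 2 ^ p) / 2 ≤ 1 ∧ gain d p K ≤ 1 := by
  have h2 : (1 : ℝ) ≤ 2 ^ p := Real.one_le_rpow one_le_two (by linarith)
  have h3 : 1 / (K * 2 ^ p) ≤ 1 := by
    rw [div_le_one (by positivity)]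
    nlinarith
  refine ⟨by linarith, ?_⟩
  unfold gain
  rw [div_le_one (by positivity)]
  have : (0 : ℝ) ≤ d := Nat.cast_nonneg d
  linarith

theorem IsApWeight.reverse_holder {d : ℕ} {p K : ℝ} {w : EuclideanSpace ℝ (Fin d) → ℝ≥0∞}
    (h : IsApWeight p K w) (hp : 1 < p) (hK : 1 ≤ K) (Q : Cube d) :
    ⨍⁻ x in Q.toSet, w x ^ (1 + gain d p K) ∂volume ≤
      4 * (⨍⁻ y in Q.toSet, w y ∂volume) ^ (1 + gain d p K) := by
  have hK0 : 0 < K := by linarith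
  have hg := gain_pos d p hK0
  obtain ⟨hg2, hg1⟩ := gain_le_one d hp hK
  refine (Cube.reverse_holder h.aemeasurable hg.le (h.lintegral_ne_top hp) h.lintegral_ne_zero
    (fun Q O hO hOm hOQ => h.le_lintegral_sdiff hp hK0 Q hO hOm hOQ) ?_ Q).trans ?_
  -- With δ = 1/(K 2^p), the gain is chosen so that (d + 1) · gain = δ/2; then Bernoulli's
  -- inequality gives 2^{δ/2} ≤ 1 + δ/2.
  · have h1 : ((2 : ℝ≥0∞) ^ (d + 1)) ^ gain d p K =
        ENNReal.ofReal (2 ^ (1 / (K * 2 ^ p) / 2)) := by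
      rw [← ENNReal.ofReal_rpow_of_pos two_pos, ENNReal.ofReal_ofNat, ← ENNReal.rpow_natCast,
        ← ENNReal.rpow_mul]
      congr 1
      unfold gain
      push_cast
      field_simp
    have h2 : 1 + ENNReal.ofReal (1 / (K * 2 ^ p)) / 2 =
        ENNReal.ofReal (1 + 1 / (K * 2 ^ p) / 2) := by
      rw [ENNReal.ofReal_add zero_le_one (by positivity), ENNReal.ofReal_one,
        ENNReal.ofReal_div_of_pos two_pos, ENNReal.ofReal_ofNat]
    rw [h1, h2]
    apply ENNReal.ofReal_le_ofReal
    have := rpow_one_add_le_one_add_mul_self (s := 1) (by norm_num)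
      (p := 1 / (K * 2 ^ p) / 2) (by positivity) hg2
    norm_num at this ⊢
    linarith
  · gcongr
    calc (2 : ℝ≥0∞) * 2 ^ gain d p K ≤ 2 * 2 ^ (1 : ℝ) := by
          gcongr
          exact one_le_two
      _ = 4 := by rw [ENNReal.rpow_one]; norm_num

/-- Hölder with exponent p(1 + t) on w^{1/p}, followed by the reverse Hölder inequality to return to
the plain average of w. The gain is that the exponent on v, conjugate to p(1 + t), lies strictly
below p', which leaves room for the Carleson embedding. -/
theorem IsApWeight.laverage_rpow_mul_le {d : ℕ} {p K : ℝ}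
    {w : EuclideanSpace ℝ (Fin d) → ℝ≥0∞}
    (h : IsApWeight p K w) (hp : 1 < p) (hK : 1 ≤ K) (Q : Cube d)
    {v : EuclideanSpace ℝ (Fin d) → ℝ≥0∞} (hv : AEMeasurable v) :
    ⨍⁻ x in Q.toSet, w x ^ (1 / p) * v x ∂volume ≤
      4 * (⨍⁻ x in Q.toSet, w x ∂volume) ^ (1 / p) *
        (⨍⁻ x in Q.toSet, v x ^ gainExponent d p K ∂volume) ^ (1 / gainExponent d p K) := by
  have hK0 : 0 < K := by linarith
  have hg := gain_pos d p hK0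
  set t := gain d p K with ht
  have hp0 : 0 < p := by linarith
  have hs : 1 < p * (1 + t) := by nlinarith
  have hc : (p * (1 + t)).HolderConjugate (gainExponent d p K) :=
    Real.HolderConjugate.conjExponent hs
  have h1 := ENNReal.lintegral_mul_le_Lp_mul_Lq Q.avgMeasure hc
    ((h.aemeasurable.pow_const (1 / p)).avgMeasure Q) (hv.avgMeasure Q)
  simp only [Pi.mul_apply, Q.lintegral_avgMeasure] at h1
  refine h1.trans ?_
  gcongr
  calc (⨍⁻ x in Q.toSet, (w x ^ (1 / p)) ^ (p * (1 + t)) ∂volume) ^ (1 / (p * (1 + t)))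
      = (⨍⁻ x in Q.toSet, w x ^ (1 + t) ∂volume) ^ (1 / (p * (1 + t))) := by
        congr 2
        ext x
        rw [← ENNReal.rpow_mul]
        congr 1
        field_simp
    _ ≤ (4 * (⨍⁻ y in Q.toSet, w y ∂volume) ^ (1 + t)) ^ (1 / (p * (1 + t))) := by
        gcongr
        exact h.reverse_holder hp hK Q
    _ = 4 ^ (1 / (p * (1 + t))) * (⨍⁻ y in Q.toSet, w y ∂volume) ^ (1 / p) := by
        rw [ENNReal.mul_rpow_of_nonneg _ _ (by positivity), ← ENNReal.rpow_mul]
        congr 2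
        field_simp
    _ ≤ 4 * (⨍⁻ y in Q.toSet, w y ∂volume) ^ (1 / p) := by
        gcongr
        calc (4 : ℝ≥0∞) ^ (1 / (p * (1 + t))) ≤ 4 ^ (1 : ℝ) := by
              apply ENNReal.rpow_le_rpow_of_exponent_le (by norm_num)
              rw [div_le_one (by positivity)]
              exact hs.le
          _ = 4 := ENNReal.rpow_one _

/-! ### The Carleson embedding theorem -/

/-- The sets E_Q are disjoint and have positive measure, and Lebesgue measure is σ-finite. -/
lemma IsSparse.countable {d : ℕ} {γ : ℝ} (hγ : 0 < γ) {S : Set (Cube d)} (hS : IsSparse γ S) :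
    S.Countable := by
  obtain ⟨E, hE, hd⟩ := hS
  have h := Measure.countable_meas_pos_of_disjoint_iUnion (μ := volume)
    (As := fun Q : S => E Q) (fun Q => (hE Q Q.2).2.1) (fun Q R hQR => hd Q.2 R.2 fun h =>
      hQR (Subtype.ext h))
  have huniv : {Q : S | 0 < volume (E Q)} = Set.univ := by
    ext Q
    simp only [Set.mem_ofPred_eq, Set.mem_univ, iff_true]
    refine lt_of_lt_of_le ?_ (hE Q Q.2).2.2
    exact ENNReal.mul_pos (by simpa using hγ) (Cube.volume_toSet_ne_zero _)
  rw [huniv, Set.countable_univ_iff] at h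
  exact h

/-- The weak type estimate behind the Carleson embedding theorem. -/
lemma IsSparse.mul_tsum_volume_le {d : ℕ} {γ : ℝ} {S : Set (Cube d)} (hS : IsSparse γ S)
    (hN : IsNested S) (μ : Measure (EuclideanSpace ℝ (Fin d))) (c : ℝ≥0∞) (P : Set S)
    (hP : ∀ Q ∈ P, c * volume (Q : Cube d).toSet ≤ μ (Q : Cube d).toSet) :
    ENNReal.ofReal γ * c * ∑' Q : S, P.indicator (fun Q => volume (Q : Cube d).toSet) Q ≤
      μ Set.univ := by
  classical
  obtain ⟨E, hE, hd⟩ := hS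
  rw [ENNReal.tsum_eq_iSup_sum, ENNReal.mul_iSup]
  refine iSup_le fun s => ?_
  set s' := (s.filter fun Q => Q ∈ P).map (Function.Embedding.subtype _) with hs'
  have hs'S : ∀ Q ∈ s', ∃ hQ : Q ∈ S, ⟨Q, hQ⟩ ∈ P := by
    intro Q hQ
    simp only [hs', Finset.mem_map, Finset.mem_filter, Function.Embedding.subtype_apply] at hQ
    obtain ⟨R, hR, rfl⟩ := hQ
    exact ⟨R.2, hR.2⟩
  -- The cubes overlap, so μ cannot be summed over them directly. Sparseness bounds the sum of
  -- volumes by the volume of the union, and the union is covered by disjoint members, over which μ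
  -- is additive.
  obtain ⟨t, hts, htd, htu⟩ := IsNested.exists_pairwiseDisjoint s'
    (hN.mono fun Q hQ => (hs'S Q hQ).1)
  have hsum : ∑ Q ∈ s, P.indicator (fun Q => volume (Q : Cube d).toSet) Q =
      ∑ Q ∈ s', volume Q.toSet := by
    rw [hs', Finset.sum_map, Finset.sum_filter]
    simp [Set.indicator_apply]
  calc ENNReal.ofReal γ * c * ∑ Q ∈ s, P.indicator (fun Q => volume (Q : Cube d).toSet) Q
      = c * ∑ Q ∈ s', ENNReal.ofReal γ * volume Q.toSet := by
        rw [hsum, ← Finset.mul_sum]; ring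
    _ ≤ c * ∑ Q ∈ s', volume (E Q) := by
        gcongr with Q hQ
        exact (hE Q (hs'S Q hQ).1).2.2
    _ = c * volume (⋃ Q ∈ s', E Q) := by
        rw [measure_biUnion_finset (hd.subset fun Q hQ => (hs'S Q hQ).1)
          fun Q hQ => (hE Q (hs'S Q hQ).1).2.1]
    _ ≤ c * volume (⋃ Q ∈ t, Q.toSet) := by
        gcongr c * volume ?_
        exact (Set.iUnion₂_mono fun Q hQ => (hE Q (hs'S Q hQ).1).1).trans htu
    _ = ∑ Q ∈ t, c * volume Q.toSet := by
        rw [measure_biUnion_finset htd fun Q _ => Q.measurableSet_toSet, Finset.mul_sum]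
    _ ≤ ∑ Q ∈ t, μ Q.toSet := by
        gcongr with Q hQ
        obtain ⟨hQS, hQP⟩ := hs'S Q (hts hQ)
        exact hP _ hQP
    _ = μ (⋃ Q ∈ t, Q.toSet) := by
        rw [measure_biUnion_finset htd fun Q _ => Q.measurableSet_toSet]
    _ ≤ μ Set.univ := measure_mono (Set.subset_univ _)

lemma lintegral_sum_smul_dirac {ι : Type*} [MeasurableSpace ι] [MeasurableSingletonClass ι]
    (c f : ι → ℝ≥0∞) :
    ∫⁻ i, f i ∂(Measure.sum fun i => c i • Measure.dirac i) = ∑' i, c i * f i := by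
  simp [lintegral_sum_measure]

/-- The Carleson embedding theorem for measurable functions. -/
lemma IsSparse.tsum_laverage_rpow_le_of_measurable {d : ℕ} {γ : ℝ} (hγ : 0 < γ) {S : Set (Cube d)}
    (hS : IsSparse γ S) (hN : IsNested S) {q : ℝ} (hq : 1 < q)
    {h : EuclideanSpace ℝ (Fin d) → ℝ≥0∞} (hm : Measurable h) :
    ∑' Q : S, volume (Q : Cube d).toSet * (⨍⁻ x in (Q : Cube d).toSet, h x ∂volume) ^ q ≤
      ENNReal.ofReal (2 ^ q * q / (q - 1) / γ) * ∫⁻ x, h x ^ q := by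
  have hq0 : 0 < q := by linarith
  have hq1 : 0 < q - 1 := by linarith
  by_cases htop : ∫⁻ x, h x ^ q = ∞
  · rw [htop, ENNReal.mul_top]
    · exact le_top
    · simp only [ne_eq, ENNReal.ofReal_eq_zero, not_le]
      positivity
  have hfin : ∀ᵐ x, h x ≠ ∞ := by
    filter_upwards [ae_lt_top' (hm.pow_const q).aemeasurable htop] with x hx hx'
    simp [hx', hq0] at hx
  have hav : ∀ Q : Cube d, ⨍⁻ x in Q.toSet, h x ∂volume ≠ ∞ := by
    intro Q
    rw [Q.laverage_eq]
    refine ENNReal.mul_ne_top (ENNReal.inv_ne_top.2 Q.volume_toSet_ne_zero) ?_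
    have h1 : ∫⁻ x in Q.toSet, h x ≤ ∫⁻ x in Q.toSet, (1 + h x ^ q) := by
      refine lintegral_mono fun x => ?_
      rcases le_total (h x) 1 with h1 | h1
      · exact le_add_right h1
      · refine le_add_left ?_
        calc h x = h x ^ (1 : ℝ) := (ENNReal.rpow_one _).symm
          _ ≤ h x ^ q := ENNReal.rpow_le_rpow_of_exponent_le h1 hq.le
    refine ne_top_of_le_ne_top ?_ h1
    rw [lintegral_add_left measurable_const, setLIntegral_one]
    exact ENNReal.add_ne_top.2 ⟨Q.volume_toSet_ne_top,
      ne_top_of_le_ne_top htop (setLIntegral_le_lintegral _ _)⟩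
  -- The sum over cubes becomes an integral for a discrete measure, so that the layer cake formula
  -- applies to it.
  let _ : MeasurableSpace S := ⊤
  set a : S → ℝ := fun Q => (⨍⁻ x in (Q : Cube d).toSet, h x ∂volume).toReal with ha
  set μ : Measure S := Measure.sum fun Q : S => volume (Q : Cube d).toSet • Measure.dirac Q with hμ
  set ν : Measure (EuclideanSpace ℝ (Fin d)) := volume.withDensity h with hν
  -- If the average of h over Q exceeds l, the part of h of height at most l/2 accounts for at most
  -- half, so the part where h > l/2 has integral at least (l/2)|Q|. The weak type estimate is
  -- applied to that part.
  have hlevel : ∀ l : ℝ, 0 < l →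
      ENNReal.ofReal γ * ENNReal.ofReal (l / 2) * μ {Q | l < a Q} ≤ ν {x | l < 2 * (h x).toReal} := by
    intro l hl
    have hset : MeasurableSet {x | l < 2 * (h x).toReal} :=
      measurableSet_lt measurable_const (hm.ennreal_toReal.const_mul 2)
    have h1 := hS.mul_tsum_volume_le hN (ν.restrict {x | l < 2 * (h x).toReal})
      (ENNReal.ofReal (l / 2)) {Q | l < a Q} fun Q hQ => by
        rw [Measure.restrict_apply (Cube.measurableSet_toSet _), hν,
          withDensity_apply _ ((Cube.measurableSet_toSet _).inter hset)]
        have h2 : ENNReal.ofReal l * volume (Q : Cube d).toSet ≤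
            ∫⁻ x in (Q : Cube d).toSet, h x := by
          rw [← Cube.volume_mul_laverage, mul_comm]
          gcongr
          exact ENNReal.ofReal_le_of_le_toReal hQ.le
        have h3 : ∫⁻ x in (Q : Cube d).toSet, h x ≤
            (∫⁻ x in (Q : Cube d).toSet ∩ {x | l < 2 * (h x).toReal}, h x) +
              ENNReal.ofReal (l / 2) * volume (Q : Cube d).toSet := by
          rw [← lintegral_inter_add_sdiff h _ hset]
          gcongr
          calc ∫⁻ x in (Q : Cube d).toSet \ {x | l < 2 * (h x).toReal}, h x
              ≤ ∫⁻ x in (Q : Cube d).toSet \ {x | l < 2 * (h x).toReal}, ENNReal.ofReal (l / 2) := by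
                refine lintegral_mono_ae ?_
                filter_upwards [ae_restrict_of_ae hfin, ae_restrict_mem
                  ((Cube.measurableSet_toSet _).diff hset)] with x hx hx'
                have : ¬ l < 2 * (h x).toReal := hx'.2
                rw [← ENNReal.ofReal_toReal hx]
                apply ENNReal.ofReal_le_ofReal
                linarith
            _ ≤ _ := by
                rw [setLIntegral_const]
                gcongr
                exact Set.sdiff_subset
        have h4 : ENNReal.ofReal l = ENNReal.ofReal (l / 2) + ENNReal.ofReal (l / 2) := by
          rw [← ENNReal.ofReal_add (by positivity) (by positivity)]
          ring_nf
        rw [h4, add_mul] at h2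
        exact ENNReal.le_of_add_le_add_right
          (ENNReal.mul_ne_top ENNReal.ofReal_ne_top (Cube.volume_toSet_ne_top _)) (h2.trans h3)
    rw [Measure.restrict_apply_univ] at h1
    convert h1 using 2
    rw [hμ, Measure.sum_apply _ (by trivial)]
    refine tsum_congr fun Q => ?_
    by_cases hQ : l < a Q <;> simp [hQ, Set.indicator]
  have hsum : ∑' Q : S, volume (Q : Cube d).toSet * (⨍⁻ x in (Q : Cube d).toSet, h x ∂volume) ^ q =
      ∫⁻ Q, ENNReal.ofReal (a Q ^ q) ∂μ := by
    rw [hμ, lintegral_sum_smul_dirac]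
    refine tsum_congr fun Q => ?_
    rw [← ENNReal.ofReal_rpow_of_nonneg ENNReal.toReal_nonneg hq0.le, ENNReal.ofReal_toReal (hav _)]
  -- Two layer cake formulas: exponent q for the averages under μ, and q - 1 for 2h under ν = h dx,
  -- since `hlevel` costs one power of l. Their prefactors q and q - 1 produce the factor q/(q - 1).
  have hcake := lintegral_rpow_eq_lintegral_meas_lt_mul μ (f := a)
    (ae_of_all _ fun Q => ENNReal.toReal_nonneg) (measurable_from_top).aemeasurable hq0
  have hcake' := lintegral_rpow_eq_lintegral_meas_lt_mul ν (f := fun x => 2 * (h x).toReal)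
    (ae_of_all _ fun x => by positivity) (hm.ennreal_toReal.const_mul 2).aemeasurable hq1
  have hν' : ∫⁻ x, ENNReal.ofReal ((2 * (h x).toReal) ^ (q - 1)) ∂ν =
      ENNReal.ofReal (2 ^ (q - 1)) * ∫⁻ x, h x ^ q := by
    rw [hν, lintegral_withDensity_eq_lintegral_mul _ hm (by fun_prop), ← lintegral_const_mul _
      (by fun_prop)]
    refine lintegral_congr_ae ?_
    filter_upwards [hfin] with x hx
    rw [Pi.mul_apply, Real.mul_rpow two_pos.le ENNReal.toReal_nonneg,
      ENNReal.ofReal_mul (by positivity), ← ENNReal.ofReal_rpow_of_nonneg ENNReal.toReal_nonneg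
      hq1.le, ENNReal.ofReal_toReal hx]
    have : h x ^ q = h x ^ (1 : ℝ) * h x ^ (q - 1) := by
      rw [← ENNReal.rpow_add_of_nonneg _ _ zero_le_one hq1.le]
      ring_nf
    rw [this, ENNReal.rpow_one]
    ring
  rw [hν'] at hcake'
  rw [hsum, hcake]
  calc ENNReal.ofReal q * ∫⁻ l in Set.Ioi 0, μ {Q | l < a Q} * ENNReal.ofReal (l ^ (q - 1))
      ≤ ENNReal.ofReal q * ∫⁻ l in Set.Ioi (0 : ℝ), ENNReal.ofReal (2 / γ) *
          (ν {x | l < 2 * (h x).toReal} * ENNReal.ofReal (l ^ (q - 1 - 1))) := by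
        gcongr ENNReal.ofReal q * ?_
        refine setLIntegral_mono' measurableSet_Ioi fun l hl => ?_
        have hl : 0 < l := hl
        have h1 : ENNReal.ofReal (l ^ (q - 1)) = ENNReal.ofReal (2 / γ) *
            (ENNReal.ofReal γ * ENNReal.ofReal (l / 2)) * ENNReal.ofReal (l ^ (q - 1 - 1)) := by
          rw [← ENNReal.ofReal_mul hγ.le, ← ENNReal.ofReal_mul (by positivity),
            ← ENNReal.ofReal_mul (by positivity)]
          congr 1
          rw [Real.rpow_sub_one hl.ne' (q - 1)]
          field_simp
        calc μ {Q | l < a Q} * ENNReal.ofReal (l ^ (q - 1))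
            = ENNReal.ofReal (2 / γ) * ((ENNReal.ofReal γ * ENNReal.ofReal (l / 2) *
                μ {Q | l < a Q}) * ENNReal.ofReal (l ^ (q - 1 - 1))) := by rw [h1]; ring
          _ ≤ _ := by
            gcongr ENNReal.ofReal (2 / γ) * (?_ * _)
            exact hlevel l hl
    _ = ENNReal.ofReal (q * (2 / γ) / (q - 1)) * (ENNReal.ofReal (q - 1) *
          ∫⁻ l in Set.Ioi (0 : ℝ), ν {x | l < 2 * (h x).toReal} *
            ENNReal.ofReal (l ^ (q - 1 - 1))) := by
        rw [lintegral_const_mul' _ _ ENNReal.ofReal_ne_top, ← mul_assoc, ← mul_assoc,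
          ← ENNReal.ofReal_mul hq0.le, ← ENNReal.ofReal_mul (by positivity)]
        congr 2
        field_simp
    _ = ENNReal.ofReal (2 ^ q * q / (q - 1) / γ) * ∫⁻ x, h x ^ q := by
        rw [← hcake', ← mul_assoc, ← ENNReal.ofReal_mul (by positivity)]
        congr 2
        rw [Real.rpow_sub_one two_ne_zero]
        field_simp

/-- The Carleson embedding theorem. -/
theorem IsSparse.tsum_laverage_rpow_le {d : ℕ} {γ : ℝ} (hγ : 0 < γ) {S : Set (Cube d)}
    (hS : IsSparse γ S) (hN : IsNested S) {q : ℝ} (hq : 1 < q)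
    {h : EuclideanSpace ℝ (Fin d) → ℝ≥0∞} (hm : AEMeasurable h) :
    ∑' Q : S, volume (Q : Cube d).toSet * (⨍⁻ x in (Q : Cube d).toSet, h x ∂volume) ^ q ≤
      ENNReal.ofReal (2 ^ q * q / (q - 1) / γ) * ∫⁻ x, h x ^ q := by
  have h1 := hS.tsum_laverage_rpow_le_of_measurable hγ hN hq hm.measurable_mk
  have h2 : ∫⁻ x, hm.mk h x ^ q = ∫⁻ x, h x ^ q := lintegral_congr_ae (by
    filter_upwards [hm.ae_eq_mk] with x hx
    rw [hx])
  have h3 : ∀ Q : Cube d, ⨍⁻ x in Q.toSet, hm.mk h x ∂volume = ⨍⁻ x in Q.toSet, h x ∂volume := by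
    intro Q
    rw [Q.laverage_eq, Q.laverage_eq, lintegral_congr_ae (ae_restrict_of_ae hm.ae_eq_mk)]
  simpa only [h2, h3] using h1

/-- The Carleson embedding theorem with the integrability gain of an `A_p` weight. -/
theorem IsSparse.tsum_gainExponent_le {d : ℕ} {γ : ℝ} (hγ : 0 < γ) {S : Set (Cube d)}
    (hS : IsSparse γ S) (hN : IsNested S) {p K : ℝ} (hp : 1 < p) (hK : 1 ≤ K)
    {h : EuclideanSpace ℝ (Fin d) → ℝ≥0∞} (hm : AEMeasurable h) :
    ∑' Q : S, volume (Q : Cube d).toSet *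
      ((⨍⁻ x in (Q : Cube d).toSet, h x ^ gainExponent d p K ∂volume) ^
        (1 / gainExponent d p K)) ^ Real.conjExponent p ≤
      ENNReal.ofReal (2 ^ Real.conjExponent p * (2 * p * (2 ^ p * (2 * (d + 1)))) / γ * K) *
        ∫⁻ x, h x ^ Real.conjExponent p := by
  have hK0 : 0 < K := by linarith
  have ht := gain_pos d p hK0
  have ht1 := (gain_le_one d hp hK).2
  have htinv : 1 / gain d p K = K * (2 ^ p * (2 * (d + 1))) := by
    unfold gain
    field_simp
  set t := gain d p K with htdef
  have hp1 : 0 < p - 1 := by linarith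
  have hs1 : 0 < p * (1 + t) - 1 := by nlinarith
  have hτ : gainExponent d p K = p * (1 + t) / (p * (1 + t) - 1) := rfl
  have hτ0 : 0 < gainExponent d p K := by rw [hτ]; positivity
  have hp' : Real.conjExponent p = p / (p - 1) := rfl
  set τ := gainExponent d p K
  -- The Carleson embedding is applied to h^τ with this exponent. Since q - 1 = t/((p - 1)(1 + t)),
  -- its factor q/(q - 1) equals (p(1 + t) - 1)/t, which is linear in K.
  set q := Real.conjExponent p / τ with hq
  have hq' : q = (p * (1 + t) - 1) / ((p - 1) * (1 + t)) := by
    rw [hq, hp', hτ]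
    field_simp
  have hqs : q - 1 = t / ((p - 1) * (1 + t)) := by
    rw [hq']
    field_simp
    ring
  have hq1 : 1 < q := by
    have : 0 < q - 1 := by rw [hqs]; positivity
    linarith
  have hqp : q ≤ Real.conjExponent p := by
    rw [hq', hp', div_le_div_iff₀ (by positivity) hp1]
    nlinarith [mul_pos hp1 ht]
  have h1 := hS.tsum_laverage_rpow_le hγ hN hq1 (hm.pow_const τ)
  have h2 : ∀ a : ℝ≥0∞, (a ^ (1 / τ)) ^ Real.conjExponent p = a ^ q := by
    intro a
    rw [← ENNReal.rpow_mul, hq]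
    congr 1
    ring
  have h3 : ∀ a : ℝ≥0∞, (a ^ τ) ^ q = a ^ Real.conjExponent p := by
    intro a
    rw [← ENNReal.rpow_mul, hq]
    congr 1
    field_simp
  simp only [h2, h3] at h1 ⊢
  refine h1.trans ?_
  gcongr
  have h4 : 2 ^ q * q / (q - 1) / γ = 2 ^ q * ((p * (1 + t) - 1) * (1 / t)) / γ := by
    have : q / (q - 1) = (p * (1 + t) - 1) * (1 / t) := by
      rw [hqs, hq']
      field_simp
    rw [mul_div_assoc, this]
  rw [h4, htinv]
  have h5 : p * (1 + t) - 1 ≤ 2 * p := by nlinarith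
  have h6 : (2 : ℝ) ^ q ≤ 2 ^ Real.conjExponent p :=
    Real.rpow_le_rpow_of_exponent_le one_le_two hqp
  calc 2 ^ q * ((p * (1 + t) - 1) * (K * (2 ^ p * (2 * (d + 1))))) / γ
      ≤ 2 ^ Real.conjExponent p * (2 * p * (K * (2 ^ p * (2 * (d + 1))))) / γ := by gcongr
    _ = _ := by ring

/-! ### Auerbach bases -/

/-- Every finite-dimensional real normed space has a basis of vectors of norm at most `1` whose
coordinate functionals also have norm at most `1`. -/
theorem exists_auerbach_basis {V : Type*} [NormedAddCommGroup V] [NormedSpace ℝ V]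
    [FiniteDimensional ℝ V] {n : ℕ} (b₀ : Module.Basis (Fin n) ℝ V) :
    ∃ b : Module.Basis (Fin n) ℝ V, (∀ i, ‖b i‖ ≤ 1) ∧ ∀ x i, |b.repr x i| ≤ ‖x‖ := by
  have hprop : ProperSpace V := FiniteDimensional.proper_real V
  have hcomp : IsCompact (Set.univ.pi fun _ : Fin n => Metric.closedBall (0 : V) 1) :=
    isCompact_univ_pi fun _ => isCompact_closedBall _ _
  have hcont : Continuous fun v : Fin n → V => |b₀.det v| := by
    have h1 : ∀ i j, Continuous fun v : Fin n → V => b₀.toMatrix v i j := fun i j => by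
      have : Continuous fun x : V => b₀.repr x i :=
        (b₀.coord i).continuous_of_finiteDimensional
      exact this.comp (continuous_apply j)
    simp only [Module.Basis.det_apply]
    exact (Continuous.matrix_det (continuous_matrix h1)).abs
  -- The Auerbach basis is a tuple in the unit ball whose determinant has maximal absolute value.
  obtain ⟨v, hv, hmax⟩ := hcomp.exists_isMaxOn ⟨0, fun i _ => by simp⟩ hcont.continuousOn
  have hv1 : ∀ i, ‖v i‖ ≤ 1 := fun i => by simpa using hv i trivial
  have hdet : b₀.det v ≠ 0 := by
    intro h0
    have h1 := hmax (a := fun i => ‖b₀ i‖⁻¹ • b₀ i) (fun i _ => by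
      simp [norm_smul, inv_mul_cancel₀ (norm_ne_zero_iff.2 (b₀.ne_zero i))])
    simp only [h0, abs_zero, Set.mem_ofPred_eq] at h1
    have h2 : b₀.det (fun i => ‖b₀ i‖⁻¹ • b₀ i) = ∏ i, ‖b₀ i‖⁻¹ := by
      rw [AlternatingMap.map_smul_univ]
      simp [b₀.det_self]
    rw [h2] at h1
    have h3 : ∏ i, ‖b₀ i‖⁻¹ ≠ 0 :=
      Finset.prod_ne_zero_iff.2 fun i _ => inv_ne_zero (norm_ne_zero_iff.2 (b₀.ne_zero i))
    exact h3 (abs_nonpos_iff.1 h1)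
  obtain ⟨hli, hsp⟩ := b₀.is_basis_iff_det.2 (isUnit_iff_ne_zero.2 hdet)
  set b := Module.Basis.mk hli hsp.ge with hb
  have hbv : ⇑b = v := Module.Basis.coe_mk hli hsp.ge
  refine ⟨b, fun i => hbv ▸ hv1 i, fun x i => ?_⟩
  -- Cramer's rule: replacing the i-th vector by x multiplies the determinant by the i-th coordinate
  -- of x, so maximality bounds this coordinate by 1 when ‖x‖ ≤ 1.
  have hupd : ∀ x : V, b₀.det (Function.update v i x) = b.repr x i * b₀.det v := by
    intro x
    conv_lhs => rw [← b.sum_repr x]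
    rw [AlternatingMap.map_update_sum, Finset.sum_eq_single i]
    · rw [AlternatingMap.map_update_smul, hbv, Function.update_eq_self, smul_eq_mul]
    · intro j _ hji
      rw [AlternatingMap.map_update_smul, hbv]
      rw [AlternatingMap.map_update_self _ _ (Ne.symm hji), smul_zero]
    · simp
  have key : ∀ x : V, ‖x‖ ≤ 1 → |b.repr x i| ≤ 1 := by
    intro x hx
    have h1 := hmax (a := Function.update v i x) (fun j _ => by
      rcases eq_or_ne j i with rfl | hj
      · simpa using hx
      · simpa [hj] using hv1 j)
    simp only [Set.mem_ofPred_eq, hupd, abs_mul] at h1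
    exact le_of_mul_le_mul_right (by simpa using h1) (abs_pos.2 hdet)
  rcases eq_or_ne x 0 with rfl | hx
  · simp
  · have hx' : 0 < ‖x‖ := norm_pos_iff.2 hx
    have h1 := key (‖x‖⁻¹ • x) (by simp [norm_smul, inv_mul_cancel₀ hx'.ne'])
    simp only [map_smul, Finsupp.smul_apply, smul_eq_mul, abs_mul, abs_inv, abs_norm] at h1
    rw [inv_mul_le_iff₀ hx'] at h1
    simpa using h1

/-- Auerbach bases with respect to a norm which is given as a function. -/
theorem exists_auerbach_basis_of_norm {V : Type*} [AddCommGroup V] [Module ℝ V]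
    [FiniteDimensional ℝ V] {n : ℕ} (b₀ : Module.Basis (Fin n) ℝ V) (ρ : V → ℝ)
    (hnonneg : ∀ x, 0 ≤ ρ x) (hadd : ∀ x y, ρ (x + y) ≤ ρ x + ρ y)
    (hsmul : ∀ (c : ℝ) x, ρ (c • x) = |c| * ρ x)
    (hpos : ∀ x, ρ x = 0 → x = 0) :
    ∃ b : Module.Basis (Fin n) ℝ V, (∀ i, ρ (b i) ≤ 1) ∧ ∀ x i, |b.repr x i| ≤ ρ x := by
  let _ : Norm V := ⟨ρ⟩
  have core : NormedSpace.Core ℝ V :=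
    { norm_nonneg := hnonneg
      norm_smul := fun c x => by rw [Real.norm_eq_abs]; exact hsmul c x
      norm_triangle := hadd
      norm_eq_zero_iff := fun x => ⟨hpos x, fun h => by
        have := hsmul 0 x
        rw [h, zero_smul, abs_zero, zero_mul] at this
        rw [h]
        exact this⟩ }
  let _ : NormedAddCommGroup V := NormedAddCommGroup.ofCore core
  let _ : NormedSpace ℝ V := NormedSpace.ofCore core
  exact exists_auerbach_basis b₀

/-! ### Pairs of operator valued functions -/

/-- Self-adjoint operator valued functions `U = W ^ (1 / r)`, `V = W ^ (-1 / r)`, where `W` has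
`A_r` constant at most `K`. -/
structure IsWeightPair {d n : ℕ} (r K : ℝ)
    (U V : EuclideanSpace ℝ (Fin d) → EuclideanSpace ℝ (Fin n) →L[ℝ] EuclideanSpace ℝ (Fin n)) :
    Prop where
  meas_left : AEStronglyMeasurable U volume
  meas_right : AEStronglyMeasurable V volume
  mul_eq_one : ∀ᵐ x, U x * V x = 1
  selfAdjoint_left : ∀ᵐ x, IsSelfAdjoint (U x)
  selfAdjoint_right : ∀ᵐ x, IsSelfAdjoint (V x)
  le : ∀ Q : Cube d, ⨍⁻ x in Q.toSet, (⨍⁻ y in Q.toSet, ‖U x * V y‖ₑ ^ Real.conjExponent r ∂volume)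
    ^ (r / Real.conjExponent r) ∂volume ≤ ENNReal.ofReal K

lemma div_conjExponent {r : ℝ} (hr : 1 < r) : r / Real.conjExponent r = r - 1 := by
  have : 0 < r - 1 := by linarith
  rw [Real.conjExponent]
  field_simp

lemma conjExponent_conjExponent {r : ℝ} (hr : 1 < r) :
    Real.conjExponent (Real.conjExponent r) = r :=
  (Real.HolderConjugate.conjExponent hr).symm.conjExponent_eq

lemma conjExponent_sub_one {r : ℝ} (hr : 1 < r) : Real.conjExponent r - 1 = 1 / (r - 1) := by
  have : 0 < r - 1 := by linarith
  rw [Real.conjExponent]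
  field_simp
  ring

lemma laverage_mono_ae {d : ℕ} (Q : Cube d) {f g : EuclideanSpace ℝ (Fin d) → ℝ≥0∞}
    (h : ∀ᵐ x, f x ≤ g x) : ⨍⁻ x in Q.toSet, f x ∂volume ≤ ⨍⁻ x in Q.toSet, g x ∂volume := by
  rw [Q.laverage_eq, Q.laverage_eq]
  gcongr _ * ?_
  exact lintegral_mono_ae (ae_restrict_of_ae h)

lemma laverage_const_mul {d : ℕ} (Q : Cube d) {f : EuclideanSpace ℝ (Fin d) → ℝ≥0∞}
    (c : ℝ≥0∞) (hf : AEMeasurable f) :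
    ⨍⁻ x in Q.toSet, c * f x ∂volume = c * ⨍⁻ x in Q.toSet, f x ∂volume := by
  rw [Q.laverage_eq, Q.laverage_eq, lintegral_const_mul'' _ hf.restrict]
  ring

lemma enorm_mul_comm_of_isSelfAdjoint {H : Type*} [NormedAddCommGroup H] [InnerProductSpace ℝ H]
    [CompleteSpace H] {A B : H →L[ℝ] H} (hA : IsSelfAdjoint A) (hB : IsSelfAdjoint B) :
    ‖A * B‖ₑ = ‖B * A‖ₑ := by
  have h : star (A * B) = B * A := by rw [star_mul, hA.star_eq, hB.star_eq]
  rw [← h, ← ofReal_norm, ← ofReal_norm, ContinuousLinearMap.star_eq_adjoint,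
    LinearIsometryEquiv.norm_map]

namespace IsWeightPair

variable {d n : ℕ} {r K : ℝ}
  {U V : EuclideanSpace ℝ (Fin d) → EuclideanSpace ℝ (Fin n) →L[ℝ] EuclideanSpace ℝ (Fin n)}

lemma mul_eq_one' (h : IsWeightPair r K U V) : ∀ᵐ x, V x * U x = 1 := by
  filter_upwards [h.mul_eq_one, h.selfAdjoint_left, h.selfAdjoint_right] with x h1 h2 h3
  have := congrArg star h1
  rwa [star_mul, h2.star_eq, h3.star_eq, star_one] at this

lemma aemeasurable_left (h : IsWeightPair r K U V) (e : EuclideanSpace ℝ (Fin n)) :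
    AEMeasurable fun x => ‖U x e‖ₑ :=
  (h.meas_left.apply_continuousLinearMap e).enorm

lemma aemeasurable_right (h : IsWeightPair r K U V) (e : EuclideanSpace ℝ (Fin n)) :
    AEMeasurable fun x => ‖V x e‖ₑ :=
  (h.meas_right.apply_continuousLinearMap e).enorm

lemma ae_left_ne_zero (h : IsWeightPair r K U V) {e : EuclideanSpace ℝ (Fin n)} (he : e ≠ 0) :
    ∀ᵐ x, ‖U x e‖ₑ ≠ 0 := by
  filter_upwards [h.mul_eq_one'] with x hx h0
  rw [enorm_eq_zero] at h0
  apply he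
  have := congrArg (fun A => A e) hx
  simpa [h0] using this.symm

lemma ae_right_ne_zero (h : IsWeightPair r K U V) {e : EuclideanSpace ℝ (Fin n)} (he : e ≠ 0) :
    ∀ᵐ x, ‖V x e‖ₑ ≠ 0 := by
  filter_upwards [h.mul_eq_one] with x hx h0
  rw [enorm_eq_zero] at h0
  apply he
  have := congrArg (fun A => A e) hx
  simpa [h0] using this.symm

/-- The scalar weights `|W ^ (1 / r) e| ^ r`. -/
lemma isApWeight_left (h : IsWeightPair r K U V) (hr : 1 < r) {e : EuclideanSpace ℝ (Fin n)}
    (he : e ≠ 0) : IsApWeight r K (fun x => ‖U x e‖ₑ ^ r) where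
  aemeasurable := (h.aemeasurable_left e).pow_const _
  ae_ne_zero := by
    filter_upwards [h.ae_left_ne_zero he] with x hx
    simp [hx, show 0 < r by linarith]
  ae_ne_top := ae_of_all _ fun x => ENNReal.rpow_ne_top_of_nonneg (by linarith) enorm_ne_top
  le Q := by
    have hr1 : 0 < r - 1 := by linarith
    set r' := Real.conjExponent r with hr'
    have hr'0 : 0 < r' := (Real.HolderConjugate.conjExponent hr).symm.pos
    refine le_trans ?_ (h.le Q)
    have hm : AEMeasurable fun x => ‖U x e‖ₑ ^ (-r') := (h.aemeasurable_left e).pow_const _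
    have hσ : ∀ x, (‖U x e‖ₑ ^ r) ^ (-(1 / (r - 1))) = ‖U x e‖ₑ ^ (-r') := fun x => by
      rw [← ENNReal.rpow_mul]
      congr 1
      rw [hr', Real.conjExponent]
      ring
    simp only [hσ]
    rw [mul_comm, ← laverage_const_mul Q _ ((h.aemeasurable_left e).pow_const _)]
    refine laverage_mono_ae Q ?_
    rw [← hr', div_conjExponent hr]
    filter_upwards with x
    -- From U(x)e = U(x)V(y) U(y)e, the quotient |U(x)e| / |U(y)e| is at most |U(x)V(y)|: the scalar
    -- A_r integrand is dominated pointwise by the matrix one.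
    have h1 : ‖U x e‖ₑ ^ r' * ⨍⁻ y in Q.toSet, ‖U y e‖ₑ ^ (-r') ∂volume ≤
        ⨍⁻ y in Q.toSet, ‖U x * V y‖ₑ ^ r' ∂volume := by
      rw [← laverage_const_mul Q _ hm]
      refine laverage_mono_ae Q ?_
      filter_upwards [h.mul_eq_one', h.ae_left_ne_zero he] with y hy hy0
      have h2 : ‖U x e‖ₑ ≤ ‖U x * V y‖ₑ * ‖U y e‖ₑ := by
        have : U x e = (U x * V y) (U y e) := by
          have := congrArg (fun A => U x (A e)) hy
          simpa using this.symm
        rw [this]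
        exact ContinuousLinearMap.le_opENorm _ _
      calc ‖U x e‖ₑ ^ r' * ‖U y e‖ₑ ^ (-r')
          ≤ (‖U x * V y‖ₑ * ‖U y e‖ₑ) ^ r' * ‖U y e‖ₑ ^ (-r') := by gcongr
        _ = ‖U x * V y‖ₑ ^ r' := by
          rw [ENNReal.mul_rpow_of_nonneg _ _ hr'0.le, mul_assoc,
            ← ENNReal.rpow_add _ _ hy0 enorm_ne_top]
          simp
    calc (⨍⁻ y in Q.toSet, ‖U y e‖ₑ ^ (-r') ∂volume) ^ (r - 1) * ‖U x e‖ₑ ^ r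
        = (‖U x e‖ₑ ^ r' * ⨍⁻ y in Q.toSet, ‖U y e‖ₑ ^ (-r') ∂volume) ^ (r - 1) := by
          rw [ENNReal.mul_rpow_of_nonneg _ _ hr1.le, ← ENNReal.rpow_mul, mul_comm]
          congr 2
          rw [hr', Real.conjExponent]
          field_simp
      _ ≤ _ := by gcongr

/-- The scalar weights `|W ^ (-1 / r) e| ^ r'`. -/
lemma isApWeight_right (h : IsWeightPair r K U V) (hr : 1 < r) (hK : 0 ≤ K)
    {e : EuclideanSpace ℝ (Fin n)} (he : e ≠ 0) :
    IsApWeight (Real.conjExponent r) (K ^ (1 / (r - 1)))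
      (fun x => ‖V x e‖ₑ ^ Real.conjExponent r) where
  aemeasurable := (h.aemeasurable_right e).pow_const _
  ae_ne_zero := by
    filter_upwards [h.ae_right_ne_zero he] with x hx
    simp [hx, (Real.HolderConjugate.conjExponent hr).symm.pos]
  ae_ne_top := ae_of_all _ fun x => ENNReal.rpow_ne_top_of_nonneg
    (Real.HolderConjugate.conjExponent hr).symm.pos.le enorm_ne_top
  le Q := by
    have hr1 : 0 < r - 1 := by linarith
    have hr'1 := conjExponent_sub_one hr
    set r' := Real.conjExponent r with hr'
    have hr'0 : 0 < r' := (Real.HolderConjugate.conjExponent hr).symm.pos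
    have hm : AEMeasurable fun x => ‖V x e‖ₑ ^ r' := (h.aemeasurable_right e).pow_const _
    have hσ : ∀ x, (‖V x e‖ₑ ^ r') ^ (-(1 / (r' - 1))) = ‖V x e‖ₑ ^ (-r) := fun x => by
      rw [← ENNReal.rpow_mul, hr'1]
      congr 1
      rw [hr', Real.conjExponent]
      field_simp
    simp only [hσ]
    -- This is the scalar A_{r'} condition raised to the power r - 1. In this form it compares
    -- directly with the matrix condition, through V(y)e = V(y)U(x) V(x)e; extracting the root turns
    -- K into K^{1/(r-1)}.
    have hmain : (⨍⁻ x in Q.toSet, ‖V x e‖ₑ ^ r' ∂volume) ^ (r - 1) *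
        ⨍⁻ x in Q.toSet, ‖V x e‖ₑ ^ (-r) ∂volume ≤ ENNReal.ofReal K := by
      refine le_trans ?_ (h.le Q)
      rw [← laverage_const_mul Q _ ((h.aemeasurable_right e).pow_const _)]
      refine laverage_mono_ae Q ?_
      rw [← hr', div_conjExponent hr]
      filter_upwards [h.mul_eq_one, h.ae_right_ne_zero he, h.selfAdjoint_left] with x hx hx0 hxs
      have h1 : ⨍⁻ y in Q.toSet, ‖V y e‖ₑ ^ r' ∂volume ≤
          (⨍⁻ y in Q.toSet, ‖U x * V y‖ₑ ^ r' ∂volume) * ‖V x e‖ₑ ^ r' := by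
        have hcm : AEMeasurable fun y => ‖U x * V y‖ₑ ^ r' :=
          (h.meas_right.const_mul (U x)).enorm.pow_const _
        rw [mul_comm, ← laverage_const_mul Q _ hcm]
        refine laverage_mono_ae Q ?_
        filter_upwards [h.selfAdjoint_right] with y hys
        have h2 : ‖V y e‖ₑ ≤ ‖U x * V y‖ₑ * ‖V x e‖ₑ := by
          have : V y e = (V y * U x) (V x e) := by
            have := congrArg (fun A => V y (A e)) hx
            simpa using this.symm
          rw [this, enorm_mul_comm_of_isSelfAdjoint hxs hys]
          exact ContinuousLinearMap.le_opENorm _ _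
        calc ‖V y e‖ₑ ^ r' ≤ (‖U x * V y‖ₑ * ‖V x e‖ₑ) ^ r' := by gcongr
          _ = _ := by rw [ENNReal.mul_rpow_of_nonneg _ _ hr'0.le, mul_comm]
      calc (⨍⁻ y in Q.toSet, ‖V y e‖ₑ ^ r' ∂volume) ^ (r - 1) * ‖V x e‖ₑ ^ (-r)
          ≤ ((⨍⁻ y in Q.toSet, ‖U x * V y‖ₑ ^ r' ∂volume) * ‖V x e‖ₑ ^ r') ^ (r - 1) *
              ‖V x e‖ₑ ^ (-r) := by gcongr
        _ = _ := by
          rw [ENNReal.mul_rpow_of_nonneg _ _ hr1.le, ← ENNReal.rpow_mul, mul_assoc,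
            ← ENNReal.rpow_add _ _ hx0 enorm_ne_top]
          have : r' * (r - 1) + -r = 0 := by
            rw [hr', Real.conjExponent]
            field_simp
            ring
          rw [this]
          simp
    rw [hr'1, ← ENNReal.ofReal_rpow_of_nonneg hK (by positivity)]
    calc (⨍⁻ x in Q.toSet, ‖V x e‖ₑ ^ r' ∂volume) *
          (⨍⁻ x in Q.toSet, ‖V x e‖ₑ ^ (-r) ∂volume) ^ (1 / (r - 1))
        = ((⨍⁻ x in Q.toSet, ‖V x e‖ₑ ^ r' ∂volume) ^ (r - 1) *
            ⨍⁻ x in Q.toSet, ‖V x e‖ₑ ^ (-r) ∂volume) ^ (1 / (r - 1)) := by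
          rw [ENNReal.mul_rpow_of_nonneg _ _ (by positivity), ← ENNReal.rpow_mul,
            mul_one_div_cancel hr1.ne', ENNReal.rpow_one]
      _ ≤ _ := by gcongr

lemma one_le [NeZero n] (h : IsWeightPair r K U V) (hr : 1 < r) : 1 ≤ K :=
  (h.isApWeight_left hr (e := EuclideanSpace.single 0 1) (by simp)).one_le hr

end IsWeightPair

lemma ENNReal.rpow_le_one_iff_of_pos {x : ℝ≥0∞} {z : ℝ} (hz : 0 < z) : x ^ z ≤ 1 ↔ x ≤ 1 := by
  simpa using ENNReal.rpow_le_rpow_iff (x := x) (y := 1) hz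

/-! ### Separation of variables in the kernel and the bilinear estimate on one cube -/

namespace IsWeightPair

variable {d n : ℕ} {r K : ℝ}
  {U V : EuclideanSpace ℝ (Fin d) → EuclideanSpace ℝ (Fin n) →L[ℝ] EuclideanSpace ℝ (Fin n)}

lemma eLpNorm_right_eq (hr : 1 < r) (Q : Cube d) (e : EuclideanSpace ℝ (Fin n)) :
    eLpNorm (fun x => V x e) (ENNReal.ofReal (Real.conjExponent r)) Q.avgMeasure =
      (⨍⁻ x in Q.toSet, ‖V x e‖ₑ ^ Real.conjExponent r ∂volume) ^ (1 / Real.conjExponent r) := by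
  have hr'0 : 0 < Real.conjExponent r := (Real.HolderConjugate.conjExponent hr).symm.pos
  rw [eLpNorm_eq_lintegral_rpow_enorm_toReal (by simpa using hr'0) ENNReal.ofReal_ne_top,
    ENNReal.toReal_ofReal hr'0.le, Q.lintegral_avgMeasure]

/-- The scalar weight |V e|^{r'} has finite integral over cubes. This makes the averaged norm in
`exists_decomposition` finite. -/
lemma memLp_right (h : IsWeightPair r K U V) (hr : 1 < r) (hK : 0 ≤ K) (Q : Cube d)
    (e : EuclideanSpace ℝ (Fin n)) :
    MemLp (fun x => V x e) (ENNReal.ofReal (Real.conjExponent r)) Q.avgMeasure := by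
  refine ⟨(h.meas_right.apply_continuousLinearMap e).restrict.smul_measure _, ?_⟩
  rcases eq_or_ne e 0 with rfl | he
  · simp
  have hr'1 : 1 < Real.conjExponent r := (Real.HolderConjugate.conjExponent hr).symm.lt
  rw [eLpNorm_right_eq hr, Q.laverage_eq]
  refine ENNReal.rpow_lt_top_of_nonneg (by positivity) ?_
  exact ENNReal.mul_ne_top (ENNReal.inv_ne_top.2 Q.volume_toSet_ne_zero)
    ((h.isApWeight_right hr hK he).lintegral_ne_top hr'1 Q)

/-- On every cube the kernel `V x * U y` is dominated by a sum of `n` products of functions of one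
variable, with uniformly controlled averages. -/
lemma exists_decomposition (h : IsWeightPair r K U V) (hr : 1 < r) (hK : 0 ≤ K) (Q : Cube d) :
    ∃ b c : Fin n → EuclideanSpace ℝ (Fin n), (∀ i, b i ≠ 0) ∧ (∀ i, c i ≠ 0) ∧
      (∀ i, ⨍⁻ x in Q.toSet, ‖V x (b i)‖ₑ ^ Real.conjExponent r ∂volume ≤ 1) ∧
      (∀ i, ⨍⁻ x in Q.toSet, ‖U x (c i)‖ₑ ^ r ∂volume ≤ ENNReal.ofReal K) ∧
      ∀ᵐ y, ∀ x, ‖V x * U y‖ₑ ≤ ∑ i, ‖V x (b i)‖ₑ * ‖U y (c i)‖ₑ := by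
  have hr'0 : 0 < Real.conjExponent r := (Real.HolderConjugate.conjExponent hr).symm.pos
  have hr'1 : 1 ≤ Real.conjExponent r := (Real.HolderConjugate.conjExponent hr).symm.lt.le
  set r' := Real.conjExponent r with hr'
  set ρ : EuclideanSpace ℝ (Fin n) → ℝ := fun e =>
    (eLpNorm (fun x => V x e) (ENNReal.ofReal r') Q.avgMeasure).toReal with hρ
  have hρt : ∀ e, ENNReal.ofReal (ρ e) =
      (⨍⁻ x in Q.toSet, ‖V x e‖ₑ ^ r' ∂volume) ^ (1 / r') := fun e => by
    rw [hρ, ← eLpNorm_right_eq hr]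
    exact ENNReal.ofReal_toReal (h.memLp_right hr hK Q e).2.ne
  obtain ⟨b, hb1, hb2⟩ := exists_auerbach_basis_of_norm
    (EuclideanSpace.basisFun (Fin n) ℝ).toBasis ρ (fun _ => ENNReal.toReal_nonneg)
    (fun e e' => by
      rw [hρ, ← ENNReal.toReal_add (h.memLp_right hr hK Q e).2.ne (h.memLp_right hr hK Q e').2.ne]
      refine ENNReal.toReal_mono (ENNReal.add_ne_top.2
        ⟨(h.memLp_right hr hK Q e).2.ne, (h.memLp_right hr hK Q e').2.ne⟩) ?_
      simp only [map_add]
      exact eLpNorm_add_le (h.memLp_right hr hK Q e).1 (h.memLp_right hr hK Q e').1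
        (by simpa using hr'1))
    (fun t e => by
      simp only [hρ, map_smul]
      have := eLpNorm_const_smul t (fun x => V x e) (ENNReal.ofReal r') Q.avgMeasure
      simp only [Pi.smul_def] at this
      rw [this, ENNReal.toReal_mul]
      simp)
    (fun e he => by
      by_contra hne
      have h1 := hρt e
      rw [he, ENNReal.ofReal_zero] at h1
      have h2 := h1.symm
      rw [ENNReal.rpow_eq_zero_iff_of_pos (by positivity), Q.laverage_eq, mul_eq_zero] at h2
      rcases h2 with h2 | h2
      · exact ENNReal.inv_ne_zero.2 Q.volume_toSet_ne_top h2
      · exact (h.isApWeight_right hr hK hne).lintegral_ne_zero Q h2)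
  -- The dual basis: the coordinate functionals of b, as vectors for the Euclidean inner product.
  set c : Fin n → EuclideanSpace ℝ (Fin n) := fun i =>
    (InnerProductSpace.toDual ℝ _).symm (LinearMap.toContinuousLinearMap (b.coord i)) with hc
  have hcb : ∀ i x, inner ℝ (c i) x = b.repr x i := fun i x => by
    rw [hc, InnerProductSpace.toDual_symm_apply]
    rfl
  refine ⟨b, c, fun i => b.ne_zero i, fun i h0 => ?_, fun i => ?_, fun i => ?_, ?_⟩
  · have := hcb i (b i)
    simp [h0] at this
  · have h1 := ENNReal.ofReal_le_ofReal (hb1 i)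
    rw [hρt, ENNReal.ofReal_one, ENNReal.rpow_le_one_iff_of_pos (by positivity)] at h1
    exact h1
  · refine le_trans ?_ (h.le Q)
    refine laverage_mono_ae Q ?_
    filter_upwards [h.selfAdjoint_left] with y hy
    set z := U y (c i) with hz
    -- With z = U(y)c_i, self-adjointness gives |z|^2 = ⟨c_i, U(y)z⟩ ≤ ρ(U(y)z) ≤ (⨍_Q
    -- |U(y)V(x)|^{r'} dx)^{1/r'} |z|. Cancelling |z| bounds |U(y)c_i|^r by the inner integral of
    -- the A_r condition.
    have h1 : ‖z‖ ^ 2 ≤ ρ (U y z) := by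
      have h2 : ‖z‖ ^ 2 = b.repr (U y z) i := by
        rw [← hcb, ← real_inner_self_eq_norm_sq]
        conv_lhs => rw [hz]
        have := ContinuousLinearMap.adjoint_inner_right (U y) (c i) z
        rw [← ContinuousLinearMap.star_eq_adjoint, hy.star_eq] at this
        exact this.symm
      rw [h2]
      exact (le_abs_self _).trans (hb2 _ _)
    have h3 : ‖z‖ₑ * ‖z‖ₑ ≤
        (⨍⁻ x in Q.toSet, ‖U y * V x‖ₑ ^ r' ∂volume) ^ (1 / r') * ‖z‖ₑ := by
      calc ‖z‖ₑ * ‖z‖ₑ = ENNReal.ofReal (‖z‖ ^ 2) := by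
            rw [sq, ENNReal.ofReal_mul (norm_nonneg _), ofReal_norm]
        _ ≤ (⨍⁻ x in Q.toSet, ‖V x (U y z)‖ₑ ^ r' ∂volume) ^ (1 / r') := by
            rw [← hρt]
            exact ENNReal.ofReal_le_ofReal h1
        _ ≤ (⨍⁻ x in Q.toSet, ‖z‖ₑ ^ r' * ‖U y * V x‖ₑ ^ r' ∂volume) ^ (1 / r') := by
            gcongr ?_ ^ _
            refine laverage_mono_ae Q ?_
            filter_upwards [h.selfAdjoint_right] with x hx
            rw [← ENNReal.mul_rpow_of_nonneg _ _ hr'0.le]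
            gcongr
            rw [enorm_mul_comm_of_isSelfAdjoint hy hx, mul_comm]
            exact ContinuousLinearMap.le_opENorm (V x * U y) z
        _ = _ := by
            have hcm : AEMeasurable fun x => ‖U y * V x‖ₑ ^ r' :=
              (h.meas_right.const_mul (U y)).enorm.pow_const _
            rw [laverage_const_mul Q _ hcm,
              ENNReal.mul_rpow_of_nonneg _ _ (by positivity), ← ENNReal.rpow_mul,
              mul_one_div_cancel hr'0.ne', ENNReal.rpow_one, mul_comm]
    have h4 : ‖z‖ₑ ≤ (⨍⁻ x in Q.toSet, ‖U y * V x‖ₑ ^ r' ∂volume) ^ (1 / r') := by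
      rcases eq_or_ne z 0 with hz0 | hz0
      · rw [hz0]
        simp
      · exact (ENNReal.mul_le_mul_iff_left (by simpa using hz0) enorm_ne_top).1 h3
    calc ‖z‖ₑ ^ r ≤ ((⨍⁻ x in Q.toSet, ‖U y * V x‖ₑ ^ r' ∂volume) ^ (1 / r')) ^ r := by
          gcongr
      _ = _ := by
          rw [← ENNReal.rpow_mul]
          congr 1
          ring
  · filter_upwards [h.selfAdjoint_left] with y hy x
    have hbound : ‖V x * U y‖ ≤ ∑ i, ‖V x (b i)‖ * ‖U y (c i)‖ := by
      refine ContinuousLinearMap.opNorm_le_bound _ (by positivity) fun z => ?_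
      have h1 : (V x * U y) z = ∑ i, b.repr (U y z) i • V x (b i) := by
        change V x (U y z) = _
        conv_lhs => rw [← b.sum_repr (U y z), map_sum]
        simp only [map_smul]
      rw [h1, Finset.sum_mul]
      refine (norm_sum_le _ _).trans (Finset.sum_le_sum fun i _ => ?_)
      rw [norm_smul, ← hcb, mul_comm, mul_assoc]
      gcongr
      have h2 : inner ℝ (c i) (U y z) = inner ℝ (U y (c i)) z := by
        have := ContinuousLinearMap.adjoint_inner_left (U y) z (c i)
        rw [← ContinuousLinearMap.star_eq_adjoint, hy.star_eq] at this
        exact this.symm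
      rw [h2]
      exact abs_real_inner_le_norm _ _
    calc ‖V x * U y‖ₑ ≤ ENNReal.ofReal (∑ i, ‖V x (b i)‖ * ‖U y (c i)‖) := by
          rw [← ofReal_norm]
          exact ENNReal.ofReal_le_ofReal hbound
      _ = _ := by
          rw [ENNReal.ofReal_sum_of_nonneg fun i _ => by positivity]
          refine Finset.sum_congr rfl fun i _ => ?_
          rw [ENNReal.ofReal_mul (norm_nonneg _), ofReal_norm, ofReal_norm]

/-- The bilinear estimate on a single cube. -/
lemma laverage_laverage_le (h : IsWeightPair r K U V) (hr : 1 < r) (hK : 1 ≤ K) (Q : Cube d)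
    {f g : EuclideanSpace ℝ (Fin d) → ℝ≥0∞} (hf : AEMeasurable f) (hg : AEMeasurable g) :
    ⨍⁻ y in Q.toSet, (⨍⁻ x in Q.toSet, ‖V x * U y‖ₑ * f x ∂volume) * g y ∂volume ≤
      n * 16 * ENNReal.ofReal K ^ (1 / r) *
        ((⨍⁻ x in Q.toSet, f x ^ gainExponent d (Real.conjExponent r) (K ^ (1 / (r - 1)))
          ∂volume) ^ (1 / gainExponent d (Real.conjExponent r) (K ^ (1 / (r - 1)))) *
        (⨍⁻ x in Q.toSet, g x ^ gainExponent d r K ∂volume) ^ (1 / gainExponent d r K)) := by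
  have hr0 : 0 < r := by linarith
  have hr1 : 0 < r - 1 := by linarith
  have hr'0 : 0 < Real.conjExponent r := (Real.HolderConjugate.conjExponent hr).symm.pos
  have hr'1 : 1 < Real.conjExponent r := (Real.HolderConjugate.conjExponent hr).symm.lt
  have hK1 : 1 ≤ K ^ (1 / (r - 1)) := Real.one_le_rpow hK (by positivity)
  obtain ⟨b, c, hb0, hc0, hb, hc, hbc⟩ := h.exists_decomposition hr (by linarith) Q
  set A := (⨍⁻ x in Q.toSet, f x ^ gainExponent d (Real.conjExponent r) (K ^ (1 / (r - 1)))
          ∂volume) ^ (1 / gainExponent d (Real.conjExponent r) (K ^ (1 / (r - 1))))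
  set B := (⨍⁻ x in Q.toSet, g x ^ gainExponent d r K ∂volume) ^ (1 / gainExponent d r K)
  have hA : ∀ i, ⨍⁻ x in Q.toSet, ‖V x (b i)‖ₑ * f x ∂volume ≤ 4 * A := by
    intro i
    have h1 := (h.isApWeight_right hr (by linarith) (hb0 i)).laverage_rpow_mul_le hr'1 hK1 Q hf
    simp only [← ENNReal.rpow_mul, mul_one_div_cancel hr'0.ne', ENNReal.rpow_one] at h1
    refine h1.trans ?_
    gcongr
    refine mul_le_of_le_one_right' ?_
    exact (ENNReal.rpow_le_one_iff_of_pos (by positivity)).2 (hb i)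
  -- Here the average of |U c_i|^r costs K^{1/r}; the factors |V b_i| cost no power of K because
  -- their averages are at most 1.
  have hB : ∀ i, ⨍⁻ x in Q.toSet, ‖U x (c i)‖ₑ * g x ∂volume ≤
      4 * ENNReal.ofReal K ^ (1 / r) * B := by
    intro i
    have h1 := (h.isApWeight_left hr (hc0 i)).laverage_rpow_mul_le hr hK Q hg
    simp only [← ENNReal.rpow_mul, mul_one_div_cancel hr0.ne', ENNReal.rpow_one] at h1
    refine h1.trans ?_
    gcongr
    exact hc i
  have hVf : ∀ i, AEMeasurable fun x => ‖V x (b i)‖ₑ * f x := fun i =>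
    (h.aemeasurable_right _).mul hf
  have hUg : ∀ i, AEMeasurable fun x => ‖U x (c i)‖ₑ * g x := fun i =>
    (h.aemeasurable_left _).mul hg
  have hsum : ∀ {F : Fin n → EuclideanSpace ℝ (Fin d) → ℝ≥0∞}, (∀ i, AEMeasurable (F i)) →
      ⨍⁻ x in Q.toSet, ∑ i, F i x ∂volume = ∑ i, ⨍⁻ x in Q.toSet, F i x ∂volume := by
    intro F hF
    simp only [Q.laverage_eq]
    rw [lintegral_finsetSum' _ fun i _ => (hF i).restrict, Finset.mul_sum]
  calc ⨍⁻ y in Q.toSet, (⨍⁻ x in Q.toSet, ‖V x * U y‖ₑ * f x ∂volume) * g y ∂volume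
      ≤ ⨍⁻ y in Q.toSet, ∑ i, 4 * A * (‖U y (c i)‖ₑ * g y) ∂volume := by
        refine laverage_mono_ae Q ?_
        filter_upwards [hbc] with y hy
        calc (⨍⁻ x in Q.toSet, ‖V x * U y‖ₑ * f x ∂volume) * g y
            ≤ (⨍⁻ x in Q.toSet, ∑ i, ‖U y (c i)‖ₑ * (‖V x (b i)‖ₑ * f x) ∂volume) * g y := by
              gcongr ?_ * _
              refine laverage_mono_ae Q (ae_of_all _ fun x => ?_)
              calc ‖V x * U y‖ₑ * f x ≤ (∑ i, ‖V x (b i)‖ₑ * ‖U y (c i)‖ₑ) * f x := by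
                    gcongr
                    exact hy x
                _ = _ := by
                    rw [Finset.sum_mul]
                    exact Finset.sum_congr rfl fun i _ => by ring
          _ = (∑ i, ‖U y (c i)‖ₑ * ⨍⁻ x in Q.toSet, ‖V x (b i)‖ₑ * f x ∂volume) * g y := by
              rw [hsum fun i => (hVf i).const_mul _]
              congr 1
              exact Finset.sum_congr rfl fun i _ =>
                laverage_const_mul Q _ (hVf i)
          _ ≤ (∑ i, ‖U y (c i)‖ₑ * (4 * A)) * g y := by
              gcongr
              exact hA _
          _ = _ := by
              rw [Finset.sum_mul]
              exact Finset.sum_congr rfl fun i _ => by ring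
    _ = ∑ i, 4 * A * ⨍⁻ y in Q.toSet, ‖U y (c i)‖ₑ * g y ∂volume := by
        rw [hsum fun i => (hUg i).const_mul _]
        exact Finset.sum_congr rfl fun i _ =>
          laverage_const_mul Q _ (hUg i)
    _ ≤ ∑ i : Fin n, 4 * A * (4 * ENNReal.ofReal K ^ (1 / r) * B) := by
        gcongr
        exact hB _
    _ = _ := by
        rw [Finset.sum_const, Finset.card_univ, Fintype.card_fin, nsmul_eq_mul]
        ring

end IsWeightPair

/-! ### The bilinear sparse estimate -/

lemma tsum_mul_mul_le_Lp_mul_Lq {ι : Type*} (c a b : ι → ℝ≥0∞) {p q : ℝ}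
    (hpq : p.HolderConjugate q) :
    ∑' i, c i * (a i * b i) ≤ (∑' i, c i * a i ^ p) ^ (1 / p) * (∑' i, c i * b i ^ q) ^ (1 / q) := by
  let _ : MeasurableSpace ι := ⊤
  have h := ENNReal.lintegral_mul_le_Lp_mul_Lq
    (Measure.sum fun i => c i • Measure.dirac i) hpq (f := a) (g := b)
    measurable_from_top.aemeasurable measurable_from_top.aemeasurable
  simpa only [lintegral_sum_smul_dirac, Pi.mul_apply] using h

/-- The constant of the Carleson embedding with the gain of an `A_p` weight. -/
def carlesonConst (d : ℕ) (γ p : ℝ) : ℝ :=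
  2 ^ Real.conjExponent p * (2 * p * (2 ^ p * (2 * (d + 1)))) / γ

/-- The constant in the bilinear sparse estimate. -/
def sparseConst (d n : ℕ) (r γ : ℝ) : ℝ≥0 :=
  n * 16 * Real.toNNReal (carlesonConst d γ (Real.conjExponent r)) ^ (1 / r) *
    Real.toNNReal (carlesonConst d γ r) ^ (1 / Real.conjExponent r)

/-- The bilinear sparse estimate. -/
theorem IsWeightPair.tsum_lintegral_le {d n : ℕ} {r K : ℝ}
    {U V : EuclideanSpace ℝ (Fin d) → EuclideanSpace ℝ (Fin n) →L[ℝ] EuclideanSpace ℝ (Fin n)}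
    (h : IsWeightPair r K U V) (hr : 1 < r) (hK : 1 ≤ K) {γ : ℝ} (hγ : 0 < γ) {S : Set (Cube d)}
    (hS : IsSparse γ S) (hN : IsNested S)
    {f g : EuclideanSpace ℝ (Fin d) → ℝ≥0∞} (hf : AEMeasurable f) (hg : AEMeasurable g) :
    ∑' Q : S, ∫⁻ y in (Q : Cube d).toSet,
      (⨍⁻ x in (Q : Cube d).toSet, ‖V x * U y‖ₑ * f x ∂volume) * g y ≤
      sparseConst d n r γ * ENNReal.ofReal K ^ (1 + 1 / (r - 1) - 1 / r) *
        (∫⁻ x, f x ^ r) ^ (1 / r) *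
        (∫⁻ x, g x ^ Real.conjExponent r) ^ (1 / Real.conjExponent r) := by
  have hr0 : 0 < r := by linarith
  have hr1 : 0 < r - 1 := by linarith
  have hc := Real.HolderConjugate.conjExponent hr
  have hr'0 : 0 < Real.conjExponent r := hc.symm.pos
  have hr'1 : 1 < Real.conjExponent r := hc.symm.lt
  have hK1 : 1 ≤ K ^ (1 / (r - 1)) := Real.one_le_rpow hK (by positivity)
  have hK0 : ENNReal.ofReal K ≠ 0 := by simp; linarith
  set τ₁ := gainExponent d (Real.conjExponent r) (K ^ (1 / (r - 1)))
  set τ₂ := gainExponent d r K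
  set A : Cube d → ℝ≥0∞ := fun Q => (⨍⁻ x in Q.toSet, f x ^ τ₁ ∂volume) ^ (1 / τ₁)
  set B : Cube d → ℝ≥0∞ := fun Q => (⨍⁻ x in Q.toSet, g x ^ τ₂ ∂volume) ^ (1 / τ₂)
  have hA := hS.tsum_gainExponent_le hγ hN hr'1 hK1 hf
  have hB := hS.tsum_gainExponent_le hγ hN hr hK hg
  rw [conjExponent_conjExponent hr] at hA
  have hc1 : 0 ≤ carlesonConst d γ (Real.conjExponent r) := by
    unfold carlesonConst; positivity
  have hc2 : 0 ≤ carlesonConst d γ r := by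
    unfold carlesonConst; positivity
  have hA' : ∑' Q : S, volume (Q : Cube d).toSet * A Q ^ r ≤
      ENNReal.ofReal (carlesonConst d γ (Real.conjExponent r)) *
        ENNReal.ofReal K ^ (1 / (r - 1)) * ∫⁻ x, f x ^ r := by
    rw [ENNReal.ofReal_rpow_of_nonneg (by linarith) (by positivity), ← ENNReal.ofReal_mul hc1,
      carlesonConst, conjExponent_conjExponent hr]
    exact hA
  have hB' : ∑' Q : S, volume (Q : Cube d).toSet * B Q ^ Real.conjExponent r ≤
      ENNReal.ofReal (carlesonConst d γ r) * ENNReal.ofReal K *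
        ∫⁻ x, g x ^ Real.conjExponent r := by
    rw [← ENNReal.ofReal_mul hc2, carlesonConst]
    exact hB
  calc ∑' Q : S, ∫⁻ y in (Q : Cube d).toSet,
        (⨍⁻ x in (Q : Cube d).toSet, ‖V x * U y‖ₑ * f x ∂volume) * g y
      ≤ ∑' Q : S, n * 16 * ENNReal.ofReal K ^ (1 / r) *
          (volume (Q : Cube d).toSet * (A Q * B Q)) := by
        refine ENNReal.tsum_le_tsum fun Q => ?_
        rw [← Cube.volume_mul_laverage]
        calc _ ≤ volume (Q : Cube d).toSet *
              (n * 16 * ENNReal.ofReal K ^ (1 / r) * (A Q * B Q)) := by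
              gcongr
              exact h.laverage_laverage_le hr hK Q hf hg
          _ = _ := by ring
    _ ≤ n * 16 * ENNReal.ofReal K ^ (1 / r) *
          ((∑' Q : S, volume (Q : Cube d).toSet * A Q ^ r) ^ (1 / r) *
          (∑' Q : S, volume (Q : Cube d).toSet * B Q ^ Real.conjExponent r) ^
            (1 / Real.conjExponent r)) := by
        rw [ENNReal.tsum_mul_left]
        gcongr _ * ?_
        exact tsum_mul_mul_le_Lp_mul_Lq _ _ _ hc
    _ ≤ n * 16 * ENNReal.ofReal K ^ (1 / r) *
          ((ENNReal.ofReal (carlesonConst d γ (Real.conjExponent r)) *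
            ENNReal.ofReal K ^ (1 / (r - 1)) * ∫⁻ x, f x ^ r) ^ (1 / r) *
          (ENNReal.ofReal (carlesonConst d γ r) * ENNReal.ofReal K *
            ∫⁻ x, g x ^ Real.conjExponent r) ^ (1 / Real.conjExponent r)) := by
        gcongr
    _ = n * 16 * ENNReal.ofReal (carlesonConst d γ (Real.conjExponent r)) ^ (1 / r) *
          ENNReal.ofReal (carlesonConst d γ r) ^ (1 / Real.conjExponent r) *
          (ENNReal.ofReal K ^ (1 / r) * ENNReal.ofReal K ^ (1 / (r - 1) * (1 / r)) *
            ENNReal.ofReal K ^ (1 / Real.conjExponent r)) * (∫⁻ x, f x ^ r) ^ (1 / r) *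
          (∫⁻ x, g x ^ Real.conjExponent r) ^ (1 / Real.conjExponent r) := by
        rw [ENNReal.mul_rpow_of_nonneg _ _ (by positivity),
          ENNReal.mul_rpow_of_nonneg _ _ (by positivity),
          ENNReal.mul_rpow_of_nonneg _ _ (by positivity),
          ENNReal.mul_rpow_of_nonneg _ _ (by positivity), ← ENNReal.rpow_mul]
        ring
    _ = _ := by
        rw [← ENNReal.rpow_add _ _ hK0 ENNReal.ofReal_ne_top,
          ← ENNReal.rpow_add _ _ hK0 ENNReal.ofReal_ne_top]
        -- The three powers of K come from the single cubes, from the embedding of f (A_{r'}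
        -- constant K^{1/(r-1)}, then an r-th root) and from the embedding of g.
        have he : 1 / r + 1 / (r - 1) * (1 / r) + 1 / Real.conjExponent r =
            1 + 1 / (r - 1) - 1 / r := by
          rw [Real.conjExponent]
          field_simp
          ring
        rw [he]
        congr 3
        rw [sparseConst]
        push_cast
        rw [ENNReal.coe_rpow_of_nonneg _ (by positivity),
          ENNReal.coe_rpow_of_nonneg _ (by positivity)]
        rfl

/-! ### Powers of positive definite matrices -/

namespace Matrix.PosDef

variable {n : ℕ} {A : Matrix (Fin n) (Fin n) ℝ}

lemma pos_of_mem_spectrum (hA : A.PosDef) {t : ℝ} (ht : t ∈ spectrum ℝ A) : 0 < t := by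
  rw [hA.isHermitian.spectrum_real_eq_range_eigenvalues] at ht
  obtain ⟨i, rfl⟩ := ht
  exact hA.eigenvalues_pos i

lemma matPow_mul_matPow (hA : A.PosDef) (α β : ℝ) :
    matPow A α * matPow A β = matPow A (α + β) := by
  rw [matPow, matPow, matPow, ← cfc_mul _ _ _ (A.finite_real_spectrum.continuousOn _)
    (A.finite_real_spectrum.continuousOn _)]
  exact cfc_congr fun t ht => (Real.rpow_add (hA.pos_of_mem_spectrum ht) α β).symm

lemma matPow_zero (hA : A.PosDef) : matPow A 0 = 1 := by
  simp only [matPow, Real.rpow_zero]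
  exact cfc_const_one ℝ A hA.isHermitian.isSelfAdjoint

lemma matPow_mul_matPow_neg (hA : A.PosDef) (α : ℝ) : matPow A α * matPow A (-α) = 1 := by
  rw [hA.matPow_mul_matPow, add_neg_cancel, hA.matPow_zero]

lemma matPow_matPow (hA : A.PosDef) (α β : ℝ) : matPow (matPow A α) β = matPow A (α * β) := by
  rw [matPow, matPow, matPow, ← cfc_comp' _ _ _ ((A.finite_real_spectrum.image _).continuousOn _)
    (A.finite_real_spectrum.continuousOn _) hA.isHermitian.isSelfAdjoint]
  exact cfc_congr fun t ht => (Real.rpow_mul (hA.pos_of_mem_spectrum ht).le α β).symm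

end Matrix.PosDef

lemma isSelfAdjoint_matPow {n : ℕ} (A : Matrix (Fin n) (Fin n) ℝ) (α : ℝ) :
    IsSelfAdjoint (matPow A α) :=
  cfc_predicate _ A

lemma matPow_apply_comm {n : ℕ} (A : Matrix (Fin n) (Fin n) ℝ) (α : ℝ) (i j : Fin n) :
    matPow A α i j = matPow A α j i := by
  have := congrFun (congrFun (isSelfAdjoint_matPow A α).star_eq j) i
  simpa [Matrix.star_apply] using this

lemma Matrix.IsHermitian.tendsto_cfc_apply {n : ℕ} {A : Matrix (Fin n) (Fin n) ℝ}
    (hA : A.IsHermitian) {f : ℕ → ℝ → ℝ} {g : ℝ → ℝ}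
    (h : ∀ k, Tendsto (fun N => f N (hA.eigenvalues k)) atTop (𝓝 (g (hA.eigenvalues k))))
    (i j : Fin n) : Tendsto (fun N => cfc (f N) A i j) atTop (𝓝 (cfc g A i j)) := by
  simp only [hA.cfc_eq, Matrix.IsHermitian.cfc, Unitary.conjStarAlgAut_apply, Matrix.mul_apply,
    Matrix.diagonal_apply, Function.comp_apply]
  refine tendsto_finsetSum _ fun k _ => Tendsto.mul_const _ (tendsto_finsetSum _ fun l _ =>
    Tendsto.const_mul _ ?_)
  split_ifs
  · simpa using h _
  · exact tendsto_const_nhds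

/-- Polynomials which converge to `t ^ α` for every `t > 0`. -/
lemma exists_polynomial_tendsto_rpow (α : ℝ) :
    ∃ p : ℕ → Polynomial ℝ, ∀ t : ℝ, 0 < t →
      Tendsto (fun N => (p N).eval t) atTop (𝓝 (t ^ α)) := by
  have h : ∀ N : ℕ, ∃ p : Polynomial ℝ, ∀ t ∈ Set.Icc (1 / (N + 1 : ℝ)) (N + 1),
      |p.eval t - t ^ α| < 1 / (N + 1 : ℝ) := fun N => by
    refine exists_polynomial_near_of_continuousOn _ _ _ (fun t ht => ?_) _ (by positivity)
    have ht0 : 0 < t := lt_of_lt_of_le (by positivity) ht.1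
    exact (Real.continuousAt_rpow_const _ _ (Or.inl ht0.ne')).continuousWithinAt
  choose p hp using h
  refine ⟨p, fun t ht => ?_⟩
  have h0 : Tendsto (fun N : ℕ => 1 / (N + 1 : ℝ)) atTop (𝓝 0) :=
    tendsto_one_div_add_atTop_nhds_zero_nat
  rw [tendsto_iff_norm_sub_tendsto_zero]
  refine squeeze_zero' (Eventually.of_forall fun _ => norm_nonneg _) ?_ h0
  have h1 := h0.eventually (gt_mem_nhds ht)
  have h2 := (tendsto_natCast_atTop_atTop (R := ℝ)).eventually (eventually_ge_atTop t)
  filter_upwards [h1, h2] with N h1 h2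
  exact (hp N t ⟨h1.le, by linarith⟩).le

/-- The operator on `ℝ^n` of the matrix `W ^ α`. -/
def powCLM {n : ℕ} (A : Matrix (Fin n) (Fin n) ℝ) (α : ℝ) :
    EuclideanSpace ℝ (Fin n) →L[ℝ] EuclideanSpace ℝ (Fin n) :=
  Matrix.toEuclideanCLM (n := Fin n) (𝕜 := ℝ) (matPow A α)

lemma opNorm_matPow_mul {n : ℕ} (A B : Matrix (Fin n) (Fin n) ℝ) (α β : ℝ) :
    opNorm (matPow A α * matPow B β) = ‖powCLM A α * powCLM B β‖ₑ := by
  rw [opNorm, powCLM, powCLM, map_mul]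

lemma isSelfAdjoint_powCLM {n : ℕ} (A : Matrix (Fin n) (Fin n) ℝ) (α : ℝ) :
    IsSelfAdjoint (powCLM A α) := by
  rw [isSelfAdjoint_iff, powCLM, ← map_star, (isSelfAdjoint_matPow A α).star_eq]

namespace IsMatrixWeight

variable {d n : ℕ} {W : EuclideanSpace ℝ (Fin d) → Matrix (Fin n) (Fin n) ℝ}

/-- W^α is the almost everywhere limit of polynomials in W, whose entries are measurable. The
polynomials do not depend on x, since they converge to t^α at every t > 0 and so at all eigenvalues.
-/
lemma aestronglyMeasurable_matPow (hW : IsMatrixWeight W) (α : ℝ) (i j : Fin n) :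
    AEStronglyMeasurable (fun x => matPow (W x) α i j) volume := by
  obtain ⟨p, hp⟩ := exists_polynomial_tendsto_rpow α
  refine aestronglyMeasurable_of_tendsto_ae atTop
    (f := fun N x => (Polynomial.aeval (W x) (p N)) i j) (fun N => ?_) ?_
  · have hc : Continuous fun A : Fin n → Fin n → ℝ =>
        (Polynomial.aeval (Matrix.of A) (p N)) i j := by
      have h1 : Continuous fun A : Matrix (Fin n) (Fin n) ℝ => Polynomial.aeval A (p N) :=
        (p N).continuous_aeval
      exact (h1.comp (continuous_id (X := Fin n → Fin n → ℝ))).matrix_elem i j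
    have hWm : AEMeasurable (fun x => (fun i j => W x i j : Fin n → Fin n → ℝ)) :=
      aemeasurable_pi_lambda _ fun i => aemeasurable_pi_lambda _ fun j =>
        (hW.locallyIntegrable i j).aestronglyMeasurable.aemeasurable
    exact (hc.measurable.comp_aemeasurable hWm).aestronglyMeasurable
  · filter_upwards [hW.posDef] with x hx
    have h1 := hx.isHermitian.tendsto_cfc_apply (f := fun N => (p N).eval) (g := fun t => t ^ α)
      (fun k => hp _ (hx.eigenvalues_pos k)) i j
    simpa only [matPow, cfc_polynomial _ _ hx.isHermitian.isSelfAdjoint] using h1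

lemma aestronglyMeasurable_powCLM (hW : IsMatrixWeight W) (α : ℝ) :
    AEStronglyMeasurable (fun x => powCLM (W x) α) volume := by
  have h : (fun x => powCLM (W x) α) = fun x => ∑ i, ∑ j, matPow (W x) α i j •
      Matrix.toEuclideanCLM (n := Fin n) (𝕜 := ℝ) (Matrix.single i j 1) := by
    ext1 x
    rw [powCLM]
    conv_lhs => rw [Matrix.matrix_eq_sum_single (matPow (W x) α)]
    simp only [map_sum, ← map_smul, Matrix.smul_single, smul_eq_mul, mul_one]
  rw [h]
  exact Finset.aestronglyMeasurable_fun_sum _ fun i _ =>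
    Finset.aestronglyMeasurable_fun_sum _ fun j _ =>
      (hW.aestronglyMeasurable_matPow α i j).smul_const _

lemma isWeightPair (hW : IsMatrixWeight W) {r : ℝ} (hA : matrixAr r W < ∞) :
    IsWeightPair r (matrixAr r W).toReal (fun x => powCLM (W x) (1 / r))
      (fun x => powCLM (W x) (-(1 / r))) where
  meas_left := hW.aestronglyMeasurable_powCLM _
  meas_right := hW.aestronglyMeasurable_powCLM _
  mul_eq_one := by
    filter_upwards [hW.posDef] with x hx
    rw [powCLM, powCLM, ← map_mul, hx.matPow_mul_matPow_neg, map_one]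
  selfAdjoint_left := ae_of_all _ fun x => isSelfAdjoint_powCLM _ _
  selfAdjoint_right := ae_of_all _ fun x => isSelfAdjoint_powCLM _ _
  le Q := by
    rw [ENNReal.ofReal_toReal hA.ne]
    simp only [← opNorm_matPow_mul]
    exact le_iSup (fun Q : Cube d => ⨍⁻ x in Q.toSet,
      (⨍⁻ y in Q.toSet,
      opNorm (matPow (W x) (1 / r) * matPow (W y) (-(1 / r))) ^ (Real.conjExponent r) ∂volume)
      ^ (r / Real.conjExponent r) ∂volume) Q

/-- The bilinear sparse estimate for a matrix weight. -/
theorem tsum_lintegral_le (hn : 1 ≤ n) (hW : IsMatrixWeight W) {r : ℝ} (hr : 1 < r)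
    (hA : matrixAr r W < ∞) {γ : ℝ} (hγ : 0 < γ) {D S : Set (Cube d)} (hD : IsDyadicLattice D)
    (hSD : S ⊆ D) (hS : IsSparse γ S) {f g : EuclideanSpace ℝ (Fin d) → ℝ≥0∞}
    (hf : AEMeasurable f) (hg : AEMeasurable g) :
    ∑' Q : S, ∫⁻ y in (Q : Cube d).toSet,
      (⨍⁻ x in (Q : Cube d).toSet,
        opNorm (matPow (W x) (-(1 / r)) * matPow (W y) (1 / r)) * f x ∂volume) * g y ≤
      sparseConst d n r γ * matrixAr r W ^ (1 + 1 / (r - 1) - 1 / r) *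
        (∫⁻ x, f x ^ r) ^ (1 / r) *
        (∫⁻ x, g x ^ Real.conjExponent r) ^ (1 / Real.conjExponent r) := by
  have : NeZero n := ⟨by omega⟩
  have h := hW.isWeightPair hA
  have h1 := h.tsum_lintegral_le hr (h.one_le hr) hγ hS (hD.isNested.mono hSD) hf hg
  rw [ENNReal.ofReal_toReal hA.ne] at h1
  simpa only [opNorm_matPow_mul] using h1

end IsMatrixWeight

/-! ### The sparse operator -/

/-- Write I = I^{1/p} I^{1/q} and cancel I^{1/q}. Finiteness of I is essential, which is why this is
used with truncated functions. -/
lemma ENNReal.rpow_le_of_le_mul_rpow {p q : ℝ} (hpq : p.HolderConjugate q) {I K : ℝ≥0∞}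
    (hI : I ≠ ∞) (h : I ≤ K * I ^ (1 / q)) : I ^ (1 / p) ≤ K := by
  rcases eq_or_ne I 0 with rfl | h0
  · rw [ENNReal.zero_rpow_of_pos (by have := hpq.pos; positivity)]
    exact bot_le
  · have h1 : I ^ (1 / p) * I ^ (1 / q) ≤ K * I ^ (1 / q) := by
      rw [← ENNReal.rpow_add _ _ h0 hI]
      have : 1 / p + 1 / q = 1 := by simpa using hpq.inv_add_inv_eq_one
      rwa [this, ENNReal.rpow_one]
    refine (ENNReal.mul_le_mul_iff_left ?_ ?_).1 h1
    · simp [h0, hI]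
    · exact ENNReal.rpow_ne_top_of_nonneg (by have := hpq.symm.pos; positivity) hI

/-- The converse of Hölder's inequality for nonnegative functions. -/
lemma lintegral_rpow_le_of_forall_lintegral_mul_le {d : ℕ}
    {F : EuclideanSpace ℝ (Fin d) → ℝ≥0∞} (hF : AEMeasurable F) {p q : ℝ}
    (hpq : p.HolderConjugate q) {K : ℝ≥0∞}
    (h : ∀ g : EuclideanSpace ℝ (Fin d) → ℝ≥0∞, AEMeasurable g →
      ∫⁻ x, F x * g x ≤ K * (∫⁻ x, g x ^ q) ^ (1 / q)) :
    (∫⁻ x, F x ^ p) ^ (1 / p) ≤ K := by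
  have hp := hpq.pos
  have hp1 : 0 < p - 1 := hpq.sub_one_pos
  -- Truncation in space and in height makes the p-th power integrable. The test function is the
  -- truncation to the power p - 1, and monotone convergence removes the truncation.
  set FN : ℕ → EuclideanSpace ℝ (Fin d) → ℝ≥0∞ := fun N =>
    (Metric.closedBall 0 N).indicator fun x => min (F x) N with hFN
  have hFNm : ∀ N, AEMeasurable (FN N) := fun N =>
    (hF.min aemeasurable_const).indicator Metric.isClosed_closedBall.measurableSet
  have hFNle : ∀ N x, FN N x ≤ F x := fun N x => by
    by_cases hx : x ∈ Metric.closedBall (0 : EuclideanSpace ℝ (Fin d)) N <;> simp [hFN, hx]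
  have hbound : ∀ N, (∫⁻ x, FN N x ^ p) ^ (1 / p) ≤ K := by
    intro N
    refine ENNReal.rpow_le_of_le_mul_rpow hpq ?_ ?_
    · have h1 : ∫⁻ x, FN N x ^ p ≤
          ∫⁻ _ in Metric.closedBall (0 : EuclideanSpace ℝ (Fin d)) N, (N : ℝ≥0∞) ^ p := by
        rw [← lintegral_indicator Metric.isClosed_closedBall.measurableSet]
        refine lintegral_mono fun x => ?_
        by_cases hx : x ∈ Metric.closedBall (0 : EuclideanSpace ℝ (Fin d)) N
        · simp only [hFN, Set.indicator_of_mem hx]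
          gcongr
          exact min_le_right _ _
        · simp [hFN, Set.indicator_of_notMem hx, hp]
      refine ne_top_of_le_ne_top ?_ h1
      rw [setLIntegral_const]
      exact ENNReal.mul_ne_top (ENNReal.rpow_ne_top_of_nonneg hp.le (by simp))
        measure_closedBall_lt_top.ne
    · have h1 := h (fun x => FN N x ^ (p - 1)) ((hFNm N).pow_const _)
      have h2 : ∀ x, (FN N x ^ (p - 1)) ^ q = FN N x ^ p := fun x => by
        rw [← ENNReal.rpow_mul, hpq.sub_one_mul_conj]
      simp only [h2] at h1
      refine le_trans (lintegral_mono fun x => ?_) h1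
      calc FN N x ^ p = FN N x ^ (1 : ℝ) * FN N x ^ (p - 1) := by
            rw [← ENNReal.rpow_add_of_nonneg _ _ zero_le_one hp1.le]
            ring_nf
        _ ≤ F x * FN N x ^ (p - 1) := by
            rw [ENNReal.rpow_one]
            gcongr
            exact hFNle N x
  have hlim : Tendsto (fun N => ∫⁻ x, FN N x ^ p) atTop (𝓝 (∫⁻ x, F x ^ p)) := by
    refine lintegral_tendsto_of_tendsto_of_monotone (fun N => (hFNm N).pow_const _)
      (ae_of_all _ fun x N M hNM => ?_) (ae_of_all _ fun x => ?_)
    · dsimp only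
      gcongr
      simp only [hFN]
      by_cases hx : x ∈ Metric.closedBall (0 : EuclideanSpace ℝ (Fin d)) N
      · have hx' : x ∈ Metric.closedBall (0 : EuclideanSpace ℝ (Fin d)) M :=
          Metric.closedBall_subset_closedBall (by exact_mod_cast hNM) hx
        rw [Set.indicator_of_mem hx, Set.indicator_of_mem hx']
        gcongr
      · rw [Set.indicator_of_notMem hx]
        exact bot_le
    · refine (ENNReal.continuous_rpow_const.tendsto _).comp ?_
      have h1 : Tendsto (fun N : ℕ => min (F x) (N : ℝ≥0∞)) atTop (𝓝 (min (F x) ∞)) :=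
        tendsto_const_nhds.min ENNReal.tendsto_nat_nhds_top
      rw [min_eq_left le_top] at h1
      refine h1.congr' ?_
      filter_upwards [(tendsto_natCast_atTop_atTop (R := ℝ)).eventually
        (eventually_ge_atTop (dist x 0))] with N hN
      simp only [hFN]
      rw [Set.indicator_of_mem (Metric.mem_closedBall.2 hN)]
  exact le_of_tendsto ((ENNReal.continuous_rpow_const.tendsto _).comp hlim)
    (Eventually.of_forall hbound)

namespace IsMatrixWeight

variable {d n : ℕ} {W : EuclideanSpace ℝ (Fin d) → Matrix (Fin n) (Fin n) ℝ}

lemma aemeasurable_lintegral_opNorm (hW : IsMatrixWeight W) (α β : ℝ) (Q : Cube d)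
    {f : EuclideanSpace ℝ (Fin d) → ℝ≥0∞} (hf : AEMeasurable f) :
    AEMeasurable fun y => ⨍⁻ x in Q.toSet, opNorm (matPow (W x) α * matPow (W y) β) * f x
      ∂volume := by
  simp only [opNorm_matPow_mul, Q.laverage_eq]
  refine AEMeasurable.const_mul ?_ _
  have h1 : AEStronglyMeasurable (fun z : EuclideanSpace ℝ (Fin d) × EuclideanSpace ℝ (Fin d) =>
      powCLM (W z.2) α * powCLM (W z.1) β)
      ((volume : Measure (EuclideanSpace ℝ (Fin d))).prod (volume.restrict Q.toSet)) :=
    (hW.aestronglyMeasurable_powCLM α).restrict.comp_snd.mul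
      (hW.aestronglyMeasurable_powCLM β).comp_fst
  have h2 : AEMeasurable (fun z : EuclideanSpace ℝ (Fin d) × EuclideanSpace ℝ (Fin d) => f z.2)
      ((volume : Measure (EuclideanSpace ℝ (Fin d))).prod (volume.restrict Q.toSet)) :=
    hf.restrict.comp_snd
  exact (h1.enorm.mul h2).lintegral_prod_right'

lemma aemeasurable_sparseOp (hW : IsMatrixWeight W) (r : ℝ) {S : Set (Cube d)} (hS : S.Countable)
    {f : EuclideanSpace ℝ (Fin d) → ℝ} (hf : AEStronglyMeasurable f volume) :
    AEMeasurable (sparseOp r W S f) := by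
  have := hS.to_subtype
  exact AEMeasurable.tsum fun Q =>
    (hW.aemeasurable_lintegral_opNorm _ _ Q hf.enorm).indicator (Cube.measurableSet_toSet _)

/-- The matrix-weighted sparse operator is bounded on `L^r`. -/
theorem eLpNorm_sparseOp_le (hn : 1 ≤ n) (hW : IsMatrixWeight W) {r : ℝ} (hr : 1 < r)
    (hA : matrixAr r W < ∞) {γ : ℝ} (hγ : 0 < γ) {D S : Set (Cube d)} (hD : IsDyadicLattice D)
    (hSD : S ⊆ D) (hS : IsSparse γ S) {f : EuclideanSpace ℝ (Fin d) → ℝ}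
    (hf : AEStronglyMeasurable f volume) :
    eLpNorm (sparseOp r W S f) (ENNReal.ofReal r) volume ≤
      sparseConst d n r γ * matrixAr r W ^ (1 + 1 / (r - 1) - 1 / r) *
        eLpNorm f (ENNReal.ofReal r) volume := by
  have hr0 : 0 < r := by linarith
  have hSc := hS.countable hγ
  have := hSc.to_subtype
  have he : ∀ {F : Type} [TopologicalSpace F] [ContinuousENorm F]
      (g : EuclideanSpace ℝ (Fin d) → F),
      eLpNorm g (ENNReal.ofReal r) volume = (∫⁻ x, ‖g x‖ₑ ^ r) ^ (1 / r) := fun g => by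
    rw [eLpNorm_eq_lintegral_rpow_enorm_toReal (by simpa using hr0) ENNReal.ofReal_ne_top,
      ENNReal.toReal_ofReal hr0.le]
  rw [he, he]
  simp only [enorm_eq_self]
  refine lintegral_rpow_le_of_forall_lintegral_mul_le (hW.aemeasurable_sparseOp r hSc hf)
    (Real.HolderConjugate.conjExponent hr) fun g hg => ?_
  refine le_trans (le_of_eq ?_) (hW.tsum_lintegral_le hn hr hA hγ hD hSD hS hf.enorm hg)
  have hm : ∀ Q : S, AEMeasurable fun y => (Q : Cube d).toSet.indicator (fun y =>
      ⨍⁻ x in (Q : Cube d).toSet,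
        opNorm (matPow (W x) (-(1 / r)) * matPow (W y) (1 / r)) * ‖f x‖ₑ ∂volume) y * g y :=
    fun Q => ((hW.aemeasurable_lintegral_opNorm _ _ Q hf.enorm).indicator
      (Cube.measurableSet_toSet _)).mul hg
  simp only [sparseOp, ← ENNReal.tsum_mul_right]
  rw [lintegral_tsum hm]
  refine tsum_congr fun Q => ?_
  rw [← lintegral_indicator (Cube.measurableSet_toSet _)]
  refine lintegral_congr fun y => ?_
  by_cases hy : y ∈ (Q : Cube d).toSet <;> simp [hy]

end IsMatrixWeight

/-! ### Convex bodies -/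

lemma enorm_apply_le_opNorm {n : ℕ} (A : Matrix (Fin n) (Fin n) ℝ) (i j : Fin n) :
    ‖A i j‖ₑ ≤ opNorm A := by
  have h1 : (Matrix.toEuclideanCLM (n := Fin n) (𝕜 := ℝ) A (EuclideanSpace.single j 1)) i = A i j := by
    rw [Matrix.ofLp_toEuclideanCLM]
    simp
  rw [← h1, opNorm]
  refine (PiLp.enorm_apply_le _ i).trans ((ContinuousLinearMap.le_opENorm _ _).trans ?_)
  have h2 : ‖(EuclideanSpace.single j (1 : ℝ) : EuclideanSpace ℝ (Fin n))‖ₑ = 1 := by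
    rw [← ofReal_norm]
    simp
  rw [h2, mul_one]

lemma enorm_sum_smul_le {ι : Type*} (s : Finset ι) {B : Type*} [NormedAddCommGroup B]
    [NormedSpace ℝ B] (a : ι → ℝ) (b : ι → B) :
    ‖∑ i ∈ s, a i • b i‖ₑ ≤ ∑ i ∈ s, ‖a i‖ₑ * ‖b i‖ₑ := by
  refine (enorm_sum_le _ _).trans (Finset.sum_le_sum fun i _ => ?_)
  rw [enorm_smul]

lemma enorm_dual_apply_le {X : Type*} [NormedAddCommGroup X] [NormedSpace ℝ X]
    {φ : StrongDual ℝ X} (hφ : ‖φ‖ ≤ 1) (x : X) : ‖φ x‖ₑ ≤ ‖x‖ₑ := by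
  rw [← ofReal_norm, ← ofReal_norm]
  exact ENNReal.ofReal_le_ofReal ((φ.le_of_opNorm_le hφ x).trans (one_mul _).le)

/-- Integrability is only assumed on cubes of D; countably many of them cover the space, because
every ball lies in one. -/
lemma IsDyadicLattice.aestronglyMeasurable {d : ℕ} {B : Type*} [NormedAddCommGroup B]
    {D : Set (Cube d)} (hD : IsDyadicLattice D)
    {f : EuclideanSpace ℝ (Fin d) → B} (hf : ∀ Q ∈ D, MemLp f 1 Q.avgMeasure) :
    AEStronglyMeasurable f volume := by
  choose Q hQD hQ using fun N : ℕ => hD.compact_subset (Metric.closedBall 0 N)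
    (isCompact_closedBall _ _)
  have hU : ⋃ N, (Q N).toSet = Set.univ := by
    refine Set.eq_univ_of_forall fun x => Set.mem_iUnion.2 ?_
    obtain ⟨N, hN⟩ := exists_nat_ge (dist x 0)
    exact ⟨N, hQ N (Metric.mem_closedBall.2 hN)⟩
  rw [← Measure.restrict_univ (μ := volume), ← hU, aestronglyMeasurable_iUnion_iff]
  intro N
  refine (hf _ (hQD N)).1.mono_ac ?_
  rw [Cube.avgMeasure]
  exact Measure.absolutelyContinuous_smul (ENNReal.inv_ne_zero.2 (Q N).volume_toSet_ne_top)

lemma aestronglyMeasurable_toLp {n : ℕ} {B : Type*} [NormedAddCommGroup B]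
    {α : Type*} [MeasurableSpace α] {μ : Measure α} {f : Fin n → α → B} (hf : ∀ i, AEStronglyMeasurable (f i) μ) :
    AEStronglyMeasurable (fun x => (WithLp.toLp 2 fun i => f i x : PiLp 2 fun _ : Fin n => B)) μ := by
  have h1 : (fun x => (WithLp.toLp 2 fun i => f i x : PiLp 2 fun _ : Fin n => B)) =
      fun x => ∑ i, WithLp.toLp 2 (Pi.single i (f i x)) := by
    ext1 x
    rw [← WithLp.toLp_sum, Finset.univ_sum_single]
  rw [h1]
  refine Finset.aestronglyMeasurable_fun_sum _ fun i _ => ?_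
  have hc : Continuous fun b : B => (WithLp.toLp 2 (Pi.single i b) : PiLp 2 fun _ : Fin n => B) :=
    (PiLp.continuous_toLp 2 _).comp (@continuous_single (Fin n) (fun _ => B) _ _ _ i)
  exact hc.comp_aestronglyMeasurable (hf i)

section

variable {d n : ℕ} {B : Type*} [NormedAddCommGroup B] [NormedSpace ℝ B]

lemma sum_smul_toL1Avg_ae_eq {Q : Cube d} {f : Fin n → EuclideanSpace ℝ (Fin d) → B}
    (hf : ∀ i, MemLp (f i) 1 Q.avgMeasure) (a : Fin n → ℝ) (s : Finset (Fin n)) :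
    (∑ i ∈ s, a i • toL1Avg Q (f i) : Lp B 1 Q.avgMeasure) =ᵐ[Q.avgMeasure]
      fun x => ∑ i ∈ s, a i • f i x := by
  induction s using Finset.cons_induction with
  | empty => simpa using! Lp.coeFn_zero B 1 Q.avgMeasure
  | cons j s hj ih =>
    rw [Finset.sum_cons]
    filter_upwards [Lp.coeFn_add (a j • toL1Avg Q (f j)) (∑ i ∈ s, a i • toL1Avg Q (f i)), ih,
      Lp.coeFn_smul (a j) (toL1Avg Q (f j)), (hf j).coeFn_toLp] with x h1 h2 h3 h4
    have h5 : toL1Avg Q (f j) = (hf j).toLp (f j) := by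
      simp [toL1Avg, hf j]
    rw [h1, Pi.add_apply, h2, h3, Pi.smul_apply, h5, h4, Finset.sum_cons]

/-- By linearity the functional acts on the single element Σ a_i f_i of L^1(Q). In this way the
functionals defining the convex bodies are replaced by averages. -/
lemma enorm_sum_dual_toL1Avg_le {Q : Cube d} {f : Fin n → EuclideanSpace ℝ (Fin d) → B}
    (hf : ∀ i, MemLp (f i) 1 Q.avgMeasure) (a : Fin n → ℝ)
    {φ : StrongDual ℝ (Lp B 1 Q.avgMeasure)} (hφ : ‖φ‖ ≤ 1) :
    ‖∑ i, a i * φ (toL1Avg Q (f i))‖ₑ ≤ ⨍⁻ x in Q.toSet, ‖∑ i, a i • f i x‖ₑ ∂volume := by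
  have h1 : ∑ i, a i * φ (toL1Avg Q (f i)) = φ (∑ i, a i • toL1Avg Q (f i)) := by
    simp only [map_sum, map_smul, smul_eq_mul]
  rw [h1]
  refine (enorm_dual_apply_le hφ _).trans (le_of_eq ?_)
  rw [Lp.enorm_def, eLpNorm_congr_ae (sum_smul_toL1Avg_ae_eq hf a _),
    eLpNorm_one_eq_lintegral_enorm, Q.lintegral_avgMeasure]

/-- The vector valued function `W ^ α f`. -/
def matPowSMul (W : EuclideanSpace ℝ (Fin d) → Matrix (Fin n) (Fin n) ℝ) (α : ℝ)
    (f : Fin n → EuclideanSpace ℝ (Fin d) → B) (x : EuclideanSpace ℝ (Fin d)) :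
    PiLp 2 fun _ : Fin n => B :=
  WithLp.toLp 2 fun i => ∑ j, matPow (W x) α i j • f j x

lemma Matrix.PosDef.sum_matPow_smul {A : Matrix (Fin n) (Fin n) ℝ} (hA : A.PosDef) (α : ℝ)
    (v : Fin n → B) (i : Fin n) :
    ∑ k, matPow A (-α) i k • ∑ j, matPow A α k j • v j = v i := by
  simp only [Finset.smul_sum, smul_smul]
  rw [Finset.sum_comm]
  simp only [← Finset.sum_smul, ← Matrix.mul_apply]
  have h1 := hA.matPow_mul_matPow_neg (-α)
  rw [neg_neg] at h1
  rw [h1]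
  simp [Matrix.one_apply, ite_smul]

lemma Matrix.PosDef.eq_sum_matPowSMul {W : EuclideanSpace ℝ (Fin d) → Matrix (Fin n) (Fin n) ℝ}
    {x : EuclideanSpace ℝ (Fin d)} (hx : (W x).PosDef) (α : ℝ)
    (f : Fin n → EuclideanSpace ℝ (Fin d) → B) (i : Fin n) :
    f i x = ∑ k, matPow (W x) (-α) i k • matPowSMul W α f x k :=
  (hx.sum_matPow_smul α (fun j => f j x) i).symm

lemma IsMatrixWeight.aestronglyMeasurable_matPowSMul
    {W : EuclideanSpace ℝ (Fin d) → Matrix (Fin n) (Fin n) ℝ} (hW : IsMatrixWeight W) (α : ℝ)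
    {f : Fin n → EuclideanSpace ℝ (Fin d) → B} (hf : ∀ i, AEStronglyMeasurable (f i) volume) :
    AEStronglyMeasurable (matPowSMul W α f) volume :=
  aestronglyMeasurable_toLp fun i => Finset.aestronglyMeasurable_fun_sum _ fun j _ =>
    (hW.aestronglyMeasurable_matPow α i j).smul (hf j)

lemma weightedNorm_eq {r : ℝ} (hr : 0 < r)
    (W : EuclideanSpace ℝ (Fin d) → Matrix (Fin n) (Fin n) ℝ)
    (f : Fin n → EuclideanSpace ℝ (Fin d) → B) :
    weightedNorm r W f = (∫⁻ x, ‖matPowSMul W (1 / r) f x‖ₑ ^ r) ^ (1 / r) := by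
  rw [weightedNorm, eLpNorm_eq_lintegral_rpow_enorm_toReal (by simpa using hr)
    ENNReal.ofReal_ne_top, ENNReal.toReal_ofReal hr.le]
  rfl

/-- The power 1/r' of the dual weight W^{-r'/r} is W^{-1/r}, almost everywhere where W is positive
definite. -/
lemma weightedNorm_dual_eq {r : ℝ} (hr : 1 < r)
    {W : EuclideanSpace ℝ (Fin d) → Matrix (Fin n) (Fin n) ℝ} (hW : IsMatrixWeight W)
    (g : Fin n → EuclideanSpace ℝ (Fin d) → B) :
    weightedNorm (Real.conjExponent r) (fun x => matPow (W x) (-(Real.conjExponent r / r))) g =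
      (∫⁻ x, ‖matPowSMul W (-(1 / r)) g x‖ₑ ^ Real.conjExponent r) ^ (1 / Real.conjExponent r) := by
  have hr' : 0 < Real.conjExponent r := (Real.HolderConjugate.conjExponent hr).symm.pos
  rw [weightedNorm_eq hr']
  congr 1
  refine lintegral_congr_ae ?_
  filter_upwards [hW.posDef] with x hx
  have h1 : matPow (matPow (W x) (-(Real.conjExponent r / r))) (1 / Real.conjExponent r) =
      matPow (W x) (-(1 / r)) := by
    rw [hx.matPow_matPow]
    congr 1
    field_simp
  simp only [matPowSMul, h1]

/-- The product of two convex bodies is dominated by a double average. -/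
lemma ofReal_convexBodyProd_le {B' : Type*} [NormedAddCommGroup B'] [NormedSpace ℝ B']
    {W : EuclideanSpace ℝ (Fin d) → Matrix (Fin n) (Fin n) ℝ} (hW : IsMatrixWeight W) (α : ℝ)
    {Q : Cube d} {f : Fin n → EuclideanSpace ℝ (Fin d) → B}
    {g : Fin n → EuclideanSpace ℝ (Fin d) → B'}
    (hf : ∀ i, MemLp (f i) 1 Q.avgMeasure) (hg : ∀ i, MemLp (g i) 1 Q.avgMeasure) :
    ENNReal.ofReal (convexBodyProd Q f g) ≤ (n : ℝ≥0∞) ^ 2 *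
      ⨍⁻ y in Q.toSet, (⨍⁻ x in Q.toSet, opNorm (matPow (W x) (-α) * matPow (W y) α) *
        ‖matPowSMul W α f x‖ₑ ∂volume) * ‖matPowSMul W (-α) g y‖ₑ ∂volume := by
  set R := (n : ℝ≥0∞) ^ 2 *
      ⨍⁻ y in Q.toSet, (⨍⁻ x in Q.toSet, opNorm (matPow (W x) (-α) * matPow (W y) α) *
        ‖matPowSMul W α f x‖ₑ ∂volume) * ‖matPowSMul W (-α) g y‖ₑ ∂volume with hR
  rcases eq_or_ne R ∞ with hRt | hRt
  · rw [hRt]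
    exact le_top
  refine ENNReal.ofReal_le_of_le_toReal (Real.sSup_le ?_ ENNReal.toReal_nonneg)
  rintro c ⟨a, ⟨φ, hφ, rfl⟩, b, ⟨ψ, hψ, rfl⟩, rfl⟩
  refine (ENNReal.ofReal_le_iff_le_toReal hRt).1 ?_
  calc ENNReal.ofReal (∑ i, φ (toL1Avg Q (f i)) * ψ (toL1Avg Q (g i)))
      ≤ ‖∑ i, φ (toL1Avg Q (f i)) * ψ (toL1Avg Q (g i))‖ₑ := by
        rw [← ofReal_norm]
        exact ENNReal.ofReal_le_ofReal (le_abs_self _)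
    -- The functional ψ is removed first, with the numbers φ(f_i) as coefficients. After W(y)^α
    -- W(y)^{-α} = 1 has been inserted, φ acts on the combinations Σ_i W(y)^α_{ik} f_i and is
    -- removed in the same way. The two sums over entries cost n each.
    _ ≤ ⨍⁻ y in Q.toSet, ‖∑ i, φ (toL1Avg Q (f i)) • g i y‖ₑ ∂volume :=
        enorm_sum_dual_toL1Avg_le hg _ hψ
    _ ≤ ⨍⁻ y in Q.toSet, (n : ℝ≥0∞) ^ 2 * ((⨍⁻ x in Q.toSet,
          opNorm (matPow (W x) (-α) * matPow (W y) α) * ‖matPowSMul W α f x‖ₑ ∂volume) *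
          ‖matPowSMul W (-α) g y‖ₑ) ∂volume := by
        refine laverage_mono_ae Q ?_
        filter_upwards [hW.posDef] with y hy
        have hk : ∀ k, ‖∑ i, matPow (W y) α i k * φ (toL1Avg Q (f i))‖ₑ ≤
            n * ⨍⁻ x in Q.toSet, opNorm (matPow (W x) (-α) * matPow (W y) α) *
              ‖matPowSMul W α f x‖ₑ ∂volume := by
          intro k
          refine (enorm_sum_dual_toL1Avg_le hf _ hφ).trans ?_
          calc ⨍⁻ x in Q.toSet, ‖∑ i, matPow (W y) α i k • f i x‖ₑ ∂volume
              ≤ ⨍⁻ x in Q.toSet, n * (opNorm (matPow (W x) (-α) * matPow (W y) α) *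
                  ‖matPowSMul W α f x‖ₑ) ∂volume := by
                refine laverage_mono_ae Q ?_
                filter_upwards [hW.posDef] with x hx
                have h1 : ∑ i, matPow (W y) α i k • f i x =
                    ∑ l, (matPow (W x) (-α) * matPow (W y) α) l k • matPowSMul W α f x l := by
                  simp only [Matrix.mul_apply, Finset.sum_smul]
                  rw [Finset.sum_comm]
                  refine Finset.sum_congr rfl fun i _ => ?_
                  rw [hx.eq_sum_matPowSMul α f i, Finset.smul_sum]
                  refine Finset.sum_congr rfl fun l _ => ?_
                  rw [smul_smul, matPow_apply_comm (W x) (-α) l i, mul_comm]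
                rw [h1]
                calc _ ≤ ∑ l, ‖(matPow (W x) (-α) * matPow (W y) α) l k‖ₑ *
                      ‖matPowSMul W α f x l‖ₑ := enorm_sum_smul_le _ _ _
                  _ ≤ ∑ _l : Fin n, opNorm (matPow (W x) (-α) * matPow (W y) α) *
                      ‖matPowSMul W α f x‖ₑ := by
                      gcongr with l
                      · exact enorm_apply_le_opNorm _ _ _
                      · exact PiLp.enorm_apply_le _ _
                  _ = _ := by simp
            _ = _ := by
                rw [Q.laverage_eq, Q.laverage_eq, lintegral_const_mul' _ _ (by simp)]
                ring
        have h2 : ∑ i, φ (toL1Avg Q (f i)) • g i y =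
            ∑ k, (∑ i, matPow (W y) α i k * φ (toL1Avg Q (f i))) • matPowSMul W (-α) g y k := by
          simp only [Finset.sum_smul]
          rw [Finset.sum_comm]
          refine Finset.sum_congr rfl fun i _ => ?_
          have h3 := hy.eq_sum_matPowSMul (-α) g i
          rw [neg_neg] at h3
          rw [h3, Finset.smul_sum]
          exact Finset.sum_congr rfl fun k _ => by rw [smul_smul, mul_comm]
        rw [h2]
        calc _ ≤ ∑ k, ‖∑ i, matPow (W y) α i k * φ (toL1Avg Q (f i))‖ₑ *
              ‖matPowSMul W (-α) g y k‖ₑ := enorm_sum_smul_le _ _ _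
          _ ≤ ∑ _k : Fin n, (n * ⨍⁻ x in Q.toSet,
                opNorm (matPow (W x) (-α) * matPow (W y) α) * ‖matPowSMul W α f x‖ₑ ∂volume) *
              ‖matPowSMul W (-α) g y‖ₑ := by
              gcongr with k
              · exact hk k
              · exact PiLp.enorm_apply_le _ _
          _ = _ := by
              simp only [Finset.sum_const, Finset.card_univ, Fintype.card_fin, nsmul_eq_mul]
              ring
    _ = R := by
        rw [hR, Q.laverage_eq, Q.laverage_eq, lintegral_const_mul' _ _ (by simp)]
        ring

end

/-- Convex body domination implies matrix-weighted bounds of the bilinear form. -/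
theorem HasConvexBodyDomination.ofReal_pairing_le {d n : ℕ} (hn : 1 ≤ n) {r : ℝ} (hr : 1 < r)
    {γ : ℝ} (hγ : 0 < γ) {D : Set (Cube d)} (hD : IsDyadicLattice D)
    {W : EuclideanSpace ℝ (Fin d) → Matrix (Fin n) (Fin n) ℝ} (hW : IsMatrixWeight W)
    (hA : matrixAr r W < ∞) {B₁ : Type u} {B₂ : Type v} [NormedAddCommGroup B₁] [NormedSpace ℝ B₁]
    [NormedAddCommGroup B₂] [NormedSpace ℝ B₂]
    {F : Submodule ℝ (EuclideanSpace ℝ (Fin d) → B₁)}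
    {G : Submodule ℝ (EuclideanSpace ℝ (Fin d) → StrongDual ℝ B₂)}
    {T : F →ₗ[ℝ] (EuclideanSpace ℝ (Fin d) →ₘ[volume] B₂)} {C₁ : ℝ≥0}
    (hT : HasConvexBodyDomination n D F G T γ C₁) (f : Fin n → F) (g : Fin n → G) :
    ENNReal.ofReal |pairing T f g| ≤
      ((n ^ 2 * sparseConst d n r γ : ℝ≥0) : ℝ≥0∞) * C₁ *
        matrixAr r W ^ (1 + 1 / (r - 1) - 1 / r) *
        weightedNorm r W (fun i => (f i : EuclideanSpace ℝ (Fin d) → B₁)) *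
        weightedNorm (Real.conjExponent r)
          (fun x => matPow (W x) (-(Real.conjExponent r / r)))
          (fun i => (g i : EuclideanSpace ℝ (Fin d) → StrongDual ℝ B₂)) := by
  obtain ⟨S, hSD, hS, hb⟩ := hT.bound f g
  refine hb.trans ?_
  rw [weightedNorm_eq (by linarith), weightedNorm_dual_eq hr hW]
  set u := fun x => ‖matPowSMul W (1 / r) (fun i => (f i : EuclideanSpace ℝ (Fin d) → B₁)) x‖ₑ
  set v := fun x => ‖matPowSMul W (-(1 / r))
    (fun i => (g i : EuclideanSpace ℝ (Fin d) → StrongDual ℝ B₂)) x‖ₑ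
  have hu : AEMeasurable u := (hW.aestronglyMeasurable_matPowSMul _ fun i =>
    hD.aestronglyMeasurable (hT.memLp_left _ (f i).2)).enorm
  have hv : AEMeasurable v := (hW.aestronglyMeasurable_matPowSMul _ fun i =>
    hD.aestronglyMeasurable (hT.memLp_right _ (g i).2)).enorm
  calc C₁ * ∑' Q : S, volume (Q : Cube d).toSet *
        ENNReal.ofReal (convexBodyProd (Q : Cube d) (fun i => (f i : EuclideanSpace ℝ (Fin d) → B₁))
          (fun i => (g i : EuclideanSpace ℝ (Fin d) → StrongDual ℝ B₂)))
      ≤ C₁ * ∑' Q : S, (n : ℝ≥0∞) ^ 2 * ∫⁻ y in (Q : Cube d).toSet,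
          (⨍⁻ x in (Q : Cube d).toSet,
            opNorm (matPow (W x) (-(1 / r)) * matPow (W y) (1 / r)) * u x ∂volume) * v y := by
        gcongr C₁ * ?_
        refine ENNReal.tsum_le_tsum fun Q => ?_
        rw [← Cube.volume_mul_laverage, mul_left_comm]
        gcongr
        exact ofReal_convexBodyProd_le hW (1 / r) (fun i => hT.memLp_left _ (f i).2 _ (hSD Q.2))
          (fun i => hT.memLp_right _ (g i).2 _ (hSD Q.2))
    _ ≤ C₁ * ((n : ℝ≥0∞) ^ 2 *
          (sparseConst d n r γ * matrixAr r W ^ (1 + 1 / (r - 1) - 1 / r) *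
            (∫⁻ x, u x ^ r) ^ (1 / r) *
            (∫⁻ x, v x ^ Real.conjExponent r) ^ (1 / Real.conjExponent r))) := by
        rw [ENNReal.tsum_mul_left]
        gcongr
        exact hW.tsum_lintegral_le hn hr hA hγ hD hSD hS hu hv
    _ = _ := by
        push_cast
        ring

/-! ### Approximation by step functions -/

namespace Cube

variable {d : ℕ}

lemma abs_setAverage_le (R : Cube d) {φ : EuclideanSpace ℝ (Fin d) → ℝ} {M : ℝ}
    (hM : ∀ x, |φ x| ≤ M) : |⨍ x in R.toSet, φ x ∂volume| ≤ M := by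
  rw [setAverage_eq, smul_eq_mul, abs_mul, abs_inv]
  have h1 : |∫ x in R.toSet, φ x| ≤ M * volume.real R.toSet := by
    rw [← Real.norm_eq_abs]
    exact norm_setIntegral_le_of_norm_le_const R.volume_toSet_ne_top.lt_top fun x _ => hM x
  have h2 : 0 < volume.real R.toSet :=
    ENNReal.toReal_pos R.volume_toSet_ne_zero R.volume_toSet_ne_top
  rw [abs_of_pos h2, inv_mul_le_iff₀ h2]
  linarith

lemma abs_dyadicStep_setAverage_le (Q : Cube d) (N : ℕ) {φ : EuclideanSpace ℝ (Fin d) → ℝ} {M : ℝ}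
    (hM : ∀ x, |φ x| ≤ M) (x : EuclideanSpace ℝ (Fin d)) :
    |dyadicStep (fun R => ⨍ y in R.toSet, φ y ∂volume) N Q x| ≤ M := by
  by_cases hx : x ∈ Q.toSet
  · obtain ⟨R, -, -, -, h⟩ := exists_dyadicStep_eq (fun R => ⨍ y in R.toSet, φ y ∂volume) N Q hx
    rw [h]
    exact R.abs_setAverage_le hM
  · rw [dyadicStep_of_notMem _ _ _ hx, abs_zero]
    exact (abs_nonneg _).trans (hM x)

lemma integrable_of_bounded (Q : Cube d) {φ : EuclideanSpace ℝ (Fin d) → ℝ} {M : ℝ}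
    (hφ : AEStronglyMeasurable φ volume) (hM : ∀ x, |φ x| ≤ M) (h0 : ∀ x ∉ Q.toSet, φ x = 0) :
    Integrable φ := by
  rw [← integrableOn_iff_integrable_of_support_subset (s := Q.toSet)
    (fun x hx => by by_contra h; exact hx (h0 x h))]
  exact Measure.integrableOn_of_bounded (M := M) Q.volume_toSet_ne_top hφ
    (ae_of_all _ fun x => hM x)

lemma ae_tendsto_dyadicStep_setAverage (Q : Cube d) {φ : EuclideanSpace ℝ (Fin d) → ℝ} {M : ℝ}
    (hφ : AEStronglyMeasurable φ volume) (hM : ∀ x, |φ x| ≤ M) (h0 : ∀ x ∉ Q.toSet, φ x = 0) :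
    ∀ᵐ x, Tendsto (fun N => dyadicStep (fun R => ⨍ y in R.toSet, φ y ∂volume) N Q x) atTop
      (𝓝 (φ x)) := by
  filter_upwards [ae_tendsto_setAverage (Q.integrable_of_bounded hφ hM h0).locallyIntegrable]
    with x hx
  by_cases hxQ : x ∈ Q.toSet
  · choose R hxR hRQ hRs hRe using fun N => exists_dyadicStep_eq
      (fun R => ⨍ y in R.toSet, φ y ∂volume) N Q hxQ
    have hlim : Tendsto (fun N => (R N).side) atTop (𝓝 0) := by
      simp only [hRs]
      have := (tendsto_pow_atTop_nhds_zero_of_lt_one (r := (1 / 2 : ℝ)) (by norm_num)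
        (by norm_num)).const_mul Q.side
      simpa [div_eq_mul_inv] using this
    simpa only [hRe] using hx R hxR hlim
  · simp only [dyadicStep_of_notMem _ _ _ hxQ, h0 x hxQ]
    exact tendsto_const_nhds

end Cube

lemma IsDyadicLattice.dyadicStep_smul_mem {d : ℕ} {B : Type*} [NormedAddCommGroup B]
    [NormedSpace ℝ B] {D : Set (Cube d)} (hD : IsDyadicLattice D) (a : Cube d → ℝ) (b : B) (N : ℕ)
    {Q : Cube d} (hQ : Q ∈ D) : (fun x => Cube.dyadicStep a N Q x • b) ∈ stepFunctions B D := by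
  induction N generalizing Q with
  | zero =>
    refine Submodule.subset_span ⟨Q, hQ, a Q • b, ?_⟩
    ext1 x
    by_cases hx : x ∈ Q.toSet <;> simp [Cube.dyadicStep, hx]
  | succ N ih =>
    have h1 : (fun x => Cube.dyadicStep a (N + 1) Q x • b) =
        ∑ c, fun x => Cube.dyadicStep a N (Q.child c) x • b := by
      ext1 x
      simp [Cube.dyadicStep, Finset.sum_smul]
    rw [h1]
    exact Submodule.sum_mem _ fun c _ => ih (hD.subcubes Q hQ (Q.child_mem_dyadicSubcubes c))

lemma norm_toLp_le_sum {n : ℕ} {B : Type*} [NormedAddCommGroup B] (v : Fin n → B) :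
    ‖(WithLp.toLp 2 v : PiLp 2 fun _ : Fin n => B)‖ ≤ ∑ i, ‖v i‖ := by
  rw [PiLp.norm_eq_of_L2]
  refine Real.sqrt_le_iff.2 ⟨by positivity, ?_⟩
  exact Finset.sum_sq_le_sq_sum_of_nonneg fun i _ => norm_nonneg _

section

variable {d n : ℕ} {B : Type*} [NormedAddCommGroup B] [NormedSpace ℝ B]
  {W : EuclideanSpace ℝ (Fin d) → Matrix (Fin n) (Fin n) ℝ}

lemma norm_matPowSMul_le (α : ℝ) {g : Fin n → EuclideanSpace ℝ (Fin d) → B}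
    {x : EuclideanSpace ℝ (Fin d)} {M : ℝ} (hM : ∀ i, ‖g i x‖ ≤ M) :
    ‖matPowSMul W α g x‖ ≤ (∑ i, ∑ k, ‖matPow (W x) α i k‖) * M := by
  refine (norm_toLp_le_sum _).trans ?_
  simp only [Finset.sum_mul]
  refine Finset.sum_le_sum fun i _ => (norm_sum_le _ _).trans (Finset.sum_le_sum fun k _ => ?_)
  rw [norm_smul]
  gcongr
  exact hM k

/-- The entries of W^{-1/r} are in L^{r'} on cubes. This provides the majorant for dominated
convergence in the dual norm. -/
lemma IsMatrixWeight.memLp_sum_norm_matPow (hn : 1 ≤ n) (hW : IsMatrixWeight W) {r : ℝ}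
    (hr : 1 < r) (hA : matrixAr r W < ∞) (Q : Cube d) :
    MemLp (fun x => ∑ i, ∑ k, ‖matPow (W x) (-(1 / r)) i k‖)
      (ENNReal.ofReal (Real.conjExponent r)) Q.avgMeasure := by
  have : NeZero n := ⟨by omega⟩
  have h := hW.isWeightPair hA
  refine memLp_finsetSum _ fun i _ => memLp_finsetSum _ fun k _ => ?_
  refine MemLp.norm ((h.memLp_right hr (zero_le_one.trans (h.one_le hr)) Q
    (EuclideanSpace.single k 1)).mono
    ((hW.aestronglyMeasurable_matPow _ i k).restrict.smul_measure _) (ae_of_all _ fun x => ?_))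
  have h1 : (powCLM (W x) (-(1 / r)) (EuclideanSpace.single k 1)) i =
      matPow (W x) (-(1 / r)) i k := by
    rw [powCLM, Matrix.ofLp_toEuclideanCLM]
    simp
  rw [← h1]
  exact PiLp.norm_apply_le _ _

lemma IsMatrixWeight.lintegral_sum_norm_matPow_ne_top (hn : 1 ≤ n) (hW : IsMatrixWeight W) {r : ℝ}
    (hr : 1 < r) (hA : matrixAr r W < ∞) (Q : Cube d) (M : ℝ) :
    ∫⁻ x, ‖Q.toSet.indicator (fun x => (∑ i, ∑ k, ‖matPow (W x) (-(1 / r)) i k‖) * M) x‖ₑ ^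
      Real.conjExponent r ≠ ∞ := by
  have hr' : 0 < Real.conjExponent r := (Real.HolderConjugate.conjExponent hr).symm.pos
  have h1 := lintegral_rpow_enorm_lt_top_of_eLpNorm_lt_top (by simpa using hr')
    ENNReal.ofReal_ne_top ((hW.memLp_sum_norm_matPow hn hr hA Q).mul_const M).2
  rw [ENNReal.toReal_ofReal hr'.le, Q.lintegral_avgMeasure, Q.laverage_eq] at h1
  have h2 : ∫⁻ x in Q.toSet, ‖(∑ i, ∑ k, ‖matPow (W x) (-(1 / r)) i k‖) * M‖ₑ ^
      Real.conjExponent r ≠ ∞ := by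
    intro htop
    rw [htop, ENNReal.mul_top (ENNReal.inv_ne_zero.2 Q.volume_toSet_ne_top)] at h1
    exact lt_irrefl _ h1
  rw [← lintegral_indicator Q.measurableSet_toSet] at h2
  refine fun htop => h2 (htop ▸ lintegral_congr fun x => ?_)
  by_cases hx : x ∈ Q.toSet <;> simp [hx, hr']

/-- A bound of a bilinear form which holds for step functions extends to combinations of fixed
vectors with bounded scalar coefficients. -/
lemma IsMatrixWeight.ofReal_integral_le_of_stepFunctions (hn : 1 ≤ n) (hW : IsMatrixWeight W)
    {r : ℝ} (hr : 1 < r) (hA : matrixAr r W < ∞) {D : Set (Cube d)} (hD : IsDyadicLattice D)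
    {h : Fin n → EuclideanSpace ℝ (Fin d) → B} {K : ℝ≥0∞} (hK : K ≠ ∞)
    (hint : ∀ g ∈ stepFunctions (StrongDual ℝ B) D, ∀ i, Integrable fun x => g x (h i x))
    (hb : ∀ g : Fin n → EuclideanSpace ℝ (Fin d) → StrongDual ℝ B,
      (∀ i, g i ∈ stepFunctions (StrongDual ℝ B) D) →
      ENNReal.ofReal |∑ i, ∫ x, g i x (h i x)| ≤
        K * (∫⁻ x, ‖matPowSMul W (-(1 / r)) g x‖ₑ ^ Real.conjExponent r) ^
          (1 / Real.conjExponent r))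
    {J : Type*} [Fintype J] {Q : Cube d} (hQ : Q ∈ D) (b : J → StrongDual ℝ B)
    {φ : Fin n → J → EuclideanSpace ℝ (Fin d) → ℝ} {M : ℝ}
    (hφ : ∀ i j, AEStronglyMeasurable (φ i j) volume) (hM : ∀ i j x, |φ i j x| ≤ M)
    (h0 : ∀ i j, ∀ x ∉ Q.toSet, φ i j x = 0) :
    ENNReal.ofReal |∫ x, ∑ i, (∑ j, φ i j x • b j) (h i x)| ≤
      K * (∫⁻ x, ‖matPowSMul W (-(1 / r)) (fun i x => ∑ j, φ i j x • b j) x‖ₑ ^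
        Real.conjExponent r) ^ (1 / Real.conjExponent r) := by
  have hr' : 0 < Real.conjExponent r := (Real.HolderConjugate.conjExponent hr).symm.pos
  -- Dyadic averages of the coefficients: they give step functions on subcubes of Q, keep the bound
  -- M and the support, and converge almost everywhere.
  set φN : ℕ → Fin n → J → EuclideanSpace ℝ (Fin d) → ℝ := fun N i j =>
    Cube.dyadicStep (fun R => ⨍ y in R.toSet, φ i j y ∂volume) N Q with hφN
  set g : ℕ → Fin n → EuclideanSpace ℝ (Fin d) → StrongDual ℝ B := fun N i x =>
    ∑ j, φN N i j x • b j with hg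
  have hgs : ∀ N i, g N i ∈ stepFunctions (StrongDual ℝ B) D := fun N i => by
    have h1 : g N i = ∑ j, fun x => φN N i j x • b j := by
      ext1 x
      simp [hg]
    rw [h1]
    exact Submodule.sum_mem _ fun j _ => hD.dyadicStep_smul_mem _ _ _ hQ
  have hlim : ∀ᵐ x, ∀ i j, Tendsto (fun N => φN N i j x) atTop (𝓝 (φ i j x)) := by
    rw [ae_all_iff]
    intro i
    rw [ae_all_iff]
    intro j
    exact Q.ae_tendsto_dyadicStep_setAverage (hφ i j) (hM i j) (h0 i j)
  have hφNM : ∀ N i j x, |φN N i j x| ≤ M := fun N i j x =>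
    Q.abs_dyadicStep_setAverage_le N (hM i j) x
  have hφN0 : ∀ N i j, ∀ x ∉ Q.toSet, φN N i j x = 0 := fun N i j x hx =>
    Cube.dyadicStep_of_notMem _ _ _ hx
  have hind : ∀ j, (Q.toSet.indicator fun _ => b j) ∈ stepFunctions (StrongDual ℝ B) D :=
    fun j => Submodule.subset_span ⟨Q, hQ, b j, rfl⟩
  have hL : Tendsto (fun N => ∑ i, ∫ x, g N i x (h i x)) atTop
      (𝓝 (∫ x, ∑ i, (∑ j, φ i j x • b j) (h i x))) := by
    have h1 : ∀ N, ∑ i, ∫ x, g N i x (h i x) = ∫ x, ∑ i, g N i x (h i x) := fun N =>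
      (integral_finsetSum _ fun i _ => hint _ (hgs N i) i).symm
    simp only [h1]
    -- No local integrability of h is available. The majorant is integrable because each 1_Q b_j is
    -- itself a step function, to which `hint` applies.
    refine tendsto_integral_of_dominated_convergence
      (fun x => ∑ i, ∑ j, M * ‖(Q.toSet.indicator (fun _ => b j) x) (h i x)‖)
      (fun N => (integrable_finsetSum _ fun i _ => hint _ (hgs N i) i).1)
      (integrable_finsetSum _ fun i _ => integrable_finsetSum _ fun j _ =>
        (hint _ (hind j) i).norm.const_mul M) (fun N => ae_of_all _ fun x => ?_) ?_
    · refine (norm_sum_le _ _).trans (Finset.sum_le_sum fun i _ => ?_)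
      simp only [hg, _root_.sum_apply, _root_.smul_apply]
      refine (norm_sum_le _ _).trans (Finset.sum_le_sum fun j _ => ?_)
      by_cases hx : x ∈ Q.toSet
      · rw [norm_smul, Set.indicator_of_mem hx]
        gcongr
        exact hφNM N i j x
      · simp [hφN0 N i j x hx, hx]
    · filter_upwards [hlim] with x hx
      simp only [hg, _root_.sum_apply, _root_.smul_apply]
      exact tendsto_finsetSum _ fun i _ => tendsto_finsetSum _ fun j _ =>
        (hx i j).smul_const _
  have hR : Tendsto (fun N => ∫⁻ x, ‖matPowSMul W (-(1 / r)) (g N) x‖ₑ ^ Real.conjExponent r) atTop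
      (𝓝 (∫⁻ x, ‖matPowSMul W (-(1 / r)) (fun i x => ∑ j, φ i j x • b j) x‖ₑ ^
        Real.conjExponent r)) := by
    refine tendsto_lintegral_of_dominated_convergence'
      (fun x => ‖Q.toSet.indicator (fun x => (∑ i, ∑ k, ‖matPow (W x) (-(1 / r)) i k‖) *
        ∑ j, M * ‖b j‖) x‖ₑ ^ Real.conjExponent r) (fun N => ?_) (fun N => ae_of_all _ fun x => ?_)
      (hW.lintegral_sum_norm_matPow_ne_top hn hr hA Q _) ?_
    · have hm : AEStronglyMeasurable (matPowSMul W (-(1 / r)) (g N)) volume :=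
        hW.aestronglyMeasurable_matPowSMul _ fun i =>
          Finset.aestronglyMeasurable_fun_sum _ fun j _ =>
            (Cube.measurable_dyadicStep _ _ _).aestronglyMeasurable.smul_const _
      exact hm.enorm.pow_const _
    · dsimp only
      gcongr
      by_cases hx : x ∈ Q.toSet
      · rw [Set.indicator_of_mem hx]
        have hle : ‖matPowSMul W (-(1 / r)) (g N) x‖ ≤
            (∑ i, ∑ k, ‖matPow (W x) (-(1 / r)) i k‖) * ∑ j, M * ‖b j‖ := by
          refine norm_matPowSMul_le _ fun i => (norm_sum_le _ _).trans
            (Finset.sum_le_sum fun j _ => ?_)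
          rw [norm_smul]
          gcongr
          exact hφNM N i j x
        exact enorm_le_iff_norm_le.2 (hle.trans (le_abs_self _))
      · have h1 : matPowSMul W (-(1 / r)) (g N) x = 0 := by
          ext i
          simp [matPowSMul, hg, hφN0 N _ _ x hx]
        have h2 : ‖matPowSMul W (-(1 / r)) (g N) x‖ₑ = 0 := by
          rw [← ofReal_norm, h1, norm_zero, ENNReal.ofReal_zero]
        exact h2.trans_le bot_le
    · filter_upwards [hlim] with x hx
      have hv : Tendsto (fun N => matPowSMul W (-(1 / r)) (g N) x) atTop
          (𝓝 (matPowSMul W (-(1 / r)) (fun i x => ∑ j, φ i j x • b j) x)) := by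
        refine ((PiLp.continuous_toLp 2 fun _ : Fin n => StrongDual ℝ B).tendsto _).comp (tendsto_pi_nhds.2 fun i => ?_)
        exact tendsto_finsetSum _ fun k _ => Tendsto.const_smul (tendsto_finsetSum _ fun j _ =>
          (hx k j).smul_const _) _
      exact (ENNReal.continuous_rpow_const.tendsto _).comp hv.enorm
  refine le_of_tendsto_of_tendsto' ((ENNReal.continuous_ofReal.tendsto _).comp
    ((continuous_abs.tendsto _).comp hL)) (ENNReal.Tendsto.const_mul
    ((ENNReal.continuous_rpow_const.tendsto _).comp hR) (Or.inr hK)) fun N => hb _ (hgs N)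

end

/-! ### Norming functionals -/

/-- Hahn–Banach functionals ψ_i norming the components are combined with weights ‖v_i‖/‖v‖, and
Cauchy–Schwarz gives the bound. For v = 0 division by zero makes all β_i zero, whence norm at most 1
rather than equal to 1. -/
lemma exists_norming_dual {n : ℕ} {B : Type*} [NormedAddCommGroup B] [NormedSpace ℝ B]
    (v : PiLp 2 fun _ : Fin n => B) :
    ∃ β : Fin n → StrongDual ℝ B, ‖(WithLp.toLp 2 β : PiLp 2 fun _ : Fin n => StrongDual ℝ B)‖ ≤ 1 ∧
      ∑ i, β i (v i) = ‖v‖ ∧ ∀ w : PiLp 2 fun _ : Fin n => B, |∑ i, β i (w i)| ≤ ‖w‖ := by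
  choose ψ hψ hψv using fun i => exists_dual_vector'' ℝ (v i)
  have hβ : ‖(WithLp.toLp 2 (fun i => (‖v i‖ / ‖v‖) • ψ i) :
      PiLp 2 fun _ : Fin n => StrongDual ℝ B)‖ ≤ 1 := by
    rw [PiLp.norm_eq_of_L2, Real.sqrt_le_one]
    have h1 : ∀ i, ‖(‖v i‖ / ‖v‖) • ψ i‖ ^ 2 ≤ ‖v i‖ ^ 2 / ‖v‖ ^ 2 := fun i => by
      rw [← div_pow]
      gcongr
      rw [norm_smul, Real.norm_of_nonneg (by positivity)]
      exact mul_le_of_le_one_right (by positivity) (hψ i)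
    refine (Finset.sum_le_sum fun i _ => h1 i).trans ?_
    rw [← Finset.sum_div, ← PiLp.norm_sq_eq_of_L2]
    exact div_self_le_one _
  refine ⟨fun i => (‖v i‖ / ‖v‖) • ψ i, hβ, ?_, fun w => ?_⟩
  · have h1 : ∀ i, ((‖v i‖ / ‖v‖) • ψ i) (v i) = ‖v i‖ ^ 2 / ‖v‖ := fun i => by
      have h2 : ψ i (v i) = ‖v i‖ := hψv i
      rw [_root_.smul_apply, h2, smul_eq_mul]
      ring
    simp only [h1]
    rw [← Finset.sum_div, ← PiLp.norm_sq_eq_of_L2, pow_two, mul_self_div_self]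
  · set β := fun i => (‖v i‖ / ‖v‖) • ψ i with hβdef
    have h1 : |∑ i, β i (w i)| ≤ ∑ i, ‖β i‖ * ‖w i‖ :=
      (Finset.abs_sum_le_sum_abs _ _).trans (Finset.sum_le_sum fun i _ => (β i).le_opNorm _)
    refine h1.trans ((Real.sum_mul_le_sqrt_mul_sqrt _ _ _).trans ?_)
    rw [PiLp.norm_eq_of_L2] at hβ
    rw [PiLp.norm_eq_of_L2 w]
    exact mul_le_of_le_one_left (Real.sqrt_nonneg _) hβ

/-! ### The weighted norm by duality -/

/-- The test function is ω = (s^+ 1_A)^{r-1}, for which ω s = (s^+ 1_A)^r. Boundedness of s from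
above on A and finiteness of the measure of A make the integral finite, so that a power of it can be
cancelled; ω also stays bounded, as the later tests require. -/
lemma lintegral_rpow_le_of_forall_mul {α : Type*} [MeasurableSpace α] {μ : Measure α} {r : ℝ}
    (hr : 1 < r) {s : α → ℝ} (hs : AEStronglyMeasurable s μ) {A : Set α}
    (hA : NullMeasurableSet A μ) (hAt : μ A ≠ ∞) {M : ℝ} (hM : 0 ≤ M) (hsM : ∀ x ∈ A, s x ≤ M)
    {K : ℝ≥0∞}
    (hb : ∀ ω : α → ℝ, AEStronglyMeasurable ω μ → (∀ x, 0 ≤ ω x) → (∀ x, ω x ≤ M ^ (r - 1)) →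
      (∀ x ∉ A, ω x = 0) → ENNReal.ofReal |∫ x, ω x * s x ∂μ| ≤
        K * (∫⁻ x, ENNReal.ofReal (ω x) ^ Real.conjExponent r ∂μ) ^ (1 / Real.conjExponent r)) :
    ∫⁻ x, ENNReal.ofReal (A.indicator (fun x => max (s x) 0) x) ^ r ∂μ ≤ K ^ r := by
  have hr0 : 0 < r := by linarith
  have hpq := Real.HolderConjugate.conjExponent hr
  set c : α → ℝ := A.indicator fun x => max (s x) 0 with hc
  have hcm : AEStronglyMeasurable c μ := (hs.sup aestronglyMeasurable_const).indicator₀ hA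
  have hc0 : ∀ x, 0 ≤ c x := fun x => Set.indicator_nonneg (fun x _ => le_max_right _ _) x
  have hcM : ∀ x, c x ≤ M := fun x => Set.indicator_le' (fun x hx => max_le (hsM x hx) hM)
    (fun x _ => hM) x
  have hcA : ∀ x ∉ A, c x = 0 := fun x hx => Set.indicator_of_notMem hx _
  have hcs : ∀ x, c x ^ (r - 1) * s x = c x ^ r := fun x => by
    rcases (hc0 x).eq_or_lt with h | h
    · rw [← h, Real.zero_rpow (by linarith), Real.zero_rpow hr0.ne', zero_mul]
    · have hx : x ∈ A := by
        by_contra hx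
        exact h.ne' (hcA x hx)
      have h1 : c x = max (s x) 0 := Set.indicator_of_mem hx _
      have h2 : c x = s x := by
        rcases max_choice (s x) 0 with h3 | h3
        · rw [h1, h3]
        · rw [h1, h3] at h
          exact absurd h (lt_irrefl _)
      rw [← h2, ← Real.rpow_add_one h.ne']
      congr 1
      ring
  have hcr : ∀ x, ENNReal.ofReal (c x ^ (r - 1)) ^ Real.conjExponent r =
      ENNReal.ofReal (c x) ^ r := fun x => by
    rw [← ENNReal.ofReal_rpow_of_nonneg (hc0 x) (by linarith), ← ENNReal.rpow_mul]
    congr 1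
    rw [Real.conjExponent]
    have : r - 1 ≠ 0 := by linarith
    field_simp
  have hI : ∫⁻ x, ENNReal.ofReal (c x) ^ r ∂μ ≠ ∞ := by
    have h1 : ∫⁻ x, ENNReal.ofReal (c x) ^ r ∂μ ≤
        ∫⁻ x, A.indicator (fun _ => ENNReal.ofReal M ^ r) x ∂μ := lintegral_mono fun x => by
      by_cases hx : x ∈ A
      · rw [Set.indicator_of_mem hx]
        gcongr
        exact hcM x
      · rw [hcA x hx, ENNReal.ofReal_zero, ENNReal.zero_rpow_of_pos hr0]
        exact bot_le
    refine (h1.trans_lt ?_).ne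
    rw [lintegral_indicator₀ hA, setLIntegral_const]
    exact ENNReal.mul_lt_top (ENNReal.rpow_lt_top_of_nonneg hr0.le ENNReal.ofReal_ne_top)
      hAt.lt_top
  have h1 := hb (fun x => c x ^ (r - 1))
    (hcm.aemeasurable.pow_const _).aestronglyMeasurable (fun x => Real.rpow_nonneg (hc0 x) _)
    (fun x => Real.rpow_le_rpow (hc0 x) (hcM x) (by linarith))
    (fun x hx => by rw [hcA x hx, Real.zero_rpow (by linarith)])
  simp only [hcs, hcr] at h1
  rw [abs_of_nonneg (integral_nonneg fun x => Real.rpow_nonneg (hc0 x) _),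
    integral_eq_lintegral_of_nonneg_ae (ae_of_all _ fun x => Real.rpow_nonneg (hc0 x) _)
      (hcm.aemeasurable.pow_const _).aestronglyMeasurable] at h1
  simp only [← ENNReal.ofReal_rpow_of_nonneg (hc0 _) hr0.le] at h1
  rw [ENNReal.ofReal_toReal hI] at h1
  have h2 := ENNReal.rpow_le_of_le_mul_rpow hpq hI h1
  rwa [one_div, ENNReal.rpow_inv_le_iff hr0] at h2

section

variable {d n : ℕ} {B : Type*} [NormedAddCommGroup B] [NormedSpace ℝ B]
  {W : EuclideanSpace ℝ (Fin d) → Matrix (Fin n) (Fin n) ℝ}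

lemma sum_matPow_smul_dual_apply (α : ℝ) (h : Fin n → EuclideanSpace ℝ (Fin d) → B)
    (v : Fin n → StrongDual ℝ B) (x : EuclideanSpace ℝ (Fin d)) :
    ∑ i, (∑ k, matPow (W x) α i k • v k) (h i x) = ∑ k, v k (matPowSMul W α h x k) := by
  simp only [matPowSMul, map_sum, map_smul, _root_.sum_apply, _root_.smul_apply]
  rw [Finset.sum_comm]
  exact Finset.sum_congr rfl fun k _ => Finset.sum_congr rfl fun i _ => by rw [matPow_apply_comm]

/-- The test function is W^{1/r} ω β(f): paired with h it gives ω times the pairing of β(f) with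
W^{1/r} h, while W^{-1/r} maps it back to ω β(f), of norm at most ω. As f is simple, only finitely
many functionals occur, and their scalar coefficients are bounded because the entries of W^{1/r} are
bounded where ω ≠ 0. -/
lemma IsMatrixWeight.ofReal_integral_mul_le_of_stepFunctions (hn : 1 ≤ n) (hW : IsMatrixWeight W)
    {r : ℝ} (hr : 1 < r) (hA : matrixAr r W < ∞) {D : Set (Cube d)} (hD : IsDyadicLattice D)
    {h : Fin n → EuclideanSpace ℝ (Fin d) → B} {K : ℝ≥0∞} (hK : K ≠ ∞)
    (hint : ∀ g ∈ stepFunctions (StrongDual ℝ B) D, ∀ i, Integrable fun x => g x (h i x))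
    (hb : ∀ g : Fin n → EuclideanSpace ℝ (Fin d) → StrongDual ℝ B,
      (∀ i, g i ∈ stepFunctions (StrongDual ℝ B) D) →
      ENNReal.ofReal |∑ i, ∫ x, g i x (h i x)| ≤
        K * (∫⁻ x, ‖matPowSMul W (-(1 / r)) g x‖ₑ ^ Real.conjExponent r) ^
          (1 / Real.conjExponent r))
    {X : Type*} (β : X → Fin n → StrongDual ℝ B)
    (hβ : ∀ v, ‖(WithLp.toLp 2 (β v) : PiLp 2 fun _ : Fin n => StrongDual ℝ B)‖ ≤ 1)
    (f : SimpleFunc (EuclideanSpace ℝ (Fin d)) X) {Q : Cube d} (hQ : Q ∈ D) {M M' : ℝ}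
    {ω : EuclideanSpace ℝ (Fin d) → ℝ} (hω : AEStronglyMeasurable ω volume) (hω0 : ∀ x, 0 ≤ ω x)
    (hωM : ∀ x, ω x ≤ M') (hωQ : ∀ x ∉ Q.toSet, ω x = 0)
    (hωW : ∀ x, ω x ≠ 0 → ∀ i k, |matPow (W x) (1 / r) i k| ≤ M) :
    ENNReal.ofReal |∫ x, ω x * ∑ k, β (f x) k (matPowSMul W (1 / r) h x k)| ≤
      K * (∫⁻ x, ENNReal.ofReal (ω x) ^ Real.conjExponent r) ^ (1 / Real.conjExponent r) := by
  classical
  have hr' : 0 < Real.conjExponent r := (Real.HolderConjugate.conjExponent hr).symm.pos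
  have hM' : 0 ≤ M' := (hω0 0).trans (hωM 0)
  set φ : Fin n → Fin n × f.range → EuclideanSpace ℝ (Fin d) → ℝ := fun i j x =>
    (f ⁻¹' {j.2.1}).indicator (fun x => matPow (W x) (1 / r) i j.1 * ω x) x with hφ
  have hsum : ∀ x i, ∑ j : Fin n × f.range, φ i j x • β j.2 j.1 =
      ∑ k, matPow (W x) (1 / r) i k • ω x • β (f x) k := fun x i => by
    rw [Fintype.sum_prod_type]
    refine Finset.sum_congr rfl fun k _ => ?_
    rw [Finset.sum_eq_single ⟨f x, f.mem_range_self x⟩]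
    · simp [hφ, smul_smul]
    · intro m _ hm
      have h1 : x ∉ f ⁻¹' {m.1} := fun h2 => hm (Subtype.ext (Eq.symm h2))
      simp only [hφ, Set.indicator_of_notMem h1, zero_smul]
    · simp
  have h1 := hW.ofReal_integral_le_of_stepFunctions hn hr hA hD hK hint hb hQ
    (fun j : Fin n × f.range => β j.2 j.1) (φ := φ) (M := |M| * M')
    (fun i j => ((hW.aestronglyMeasurable_matPow _ i j.1).mul hω).indicator
      (f.measurableSet_preimage _)) (fun i j x => ?_) (fun i j x hx => ?_)
  · simp only [hsum] at h1
    have h2 : ∀ x, ∑ i, (∑ k, matPow (W x) (1 / r) i k • ω x • β (f x) k) (h i x) =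
        ω x * ∑ k, β (f x) k (matPowSMul W (1 / r) h x k) := fun x => by
      rw [sum_matPow_smul_dual_apply, Finset.mul_sum]
      rfl
    simp only [h2] at h1
    refine h1.trans ?_
    gcongr K * ?_ ^ _
    refine lintegral_mono_ae ?_
    filter_upwards [hW.posDef] with x hx
    gcongr
    have h3 : matPowSMul W (-(1 / r)) (fun i x => ∑ k, matPow (W x) (1 / r) i k • ω x • β (f x) k) x
        = ω x • WithLp.toLp 2 (β (f x)) := by
      ext1 i
      exact hx.sum_matPow_smul (1 / r) (fun k => ω x • β (f x) k) i
    rw [h3, ← ofReal_norm, norm_smul, Real.norm_of_nonneg (hω0 x)]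
    exact ENNReal.ofReal_le_ofReal (mul_le_of_le_one_right (hω0 x) (hβ _))
  · by_cases hx : ω x = 0
    · simp only [hφ, Set.indicator_apply, hx, mul_zero, ite_self, abs_zero]
      positivity
    · simp only [hφ, Set.indicator_apply]
      split_ifs
      · rw [abs_mul, abs_of_nonneg (hω0 x)]
        exact mul_le_mul ((hωW x hx i j.1).trans (le_abs_self M)) (hωM x) (hω0 x) (abs_nonneg M)
      · rw [abs_zero]
        positivity
  · simp only [hφ, Set.indicator_apply, hωQ x hx, mul_zero, ite_self]

/-- The norm of `L^r(W)` by duality with step functions. -/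
theorem IsMatrixWeight.weightedNorm_le_of_stepFunctions (hn : 1 ≤ n) (hW : IsMatrixWeight W)
    {r : ℝ} (hr : 1 < r) (hA : matrixAr r W < ∞) {D : Set (Cube d)} (hD : IsDyadicLattice D)
    {h : Fin n → EuclideanSpace ℝ (Fin d) → B} (hh : ∀ i, AEStronglyMeasurable (h i) volume)
    {K : ℝ≥0∞} (hK : K ≠ ∞)
    (hint : ∀ g ∈ stepFunctions (StrongDual ℝ B) D, ∀ i, Integrable fun x => g x (h i x))
    (hb : ∀ g : Fin n → EuclideanSpace ℝ (Fin d) → StrongDual ℝ B,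
      (∀ i, g i ∈ stepFunctions (StrongDual ℝ B) D) →
      ENNReal.ofReal |∑ i, ∫ x, g i x (h i x)| ≤
        K * (∫⁻ x, ‖matPowSMul W (-(1 / r)) g x‖ₑ ^ Real.conjExponent r) ^
          (1 / Real.conjExponent r)) :
    weightedNorm r W h ≤ K := by
  classical
  have hr0 : 0 < r := by linarith
  -- An arbitrary choice of norming functionals suffices: β is only composed with simple functions,
  -- so no measurable selection is needed.
  choose β hβ1 hβ2 hβ3 using exists_norming_dual (n := n) (B := B)
  choose Q hQD hQ using fun N : ℕ => hD.compact_subset (Metric.closedBall 0 N)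
    (isCompact_closedBall _ _)
  set H := matPowSMul W (1 / r) h with hH
  have hHm : AEStronglyMeasurable H volume := hW.aestronglyMeasurable_matPowSMul _ hh
  set f := hHm.stronglyMeasurable_mk.approx with hf
  set s : ℕ → EuclideanSpace ℝ (Fin d) → ℝ := fun N x => ∑ k, β (f N x) k (H x k) with hs
  have hsm : ∀ N, AEStronglyMeasurable (s N) volume := fun N => by
    have h1 : s N = fun x => ∑ m ∈ (f N).range,
        (f N ⁻¹' {m}).indicator (fun x => ∑ k, β m k (H x k)) x := by
      funext x
      rw [Finset.sum_eq_single (f N x)]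
      · simp [hs]
      · intro m _ hm
        have h1 : x ∉ f N ⁻¹' {m} := fun h2 => hm (Eq.symm h2)
        rw [Set.indicator_of_notMem h1]
      · exact fun h2 => absurd ((f N).mem_range_self x) h2
    rw [h1]
    refine Finset.aestronglyMeasurable_fun_sum _ fun m _ =>
      AEStronglyMeasurable.indicator (Finset.aestronglyMeasurable_fun_sum _ fun k _ => ?_)
        ((f N).measurableSet_preimage _)
    have hc : Continuous fun w : PiLp 2 fun _ : Fin n => B => β m k (w k) :=
      (β m k).continuous.comp (PiLp.continuous_apply 2 (fun _ : Fin n => B) k)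
    exact hc.comp_aestronglyMeasurable hHm
  -- The truncation sets: a cube of D, bounded entries of W^{1/r} and `s N` bounded above. Every
  -- point belongs to `A N` for almost every x as soon as N is large.
  set A : ℕ → Set (EuclideanSpace ℝ (Fin d)) := fun N => (Q N).toSet ∩
    ((⋂ i, ⋂ k, {x | |matPow (W x) (1 / r) i k| ≤ N}) ∩ {x | s N x ≤ N}) with hAdef
  have hAm : ∀ N, NullMeasurableSet (A N) volume := fun N => by
    refine (Q N).measurableSet_toSet.nullMeasurableSet.inter (NullMeasurableSet.inter
      (NullMeasurableSet.iInter fun i => NullMeasurableSet.iInter fun k => ?_) ?_)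
    · exact nullMeasurableSet_le (hW.aestronglyMeasurable_matPow (1 / r) i k).aemeasurable.abs
        aemeasurable_const
    · exact nullMeasurableSet_le (hsm N).aemeasurable aemeasurable_const
  have hbound : ∀ N, ∫⁻ x, ENNReal.ofReal ((A N).indicator (fun x => max (s N x) 0) x) ^ r ≤
      K ^ r := fun N => by
    refine lintegral_rpow_le_of_forall_mul hr (hsm N) (hAm N)
      (measure_ne_top_of_subset Set.inter_subset_left (Q N).volume_toSet_ne_top)
      (Nat.cast_nonneg N) (fun x hx => hx.2.2) fun ω hω hω0 hωM hωA => ?_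
    refine hW.ofReal_integral_mul_le_of_stepFunctions hn hr hA hD hK hint hb β hβ1 (f N) (hQD N)
      (M := N) hω hω0 hωM (fun x hx => hωA x fun h1 => hx h1.1) fun x hx i k => ?_
    have h1 : x ∈ A N := by
      by_contra h1
      exact hx (hωA x h1)
    exact Set.mem_iInter.1 (Set.mem_iInter.1 h1.2.1 i) k
  have hlim : ∀ᵐ x, Tendsto (fun N => ENNReal.ofReal
      ((A N).indicator (fun x => max (s N x) 0) x) ^ r) atTop (𝓝 (‖H x‖ₑ ^ r)) := by
    filter_upwards [hHm.ae_eq_mk] with x hx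
    refine (ENNReal.continuous_rpow_const.tendsto _).comp ?_
    rw [← ofReal_norm]
    refine (ENNReal.continuous_ofReal.tendsto _).comp ?_
    have hfx : Tendsto (fun N => f N x) atTop (𝓝 (H x)) := by
      rw [hx]
      exact hHm.stronglyMeasurable_mk.tendsto_approx x
    have hle : ∀ N, s N x ≤ ‖H x‖ := fun N => (le_abs_self _).trans (hβ3 _ _)
    -- The functional norms `f N x`, and H differs from it by a vector on which the functional is at
    -- most its norm. With `hle` this squeezes `s N x` to ‖H x‖.
    have hge : ∀ N, ‖f N x‖ - ‖H x - f N x‖ ≤ s N x := fun N => by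
      have h1 : s N x = ‖f N x‖ + ∑ k, β (f N x) k ((H x - f N x) k) := by
        rw [← hβ2 (f N x), ← Finset.sum_add_distrib]
        refine Finset.sum_congr rfl fun k _ => ?_
        rw [← map_add, PiLp.sub_apply, add_sub_cancel]
      have h2 := neg_le_of_abs_le (hβ3 (f N x) (H x - f N x))
      linarith
    have hsx : Tendsto (fun N => s N x) atTop (𝓝 ‖H x‖) := by
      refine tendsto_of_tendsto_of_tendsto_of_le_of_le ?_ tendsto_const_nhds hge hle
      have h1 := hfx.norm.sub (tendsto_const_nhds (x := H x) |>.sub hfx).norm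
      simpa using h1
    have hmax : Tendsto (fun N => max (s N x) 0) atTop (𝓝 ‖H x‖) := by
      simpa using hsx.max (tendsto_const_nhds (x := (0 : ℝ)))
    refine hmax.congr' ?_
    have hev : ∀ b : ℝ, ∀ᶠ N : ℕ in atTop, b ≤ N := fun b =>
      tendsto_natCast_atTop_atTop.eventually_ge_atTop b
    filter_upwards [hev (dist x 0), hev ‖H x‖, eventually_all.2 fun i => eventually_all.2 fun k =>
      hev |matPow (W x) (1 / r) i k|] with N h1 h2 h3
    rw [Set.indicator_of_mem]
    exact ⟨hQ N (Metric.mem_closedBall.2 h1), Set.mem_iInter.2 fun i => Set.mem_iInter.2 (h3 i),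
      (hle N).trans h2⟩
  have hfinal : ∫⁻ x, ‖H x‖ₑ ^ r ≤ K ^ r := by
    calc ∫⁻ x, ‖H x‖ₑ ^ r = ∫⁻ x, liminf (fun N => ENNReal.ofReal
          ((A N).indicator (fun x => max (s N x) 0) x) ^ r) atTop := lintegral_congr_ae <| by
            filter_upwards [hlim] with x hx
            exact hx.liminf_eq.symm
      _ ≤ liminf (fun N => ∫⁻ x, ENNReal.ofReal
          ((A N).indicator (fun x => max (s N x) 0) x) ^ r) atTop :=
            lintegral_liminf_le' fun N => (((hsm N).sup
              aestronglyMeasurable_const).indicator₀ (hAm N)).aemeasurable.ennreal_ofReal.pow_const _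
      _ ≤ K ^ r := liminf_le_of_frequently_le' (Frequently.of_forall hbound)
  rw [weightedNorm_eq hr0, ← hH, one_div, ENNReal.rpow_inv_le_iff hr0]
  exact hfinal

end

/-- Convex body domination implies matrix-weighted bounds of the operator. -/
theorem HasConvexBodyDomination.weightedNorm_le {d n : ℕ} (hn : 1 ≤ n) {r : ℝ} (hr : 1 < r)
    {γ : ℝ} (hγ : 0 < γ) {D : Set (Cube d)} (hD : IsDyadicLattice D)
    {W : EuclideanSpace ℝ (Fin d) → Matrix (Fin n) (Fin n) ℝ} (hW : IsMatrixWeight W)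
    (hA : matrixAr r W < ∞) {B₁ : Type u} {B₂ : Type v} [NormedAddCommGroup B₁] [NormedSpace ℝ B₁]
    [NormedAddCommGroup B₂] [NormedSpace ℝ B₂]
    {F : Submodule ℝ (EuclideanSpace ℝ (Fin d) → B₁)}
    {G : Submodule ℝ (EuclideanSpace ℝ (Fin d) → StrongDual ℝ B₂)}
    {T : F →ₗ[ℝ] (EuclideanSpace ℝ (Fin d) →ₘ[volume] B₂)} {C₁ : ℝ≥0}
    (hT : HasConvexBodyDomination n D F G T γ C₁) (hG : stepFunctions (StrongDual ℝ B₂) D ≤ G)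
    (f : Fin n → F) :
    weightedNorm r W (fun i => (T (f i) : EuclideanSpace ℝ (Fin d) → B₂)) ≤
      ((n ^ 2 * sparseConst d n r γ : ℝ≥0) : ℝ≥0∞) * C₁ *
        matrixAr r W ^ (1 + 1 / (r - 1) - 1 / r) *
        weightedNorm r W (fun i => (f i : EuclideanSpace ℝ (Fin d) → B₁)) := by
  set K := ((n ^ 2 * sparseConst d n r γ : ℝ≥0) : ℝ≥0∞) * C₁ *
        matrixAr r W ^ (1 + 1 / (r - 1) - 1 / r) *
        weightedNorm r W (fun i => (f i : EuclideanSpace ℝ (Fin d) → B₁)) with hK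
  rcases eq_or_ne K ∞ with hKt | hKt
  · rw [hKt]
    exact le_top
  refine hW.weightedNorm_le_of_stepFunctions hn hr hA hD (fun i => (T (f i)).aestronglyMeasurable)
    hKt (fun g hg i => hT.integrable (f i) g (hG hg)) fun g hg => ?_
  have h1 := hT.ofReal_pairing_le hn hr hγ hD hW hA f fun i => ⟨g i, hG (hg i)⟩
  rwa [weightedNorm_dual_eq hr hW] at h1

end

/-! ### The main theorem -/

theorem mainTheorem6 (d n : ℕ) (hd : 1 ≤ d) (hn : 1 ≤ n) (r : ℝ) (hr : 1 < r)
    (γ : ℝ) (hγ : 0 < γ) :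
    ∃ C : ℝ≥0,
      -- the operator is bounded on `L^r`
      (∀ (D : Set (Cube d)), IsDyadicLattice D →
        ∀ (W : EuclideanSpace ℝ (Fin d) → Matrix (Fin n) (Fin n) ℝ), IsMatrixWeight W →
        matrixAr r W < ∞ →
        ∀ S ⊆ D, IsSparse γ S →
        ∀ f : EuclideanSpace ℝ (Fin d) → ℝ, MemLp f (ENNReal.ofReal r) volume →
          MemLp (sparseOp r W S f) (ENNReal.ofReal r) volume ∧
          eLpNorm (sparseOp r W S f) (ENNReal.ofReal r) volume ≤
            C * matrixAr r W ^ (1 + 1 / (r - 1) - 1 / r) *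
              eLpNorm f (ENNReal.ofReal r) volume) ∧
      -- matrix-weighted bounds from convex body domination
      (∀ (D : Set (Cube d)), IsDyadicLattice D →
        ∀ (W : EuclideanSpace ℝ (Fin d) → Matrix (Fin n) (Fin n) ℝ), IsMatrixWeight W →
        matrixAr r W < ∞ →
        ∀ (B₁ : Type u) (B₂ : Type v) [NormedAddCommGroup B₁] [NormedSpace ℝ B₁]
          [CompleteSpace B₁] [NormedAddCommGroup B₂] [NormedSpace ℝ B₂] [CompleteSpace B₂]
          (F : Submodule ℝ (EuclideanSpace ℝ (Fin d) → B₁))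
          (G : Submodule ℝ (EuclideanSpace ℝ (Fin d) → StrongDual ℝ B₂))
          (T : F →ₗ[ℝ] (EuclideanSpace ℝ (Fin d) →ₘ[volume] B₂)) (C₁ : ℝ≥0),
          HasConvexBodyDomination n D F G T γ C₁ →
          (∀ (f : Fin n → F) (g : Fin n → G),
            ENNReal.ofReal |pairing T f g| ≤
              C * C₁ * matrixAr r W ^ (1 + 1 / (r - 1) - 1 / r) *
                weightedNorm r W (fun i => (f i : EuclideanSpace ℝ (Fin d) → B₁)) *
                weightedNorm (Real.conjExponent r)
                  (fun x => matPow (W x) (-(Real.conjExponent r / r)))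
                  (fun i => (g i : EuclideanSpace ℝ (Fin d) → StrongDual ℝ B₂))) ∧
          (stepFunctions (StrongDual ℝ B₂) D ≤ G →
            ∀ f : Fin n → F,
              weightedNorm r W (fun i => (T (f i) : EuclideanSpace ℝ (Fin d) → B₂)) ≤
                C * C₁ * matrixAr r W ^ (1 + 1 / (r - 1) - 1 / r) *
                  weightedNorm r W (fun i => (f i : EuclideanSpace ℝ (Fin d) → B₁)))) := by

  -- The factor n^2 is needed only for convex bodies; enlarging the constant of the sparse operator
  -- lets one constant serve both parts.
  have hC : sparseConst d n r γ ≤ n ^ 2 * sparseConst d n r γ :=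
    le_mul_of_one_le_left zero_le (one_le_pow₀ (by exact_mod_cast hn))
  have he : 0 ≤ 1 + 1 / (r - 1) - 1 / r := by
    have h1 : 1 / r ≤ 1 := (div_le_one (by linarith)).2 hr.le
    have h2 : 0 ≤ 1 / (r - 1) := one_div_nonneg.2 (by linarith)
    linarith
  refine ⟨n ^ 2 * sparseConst d n r γ, fun D hD W hW hA S hSD hS f hf => ?_,
    fun D hD W hW hA B₁ B₂ _ _ _ _ _ _ F G T C₁ hT =>
      ⟨hT.ofReal_pairing_le hn hr hγ hD hW hA, hT.weightedNorm_le hn hr hγ hD hW hA⟩⟩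
  have h1 : eLpNorm (sparseOp r W S f) (ENNReal.ofReal r) volume ≤
      ((n ^ 2 * sparseConst d n r γ : ℝ≥0) : ℝ≥0∞) *
        matrixAr r W ^ (1 + 1 / (r - 1) - 1 / r) * eLpNorm f (ENNReal.ofReal r) volume := by
    refine (hW.eLpNorm_sparseOp_le hn hr hA hγ hD hSD hS hf.1).trans ?_
    gcongr
  refine ⟨⟨(hW.aemeasurable_sparseOp r (hS.countable hγ) hf.1).aestronglyMeasurable,
    h1.trans_lt ?_⟩, h1⟩
  exact ENNReal.mul_lt_top (ENNReal.mul_lt_top ENNReal.coe_lt_top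
    (ENNReal.rpow_lt_top_of_nonneg he hA.ne)) hf.2
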